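/- Let $(M,g)$ be a closed (compact, without boundary) smooth Riemannian manifold of dimension $2n$ with an $SU(n)$-structure, i.e. a smooth almost complex structure $J$ with $g(JX,JY)=g(X,Y)$ and a smooth complex $n$-form $\Psi$ of type $(n,0)$ (that is, $\Psi(JX_1,X_2,\dots,X_n)=i\,\Psi(X_1,\dots,X_n)$) of unit length for the Hermitian extension of the inner product of real $n$-forms. Let $\nabla$ be the Levi-Civita connection and $R(X,Y)=[\nabla_X,\nabla_Y]-\nabla_{[X,Y]}$. Put $\mathfrak{u}(n)=\{A\in\mathfrak{so}(2n): AJ=JA\}$, $\mathfrak{su}(n)=\{A\in\mathfrak{u}(n):\operatorname{tr}(AJ)=0\}$, take orthogonal complements in $\mathfrak{so}(2n)$ for the form $\operatorname{tr}(AB)$, and decompose $\mathfrak{su}(n)^\perp=\mathfrak{u}(n)^\perp\oplus\mathbb{R}J$; the projection of $\mathfrak{so}(2n)$ onto $\mathbb{R}J$ is $A\mapsto A_{\mathbb R}=-\frac1{2n}\operatorname{tr}(AJ)J$ and the projection onto $\mathfrak{su}(n)^\perp$ is $A\mapsto A_{\mathfrak{su}(n)^\perp}=\frac12(A+JAJ)+A_{\mathbb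 R}$. Let $\xi$ be the intrinsic torsion of the $SU(n)$-structure, i.e. the unique tensor with $\xi_X\in\mathfrak{su}(n)^\perp(TM)$ such that $\nabla+\xi$ makes $J$ and $\Psi$ parallel, and let $\xi^{U(n)}$ be the intrinsic torsion of the underlying $U(n)$-structure, i.e. the unique tensor with $\xi^{U(n)}_X\in\mathfrak{u}(n)^\perp(TM)$ such that $\nabla+\xi^{U(n)}$ makes $J$ parallel. For local orthonormal frames $(e_i)$ put $$\chi^{U(n)}=\sum_i\xi^{U(n)}_{e_i}e_i,\qquad s_{\mathbb R}=\sum_{i,j}g\big(R(e_i,e_j)_{\mathbb R}e_j,e_i\big),\qquad s^{\rm alt}_{\mathfrak{su}(n)^\perp}=\sum_{i,j}g\big([\xi_{e_i},\xi_{e_j}]_{\mathfrak{su}(n)^\perp}e_j,e_i\big),$$ and let $\eta$ be a $1$-form inducing the $\mathcal W_5$-component of $\xi$, i.e. $-\frac1{2n}\sum_i g(\xi_XJe_i,e_i)\,JY=\eta(JX)\,JY$ for all $X,Y$. Then the functions $\eta(\chi^{U(n)})$, $s_{\mathbb R}$ and $s^{\rm alt}_{\mathfrak{su}(n)^\perp}$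 are integrable for the Riemannian volume, and $$8\int_M\eta(\chi^{U(n)})\,{\rm vol}_M=\int_M\big(s_{\mathbb R}-s^{\rm alt}_{\mathfrak{su}(n)^\perp}\big)\,{\rm vol}_M .$$ In particular, if $\xi^{U(n)}\in\mathcal W_1\oplus\mathcal W_2\oplus\mathcal W_3$ at every point, then $\int_M s_{\mathbb R}\,{\rm vol}_M=\int_M s^{\rm alt}_{\mathfrak{su}(n)^\perp}\,{\rm vol}_M$. Here $\mathcal W_1,\mathcal W_2,\mathcal W_3$ are the subspaces of $T^*M\otimes\mathfrak{u}(n)^\perp(TM)$ given by $\zeta_XY=-\zeta_YX$; by $g(\zeta_XY,Z)+g(\zeta_ZX,Y)+g(\zeta_YZ,X)=0$; and by $\zeta_XY=\zeta_{JX}(JY)$ together with $\sum_i\zeta_{e_i}e_i=0$, respectively. -/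

import Mathlib

open Bundle MeasureTheory
open scoped Manifold ContDiff

noncomputable section

namespace SUGeom

section Connection

variable {E : Type*} [NormedAddCommGroup E] [NormedSpace ℝ E] [FiniteDimensional ℝ E]
  {H : Type*} [TopologicalSpace H] {I : ModelWithCorners ℝ E H}
  {M : Type*} [TopologicalSpace M] [ChartedSpace H M] [IsManifold I ∞ M]
  [RiemannianBundle (fun x : M ↦ TangentSpace I x)]

/-- The Koszul expression, which equals `2 g(∇_X Y, Z)` for the Levi-Civita connection `∇`. -/
def koszul (X Y Z : Π x : M, TangentSpace I x) (x : M) : ℝ :=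
  d% (fun p ↦ inner ℝ (Y p) (Z p)) x (X x) + d% (fun p ↦ inner ℝ (X p) (Z p)) x (Y x)
    - d% (fun p ↦ inner ℝ (X p) (Y p)) x (Z x)
    + inner ℝ (VectorField.mlieBracket I X Y x) (Z x)
    - inner ℝ (VectorField.mlieBracket I X Z x) (Y x)
    - inner ℝ (VectorField.mlieBracket I Y Z x) (X x)

variable [IsContMDiffRiemannianBundle I ∞ E (fun x : M ↦ TangentSpace I x)]


theorem mdifferentiableAt_inner {X Y : Π x : M, TangentSpace I x} {x : M}
    (hX : MDiffAt (T% X) x) (hY : MDiffAt (T% Y) x) :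
    MDiffAt (fun p ↦ inner ℝ (X p) (Y p)) x := by
  have : IsContMDiffRiemannianBundle I 1 E (fun x : M ↦ TangentSpace I x) := inferInstance
  exact MDifferentiableAt.inner_bundle (F := E) (E := fun x : M ↦ TangentSpace I x) (b := id) hX hY

theorem koszul_tensorial_left {Y Z : Π x : M, TangentSpace I x} {x : M}
    (hY : MDiffAt (T% Y) x) (hZ : MDiffAt (T% Z) x) :
    TensorialAt I E (fun X ↦ koszul X Y Z x) x where
  smul {f X} hf hX := by
    have h1 := mvfderiv_mul hf (mdifferentiableAt_inner hX hZ)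
    have h2 := mvfderiv_mul hf (mdifferentiableAt_inner hX hY)
    have e1 : (fun p ↦ inner ℝ ((f • X) p) (Z p)) = f * fun p ↦ inner ℝ (X p) (Z p) := by
      ext p; simp [inner_smul_left]
    have e2 : (fun p ↦ inner ℝ ((f • X) p) (Y p)) = f * fun p ↦ inner ℝ (X p) (Y p) := by
      ext p; simp [inner_smul_left]
    simp only [koszul, e1, e2, h1, h2, VectorField.mlieBracket_smul_left hf hX]
    simp [inner_add_left, inner_smul_left, inner_smul_right]
    ring_nf
  add {X X'} hX hX' := by
    have h1 := mvfderiv_add (mdifferentiableAt_inner hX hZ) (mdifferentiableAt_inner hX' hZ)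
    have h2 := mvfderiv_add (mdifferentiableAt_inner hX hY) (mdifferentiableAt_inner hX' hY)
    have e1 : (fun p ↦ inner ℝ ((X + X') p) (Z p)) =
      (fun p ↦ inner ℝ (X p) (Z p)) + fun p ↦ inner ℝ (X' p) (Z p) := by
      ext p; simp [inner_add_left]
    have e2 : (fun p ↦ inner ℝ ((X + X') p) (Y p)) =
      (fun p ↦ inner ℝ (X p) (Y p)) + fun p ↦ inner ℝ (X' p) (Y p) := by
      ext p; simp [inner_add_left]
    simp only [koszul, e1, e2, h1, h2, VectorField.mlieBracket_add_left hX hX']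
    simp [inner_add_left, inner_add_right]
    ring_nf

theorem koszul_tensorial_right {X Y : Π x : M, TangentSpace I x} {x : M}
    (hX : MDiffAt (T% X) x) (hY : MDiffAt (T% Y) x) :
    TensorialAt I E (fun Z ↦ koszul X Y Z x) x where
  smul {f Z} hf hZ := by
    have h1 := mvfderiv_mul hf (mdifferentiableAt_inner hX hZ)
    have h2 := mvfderiv_mul hf (mdifferentiableAt_inner hY hZ)
    have e1 : (fun p ↦ inner ℝ (X p) ((f • Z) p)) = f * fun p ↦ inner ℝ (X p) (Z p) := by
      ext p; simp [inner_smul_right]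
    have e2 : (fun p ↦ inner ℝ (Y p) ((f • Z) p)) = f * fun p ↦ inner ℝ (Y p) (Z p) := by
      ext p; simp [inner_smul_right]
    simp only [koszul, e1, e2, h1, h2, VectorField.mlieBracket_smul_right hf hZ]
    simp [inner_add_left, inner_smul_left, inner_smul_right, real_inner_comm (Z x)]
    ring_nf
  add {Z Z'} hZ hZ' := by
    have h1 := mvfderiv_add (mdifferentiableAt_inner hX hZ) (mdifferentiableAt_inner hX hZ')
    have h2 := mvfderiv_add (mdifferentiableAt_inner hY hZ) (mdifferentiableAt_inner hY hZ')
    have e1 : (fun p ↦ inner ℝ (X p) ((Z + Z') p)) =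
      (fun p ↦ inner ℝ (X p) (Z p)) + fun p ↦ inner ℝ (X p) (Z' p) := by
      ext p; simp [inner_add_right]
    have e2 : (fun p ↦ inner ℝ (Y p) ((Z + Z') p)) =
      (fun p ↦ inner ℝ (Y p) (Z p)) + fun p ↦ inner ℝ (Y p) (Z' p) := by
      ext p; simp [inner_add_right]
    simp only [koszul, e1, e2, h1, h2, VectorField.mlieBracket_add_right hZ hZ']
    simp [inner_add_left, inner_add_right]
    ring_nf

open Classical in
/-- The bilinear form `(X, Z) ↦ g(∇_X Y, Z)` at `x`, given by half the Koszul expression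
(and by the junk value `0` if the vector field `Y` is not differentiable at `x`). -/
def leviCivitaForm (Y : Π x : M, TangentSpace I x) (x : M) :
    TangentSpace I x →L[ℝ] TangentSpace I x →L[ℝ] ℝ :=
  if hY : MDiffAt (T% Y) x then
    (1 / 2 : ℝ) • TensorialAt.mkHom₂ (fun X Z ↦ koszul X Y Z x) x
      (fun _ hZ ↦ koszul_tensorial_left hY hZ) (fun _ hX ↦ koszul_tensorial_right hX hY)
  else 0


instance (x : M) : FiniteDimensional ℝ (TangentSpace I x) :=
  inferInstanceAs (FiniteDimensional ℝ E)

instance (x : M) : CompleteSpace (TangentSpace I x) := FiniteDimensional.complete ℝ _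

/-- `∇_u Y`, obtained from the Koszul form by raising an index. -/
def leviCivitaFun (Y : Π x : M, TangentSpace I x) (x : M) : TangentSpace I x →L[ℝ] TangentSpace I x :=
  LinearMap.toContinuousLinearMap
    { toFun u := (InnerProductSpace.toDual ℝ (TangentSpace I x)).symm (leviCivitaForm Y x u)
      map_add' u v := by simp
      map_smul' c u := by simp }

theorem inner_leviCivitaFun {X Y Z : Π x : M, TangentSpace I x} {x : M} (hX : MDiffAt (T% X) x)
    (hY : MDiffAt (T% Y) x) (hZ : MDiffAt (T% Z) x) :
    inner ℝ (leviCivitaFun Y x (X x)) (Z x) = 1 / 2 * koszul X Y Z x := by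
  have : inner ℝ (leviCivitaFun Y x (X x)) (Z x) = leviCivitaForm Y x (X x) (Z x) := by simp [leviCivitaFun]
  rw [this, leviCivitaForm, dif_pos hY, ← TensorialAt.mkHom₂_apply
    (fun _ hZ ↦ koszul_tensorial_left hY hZ) (fun _ hX ↦ koszul_tensorial_right hX hY) hX hZ]
  simp

theorem clm_ext_vectorField {x : M} {A B : TangentSpace I x →L[ℝ] TangentSpace I x}
    (h : ∀ X Z : Π x : M, TangentSpace I x, MDiffAt (T% X) x → MDiffAt (T% Z) x →
      inner ℝ (A (X x)) (Z x) = inner ℝ (B (X x)) (Z x)) : A = B := by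
  ext u
  refine ext_inner_right ℝ fun w ↦ ?_
  simpa using h (FiberBundle.extend E u) (FiberBundle.extend E w)
    (FiberBundle.mdifferentiableAt_extend ..) (FiberBundle.mdifferentiableAt_extend ..)

/-- The Levi-Civita connection of the Riemannian metric; `leviCivita Y x u` is `∇_u Y` at `x`. -/
def leviCivita : CovariantDerivative I E (fun x : M ↦ TangentSpace I x) where
  toFun := leviCivitaFun
  isCovariantDerivativeOnUniv :=
    { add {Y Y' x} hY hY' _ := by
        refine clm_ext_vectorField fun X Z hX hZ ↦ ?_
        have h1 := mvfderiv_add (mdifferentiableAt_inner hY hZ) (mdifferentiableAt_inner hY' hZ)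
        have h2 := mvfderiv_add (mdifferentiableAt_inner hX hY) (mdifferentiableAt_inner hX hY')
        have e1 : (fun p ↦ inner ℝ ((Y + Y') p) (Z p)) =
            (fun p ↦ inner ℝ (Y p) (Z p)) + fun p ↦ inner ℝ (Y' p) (Z p) := by
          ext p; simp [inner_add_left]
        have e2 : (fun p ↦ inner ℝ (X p) ((Y + Y') p)) =
            (fun p ↦ inner ℝ (X p) (Y p)) + fun p ↦ inner ℝ (X p) (Y' p) := by
          ext p; simp [inner_add_right]
        have hs : MDiffAt (T% (Y + Y')) x := mdifferentiableAt_add_section hY hY'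
        rw [inner_leviCivitaFun hX hs hZ, _root_.add_apply, inner_add_left,
          inner_leviCivitaFun hX hY hZ, inner_leviCivitaFun hX hY' hZ]
        simp only [koszul, e1, e2, h1, h2, VectorField.mlieBracket_add_right hY hY',
          VectorField.mlieBracket_add_left hY hY']
        simp [inner_add_left, inner_add_right]
        ring_nf
      leibniz {Y f x} hY hf _ := by
        refine clm_ext_vectorField fun X Z hX hZ ↦ ?_
        have h1 := mvfderiv_mul hf (mdifferentiableAt_inner hY hZ)
        have h2 := mvfderiv_mul hf (mdifferentiableAt_inner hX hY)
        have e1 : (fun p ↦ inner ℝ ((f • Y) p) (Z p)) = f * fun p ↦ inner ℝ (Y p) (Z p) := by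
          ext p; simp [inner_smul_left]
        have e2 : (fun p ↦ inner ℝ (X p) ((f • Y) p)) = f * fun p ↦ inner ℝ (X p) (Y p) := by
          ext p; simp [inner_smul_right]
        have hs : MDiffAt (T% (f • Y)) x := hf.smul_section hY
        rw [inner_leviCivitaFun hX hs hZ, _root_.add_apply, inner_add_left,
          _root_.smul_apply, inner_smul_left, inner_leviCivitaFun hX hY hZ]
        simp only [koszul, e1, e2, h1, h2, VectorField.mlieBracket_smul_right hf hY,
          VectorField.mlieBracket_smul_left hf hY]
        simp [inner_add_left, inner_smul_left, inner_smul_right, inner_add_right, real_inner_comm (X x) (Y x)]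
        ring_nf }

/-- The Levi-Civita connection is torsion free. -/
theorem leviCivita_torsion : (leviCivita (I := I) (M := M)).torsion = 0 := by
  rw [CovariantDerivative.torsion_eq_zero_iff]
  intro X Y x hX hY
  refine ext_inner_right ℝ fun w ↦ ?_
  have hZ := FiberBundle.mdifferentiableAt_extend I E w
  have h1 := inner_leviCivitaFun hX hY hZ
  have h2 := inner_leviCivitaFun hY hX hZ
  rw [FiberBundle.extend_apply_self] at h1 h2
  change inner ℝ (leviCivitaFun Y x (X x) - leviCivitaFun X x (Y x)) w = _
  rw [inner_sub_left, h1, h2]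
  have e (U V : Π x : M, TangentSpace I x) : (fun p ↦ inner ℝ (U p) (V p)) =
    fun p ↦ inner ℝ (V p) (U p) := by ext p; rw [real_inner_comm]
  simp only [koszul, VectorField.mlieBracket_swap_apply (V := Y) (W := X), e Y X]
  simp
  ring_nf

/-- The Levi-Civita connection is compatible with the metric. -/
theorem leviCivita_metric {x : M} {X Y Z : Π x : M, TangentSpace I x} (hX : MDiffAt (T% X) x)
    (hY : MDiffAt (T% Y) x) (hZ : MDiffAt (T% Z) x) :
    d% (fun p ↦ inner ℝ (Y p) (Z p)) x (X x) =
      inner ℝ (leviCivita Y x (X x)) (Z x) + inner ℝ (Y x) (leviCivita Z x (X x)) := by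
  have h1 := inner_leviCivitaFun hX hY hZ
  have h2 := inner_leviCivitaFun hX hZ hY
  change _ = inner ℝ (leviCivitaFun Y x (X x)) (Z x) + inner ℝ (Y x) (leviCivitaFun Z x (X x))
  rw [real_inner_comm (leviCivitaFun Z x (X x)), h1, h2]
  have e (U V : Π x : M, TangentSpace I x) : (fun p ↦ inner ℝ (U p) (V p)) =
    fun p ↦ inner ℝ (V p) (U p) := by ext p; rw [real_inner_comm]
  simp only [koszul, VectorField.mlieBracket_swap_apply (V := Z) (W := Y), e Z Y]
  simp
  ring_nf

/-- The Riemann curvature `R(u, v) w = ∇_u ∇_v w - ∇_v ∇_u w - ∇_{[u, v]} w`, evaluated on tangent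
vectors at `x` by extending them to vector fields that are smooth near `x`. -/
def curvature (x : M) (u v w : TangentSpace I x) : TangentSpace I x :=
  leviCivita (fun y ↦ leviCivita (FiberBundle.extend E w) y (FiberBundle.extend E v y)) x u
    - leviCivita (fun y ↦ leviCivita (FiberBundle.extend E w) y (FiberBundle.extend E u y)) x v
    - leviCivita (FiberBundle.extend E w) x
        (VectorField.mlieBracket I (FiberBundle.extend E u) (FiberBundle.extend E v) x)

end Connection

section Volume

variable (m : ℕ) (M : Type*) [TopologicalSpace M] [T2Space M] [CompactSpace M]
  [ChartedSpace (EuclideanSpace ℝ (Fin m)) M] [IsManifold (𝓡 m) ∞ M]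
  [RiemannianBundle (fun x : M ↦ TangentSpace (𝓡 m) x)]

variable {M} in
/-- The matrix `g(∂ᵢ, ∂ⱼ)` in the preferred chart around `c`, at the point with coordinates `y`. -/
def gramMatrix (c : M) (y : EuclideanSpace ℝ (Fin m)) : Matrix (Fin m) (Fin m) ℝ :=
  let D := mfderiv (𝓡 m) (𝓡 m) (chartAt (EuclideanSpace ℝ (Fin m)) c).symm y
  Matrix.of fun i j ↦ inner ℝ (D (EuclideanSpace.single i 1)) (D (EuclideanSpace.single j 1))

/-- A smooth partition of unity subordinate to the preferred charts. -/
def chartPartition : SmoothPartitionOfUnity M (𝓡 m) M Set.univ :=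
  (SmoothPartitionOfUnity.exists_isSubordinate_chartAt_source (𝓡 m) M).choose

/-- The Riemannian volume measure: `dvol = √(det g) dy` in every chart, where the charts are glued
by a partition of unity. -/
def riemannianVolume [MeasurableSpace M] : Measure M :=
  Measure.sum fun c : M ↦
    (((volume : Measure (EuclideanSpace ℝ (Fin m))).restrict
        (chartAt (EuclideanSpace ℝ (Fin m)) c).target).withDensity fun y ↦
      ENNReal.ofReal (chartPartition m M c ((chartAt (EuclideanSpace ℝ (Fin m)) c).symm y) *
        √(gramMatrix m c y).det)).map (chartAt (EuclideanSpace ℝ (Fin m)) c).symm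

end Volume

section LinearAlgebra

variable {V : Type*} [NormedAddCommGroup V] [InnerProductSpace ℝ V] [FiniteDimensional ℝ V]

/-- The orthogonal Lie algebra `so(V)`. -/
def soAlg (V : Type*) [NormedAddCommGroup V] [InnerProductSpace ℝ V] :
    Submodule ℝ (Module.End ℝ V) where
  carrier := {A | ∀ u v, inner ℝ (A u) v = -inner ℝ u (A v)}
  add_mem' {A B} hA hB u v := by simp [inner_add_left, inner_add_right, hA u v, hB u v]; ring
  zero_mem' u v := by simp
  smul_mem' c A hA u v := by simp [inner_smul_left, inner_smul_right, hA u v]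

/-- `u(n) = {A ∈ so(2n) | AJ = JA}`. -/
def uAlg (J : Module.End ℝ V) : Submodule ℝ (Module.End ℝ V) where
  carrier := {A | A ∈ soAlg V ∧ A * J = J * A}
  add_mem' {A B} hA hB := ⟨add_mem hA.1 hB.1, by rw [add_mul, mul_add, hA.2, hB.2]⟩
  zero_mem' := ⟨zero_mem _, by simp⟩
  smul_mem' c A hA := ⟨Submodule.smul_mem _ c hA.1, by simp [hA.2]⟩

/-- `su(n) = {A ∈ u(n) | tr (AJ) = 0}`. -/
def suAlg (J : Module.End ℝ V) : Submodule ℝ (Module.End ℝ V) where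
  carrier := {A | A ∈ uAlg J ∧ LinearMap.trace ℝ V (A * J) = 0}
  add_mem' {A B} hA hB := ⟨add_mem hA.1 hB.1, by rw [add_mul, map_add, hA.2, hB.2, add_zero]⟩
  zero_mem' := ⟨zero_mem _, by simp⟩
  smul_mem' c A hA := ⟨Submodule.smul_mem _ c hA.1, by simp [hA.2]⟩

/-- The orthogonal complement in `so(V)` of a subspace `𝔤`, for the trace form `tr (AB)`. -/
def perpAlg (𝔤 : Submodule ℝ (Module.End ℝ V)) : Submodule ℝ (Module.End ℝ V) where
  carrier := {A | A ∈ soAlg V ∧ ∀ B ∈ 𝔤, LinearMap.trace ℝ V (A * B) = 0}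
  add_mem' {A A'} hA hA' := ⟨add_mem hA.1 hA'.1, fun B hB ↦ by
    rw [add_mul, map_add, hA.2 B hB, hA'.2 B hB, add_zero]⟩
  zero_mem' := ⟨zero_mem _, by simp⟩
  smul_mem' c A hA := ⟨Submodule.smul_mem _ c hA.1, fun B hB ↦ by simp [hA.2 B hB]⟩

/-- The component in the summand `ℝ = ℝJ` of `so(2n) = su(n) ⊕ u(n)^⊥ ⊕ ℝ`, that is,
`A ↦ -(1/2n) tr(AJ) J`, where `2n = dim V`. -/
def scalarPart (J : Module.End ℝ V) (A : V → V) : Module.End ℝ V :=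
  (-(1 / (Module.finrank ℝ V : ℝ)) * ∑ i, inner ℝ (A (J (stdOrthonormalBasis ℝ V i)))
    (stdOrthonormalBasis ℝ V i)) • J

/-- The orthogonal projection of `so(2n)` onto `su(n)^⊥ = u(n)^⊥ ⊕ ℝ`, that is,
`A ↦ (1/2)(A + JAJ) - (1/2n) tr(AJ) J`. -/
def suPerpPart (J : Module.End ℝ V) (A : Module.End ℝ V) : Module.End ℝ V :=
  (1 / 2 : ℝ) • (A + J * A * J) + scalarPart J A

/-- The vector `∑ᵢ ξ_{eᵢ} eᵢ` for an orthonormal basis `(eᵢ)`. -/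
def charVector (ξ : V →ₗ[ℝ] Module.End ℝ V) : V :=
  ∑ i, ξ (stdOrthonormalBasis ℝ V i) (stdOrthonormalBasis ℝ V i)

/-- The space `V^* ⊗ u(n)^⊥` of possible intrinsic torsions `ξ` (with `ξ u v = ξ_u v`) of
`U(n)`-structures. -/
def torsionSpace (J : Module.End ℝ V) : Submodule ℝ (V →ₗ[ℝ] Module.End ℝ V) where
  carrier := {ξ | ∀ u, ξ u ∈ perpAlg (uAlg J)}
  add_mem' hξ hζ u := add_mem (hξ u) (hζ u)
  zero_mem' _ := zero_mem _
  smul_mem' c _ hξ u := Submodule.smul_mem _ c (hξ u)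

/-- The Gray-Hervella class `W₁`: `ξ_u v = -ξ_v u`. -/
def classW1 (J : Module.End ℝ V) : Submodule ℝ (V →ₗ[ℝ] Module.End ℝ V) where
  carrier := {ξ | ξ ∈ torsionSpace J ∧ ∀ u v, ξ u v = -ξ v u}
  add_mem' {ξ ζ} hξ hζ := ⟨add_mem hξ.1 hζ.1, fun u v ↦ by
    simp [hξ.2 u v, hζ.2 u v, add_comm]⟩
  zero_mem' := ⟨zero_mem _, by simp⟩
  smul_mem' c ξ hξ := ⟨Submodule.smul_mem _ c hξ.1, fun u v ↦ by simp [hξ.2 u v]⟩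

/-- The Gray-Hervella class `W₂`: the cyclic sum of `g(ξ_u v, w)` vanishes. -/
def classW2 (J : Module.End ℝ V) : Submodule ℝ (V →ₗ[ℝ] Module.End ℝ V) where
  carrier := {ξ | ξ ∈ torsionSpace J ∧
    ∀ u v w, inner ℝ (ξ u v) w + inner ℝ (ξ w u) v + inner ℝ (ξ v w) u = 0}
  add_mem' {ξ ζ} hξ hζ := ⟨add_mem hξ.1 hζ.1, fun u v w ↦ by
    simp only [LinearMap.add_apply, inner_add_left]
    linear_combination hξ.2 u v w + hζ.2 u v w⟩
  zero_mem' := ⟨zero_mem _, by simp⟩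
  smul_mem' c ξ hξ := ⟨Submodule.smul_mem _ c hξ.1, fun u v w ↦ by
    simp only [LinearMap.smul_apply, real_inner_smul_left]
    linear_combination c * hξ.2 u v w⟩

/-- The Gray-Hervella class `W₃`: `ξ_u v = ξ_{Ju} (Jv)` and `∑ᵢ ξ_{eᵢ} eᵢ = 0`. -/
def classW3 (J : Module.End ℝ V) : Submodule ℝ (V →ₗ[ℝ] Module.End ℝ V) where
  carrier := {ξ | ξ ∈ torsionSpace J ∧ (∀ u v, ξ u v = ξ (J u) (J v)) ∧ charVector ξ = 0}
  add_mem' {ξ ζ} hξ hζ := ⟨add_mem hξ.1 hζ.1, fun u v ↦ by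
    simp [← hξ.2.1 u v, ← hζ.2.1 u v], by
    have h1 := hξ.2.2
    have h2 := hζ.2.2
    simp only [charVector] at h1 h2 ⊢
    simp [Finset.sum_add_distrib, h1, h2]⟩
  zero_mem' := ⟨zero_mem _, by simp, by simp [charVector]⟩
  smul_mem' c ξ hξ := ⟨Submodule.smul_mem _ c hξ.1, fun u v ↦ by simp [← hξ.2.1 u v], by
    have h1 := hξ.2.2
    simp only [charVector] at h1 ⊢
    simp [← Finset.smul_sum, h1]⟩

end LinearAlgebra

section Structure

variable (n : ℕ) (M : Type*) [TopologicalSpace M]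
  [ChartedSpace (EuclideanSpace ℝ (Fin (2 * n))) M] [IsManifold (𝓡 (2 * n)) ∞ M]
  [RiemannianBundle (fun x : M ↦ TangentSpace (𝓡 (2 * n)) x)]

variable {n M} in
/-- `X` is a smooth vector field. -/
def IsSmoothField (X : Π x : M, TangentSpace (𝓡 (2 * n)) x) : Prop :=
  ContMDiff (𝓡 (2 * n)) (𝓡 (2 * n)).tangent ∞
    fun x ↦ (⟨x, X x⟩ : TangentBundle (𝓡 (2 * n)) M)

/-- An `SU(n)`-structure on a Riemannian manifold of dimension `2n`: an orthogonal almost complex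
structure `J` and a complex volume form `Ψ`, i.e., a complex `n`-form of type `(n, 0)`, of unit
length for the Hermitian extension of the inner product of real `n`-forms. -/
structure SUStructure where
  /-- The almost complex structure. -/
  J : Π x : M, TangentSpace (𝓡 (2 * n)) x →L[ℝ] TangentSpace (𝓡 (2 * n)) x
  /-- The complex volume form. -/
  Ψ : Π x : M, TangentSpace (𝓡 (2 * n)) x [⋀^Fin n]→ₗ[ℝ] ℂ
  J_smooth : ContMDiff (𝓡 (2 * n))
    ((𝓡 (2 * n)).prod 𝓘(ℝ, EuclideanSpace ℝ (Fin (2 * n)) →L[ℝ] EuclideanSpace ℝ (Fin (2 * n)))) ∞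
    (fun x ↦ TotalSpace.mk' (EuclideanSpace ℝ (Fin (2 * n)) →L[ℝ] EuclideanSpace ℝ (Fin (2 * n)))
      (E := fun x : M ↦ TangentSpace (𝓡 (2 * n)) x →L[ℝ] TangentSpace (𝓡 (2 * n)) x) x (J x))
  J_J : ∀ x u, J x (J x u) = -u
  inner_J_J : ∀ x u v, inner ℝ (J x u) (J x v) = inner ℝ u v
  Ψ_smooth : ∀ X : Fin n → Π x : M, TangentSpace (𝓡 (2 * n)) x,
    (∀ k, IsSmoothField (X k)) → ContMDiff (𝓡 (2 * n)) 𝓘(ℝ, ℂ) ∞ (fun x ↦ Ψ x fun k ↦ X k x)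
  Ψ_J : ∀ x u k, Ψ x (Function.update u k (J x (u k))) = Complex.I * Ψ x u
  Ψ_norm : ∀ x, (1 / (n.factorial : ℝ)) *
    ∑ f : Fin n → Fin (Module.finrank ℝ (TangentSpace (𝓡 (2 * n)) x)),
      ‖Ψ x fun k ↦ stdOrthonormalBasis ℝ (TangentSpace (𝓡 (2 * n)) x) (f k)‖ ^ 2 = 1

variable {n M}
variable [IsContMDiffRiemannianBundle (𝓡 (2 * n)) ∞ (EuclideanSpace ℝ (Fin (2 * n)))
    (fun x : M ↦ TangentSpace (𝓡 (2 * n)) x)]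

namespace SUStructure

variable (S : SUStructure n M)

/-- `J` at `x`, as an element of the algebra of endomorphisms. -/
abbrev Jend (x : M) : Module.End ℝ (TangentSpace (𝓡 (2 * n)) x) := (S.J x).toLinearMap

variable (ξ : Π x : M, TangentSpace (𝓡 (2 * n)) x →ₗ[ℝ] Module.End ℝ (TangentSpace (𝓡 (2 * n)) x))

/-- The connection `(∇ + ξ)_u X` at `x`, where `∇` is the Levi-Civita connection. -/
def deformed (X : Π x : M, TangentSpace (𝓡 (2 * n)) x) (x : M) (u : TangentSpace (𝓡 (2 * n)) x) :
    TangentSpace (𝓡 (2 * n)) x :=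
  leviCivita X x u + ξ x u (X x)

/-- `J` is parallel for the connection `∇ + ξ`. -/
def ParallelJ : Prop :=
  ∀ X : Π x : M, TangentSpace (𝓡 (2 * n)) x, IsSmoothField X →
    ∀ x u, deformed ξ (fun y ↦ S.J y (X y)) x u = S.J x (deformed ξ X x u)

/-- `Ψ` is parallel for the connection `∇ + ξ`. -/
def ParallelΨ : Prop :=
  ∀ X : Fin n → Π x : M, TangentSpace (𝓡 (2 * n)) x, (∀ k, IsSmoothField (X k)) →
    ∀ (x : M) (u : TangentSpace (𝓡 (2 * n)) x), mvfderiv (𝓡 (2 * n)) (fun y ↦ S.Ψ y fun k ↦ X k y) x u =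
      ∑ k, S.Ψ x (Function.update (fun k ↦ X k x) k (deformed ξ (X k) x u))

/-- `ξ` is the intrinsic torsion of the underlying `U(n)`-structure: it takes values in
`u(n)^⊥`, and `∇ + ξ` is a `U(n)`-connection. -/
def IsTorsionU : Prop :=
  (∀ x u, ξ x u ∈ perpAlg (uAlg (S.Jend x))) ∧ S.ParallelJ ξ

/-- `ξ` is the intrinsic torsion of the `SU(n)`-structure: it takes values in
`su(n)^⊥`, and `∇ + ξ` is an `SU(n)`-connection. -/
def IsTorsionSU : Prop :=
  (∀ x u, ξ x u ∈ perpAlg (suAlg (S.Jend x))) ∧ S.ParallelJ ξ ∧ S.ParallelΨ ξ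

/-- The intrinsic torsion `ξ^{U(n)}` of the underlying `U(n)`-structure. -/
def torsionU (x : M) : TangentSpace (𝓡 (2 * n)) x →ₗ[ℝ] Module.End ℝ (TangentSpace (𝓡 (2 * n)) x) :=
  Classical.epsilon S.IsTorsionU x

/-- The intrinsic torsion of the `SU(n)`-structure. -/
def torsionSU (x : M) :
    TangentSpace (𝓡 (2 * n)) x →ₗ[ℝ] Module.End ℝ (TangentSpace (𝓡 (2 * n)) x) :=
  Classical.epsilon S.IsTorsionSU x

/-- The `W₅`-component `X, Y ↦ -(1/2n) ∑ᵢ g(ξ_X J eᵢ, eᵢ) JY` of the intrinsic torsion. -/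
def componentW5 (x : M) (u : TangentSpace (𝓡 (2 * n)) x) :
    Module.End ℝ (TangentSpace (𝓡 (2 * n)) x) :=
  scalarPart (S.Jend x) (S.torsionSU x u)

/-- The characteristic vector field `χ^{U(n)} = ∑ᵢ ξ^{U(n)}_{eᵢ} eᵢ`. -/
def charU (x : M) : TangentSpace (𝓡 (2 * n)) x := charVector (S.torsionU x)

/-- `s_ℝ = ∑ᵢⱼ g(R(eᵢ, eⱼ)_ℝ eⱼ, eᵢ)`. -/
def sReal (x : M) : ℝ :=
  let e := stdOrthonormalBasis ℝ (TangentSpace (𝓡 (2 * n)) x)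
  ∑ i, ∑ j, inner ℝ (scalarPart (S.Jend x) (curvature x (e i) (e j)) (e j)) (e i)

/-- `s^alt = ∑ᵢⱼ g([ξ_{eᵢ}, ξ_{eⱼ}]_{su(n)^⊥} eⱼ, eᵢ)`. -/
def sAlt (x : M) : ℝ :=
  let e := stdOrthonormalBasis ℝ (TangentSpace (𝓡 (2 * n)) x)
  ∑ i, ∑ j, inner ℝ (suPerpPart (S.Jend x) ⁅S.torsionSU x (e i), S.torsionSU x (e j)⁆ (e j)) (e i)

end SUStructure

end Structure

end SUGeom

end

open SUGeom

set_option linter.unusedSectionVars false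

noncomputable section

open scoped Topology

/-! Let Y be the metric dual of η (`leeField`) and χ the characteristic vector field. Everything
reduces to the pointwise identity s_ℝ − s^alt = 8 g(Y, χ) − 2 div Y (`sReal_sub_sAlt`): integrated
over a closed manifold, the divergence term disappears.

Both torsions are explicit. The tensor ξ^{U(n)} = −½ J(∇J) is skew and anticommutes with J, and ∇ +
ξ^{U(n)} preserves J, hence the forms of type (n,0). These form a complex line at each point, so
this connection sends Ψ to αΨ for a complex 1-form α. Since |Ψ| is constant and the connection is
metric, α = i n θ with θ real, and ξ = ξ^{U(n)} + θ ⊗ J makes Ψ parallel as well. Uniqueness holds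
because the trace form is definite on so(2n) (`torsionU_eq`, `torsionSU_eq`). Comparison with the
W₅-component gives θ = η ∘ J, that is, θ(v) = g(Y, Jv).

The curvature of ∇ + ξ commutes with J and annihilates Ψ, so its product with J is trace free.
Expanding it in terms of R, ξ^{U(n)} and θ yields tr(J R(u,v)) = 2n dθ(u,v) + tr(J[ξ^{U(n)}_u,
ξ^{U(n)}_v]) (`trace_curvature`); the derivatives of ξ^{U(n)} enter the trace only algebraically,
because ξ^{U(n)} anticommutes with J. Contraction with J gives s_ℝ = σ − 2 div Y + 4 g(Y, χ), with σ
= `scalarAlt`. The same σ occurs in s^alt = σ − 4 g(Y, χ), where the last term comes from the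
brackets of ξ^{U(n)} with θJ.

The divergence theorem (`integral_divergence`) follows from √(det g) div Z = Σ ∂ₖ(√(det g) Zᵏ) in a
chart, the change of variables formula and a partition of unity. Finally χ is linear in the torsion
and vanishes on each of W₁, W₂, W₃ (`charVector_eq_zero`). -/

namespace SUGeom

/-! ### Global smooth vector fields and tensoriality. -/

section SmoothFields

variable {E : Type*} [NormedAddCommGroup E] [NormedSpace ℝ E]
  {H : Type*} [TopologicalSpace H] {I : ModelWithCorners ℝ E H}
  {M : Type*} [TopologicalSpace M] [ChartedSpace H M] [IsManifold I ∞ M]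

/-- `X` is a smooth vector field on `M`. -/
def SmoothField (I : ModelWithCorners ℝ E H) {M : Type*} [TopologicalSpace M] [ChartedSpace H M]
    [IsManifold I ∞ M] (X : Π x : M, TangentSpace I x) : Prop :=
  ContMDiff I I.tangent ∞ fun x ↦ (⟨x, X x⟩ : TangentBundle I M)

namespace SmoothField

variable {X Y : Π x : M, TangentSpace I x} {f : M → ℝ}

theorem mdiffAt (hX : SmoothField I X) (x : M) : MDiffAt (T% X) x :=
  ContMDiffAt.mdifferentiableAt (hX x) (by simp)

theorem add (hX : SmoothField I X) (hY : SmoothField I Y) : SmoothField I (X + Y) :=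
  ContMDiff.add_section hX hY

theorem sub (hX : SmoothField I X) (hY : SmoothField I Y) : SmoothField I (X - Y) :=
  ContMDiff.sub_section hX hY

theorem smul (hf : CMDiff ∞ f) (hX : SmoothField I X) : SmoothField I (f • X) :=
  ContMDiff.smul_section hf hX

theorem const_smul (c : ℝ) (hX : SmoothField I X) : SmoothField I (c • X) :=
  ContMDiff.const_smul_section hX

theorem sum {ι : Type*} {s : Finset ι} {X : ι → Π x : M, TangentSpace I x}
    (hX : ∀ i ∈ s, SmoothField I (X i)) : SmoothField I (fun x ↦ ∑ i ∈ s, X i x) :=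
  ContMDiff.sum_section hX

theorem zero : SmoothField I (0 : Π x : M, TangentSpace I x) :=
  contMDiff_zeroSection _ _

theorem congr_nhds {X : Π x : M, TangentSpace I x}
    (h : ∀ x, ∃ Y : Π x : M, TangentSpace I x, SmoothField I Y ∧ ∀ᶠ y in 𝓝 x, X y = Y y) :
    SmoothField I X := by
  intro x
  obtain ⟨Y, hY, h⟩ := h x
  refine (hY x).congr_of_eventuallyEq ?_
  filter_upwards [h] with y hy
  rw [hy]

theorem mvfderiv_apply {F : Type*} [NormedAddCommGroup F] [NormedSpace ℝ F] {f : M → F}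
    (hf : CMDiff ∞ f) (hX : SmoothField I X) : CMDiff ∞ (fun x ↦ mvfderiv I f x (X x)) := by
  have h := (hf.contMDiff_tangentMap (m := ∞) (by simp)).comp hX
  exact (contMDiff_snd_tangentBundle_modelSpace F 𝓘(ℝ, F)).comp h

theorem mlieBracket [CompleteSpace E] (hX : SmoothField I X) (hY : SmoothField I Y) :
    SmoothField I (VectorField.mlieBracket I X Y) := by
  intro x
  have : IsManifold I (minSmoothness ℝ 2) M := by
    rw [minSmoothness_of_isRCLikeNormedField]; infer_instance
  have : IsManifold I ((∞ : ℕ∞ω) + 1) M := by simpa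
  exact ContMDiffAt.mlieBracket_vectorField (m := ⊤) (n := ⊤) (hX x) (hY x) (by simp)

end SmoothField

theorem exists_bump [FiniteDimensional ℝ E] [T2Space M] {x : M} {s : Set M} (hs : s ∈ 𝓝 x) :
    ∃ ψ : M → ℝ, CMDiff ∞ ψ ∧ tsupport ψ ⊆ s ∧ ∀ᶠ y in 𝓝 x, ψ y = 1 := by
  obtain ⟨ψ, -, h⟩ := (SmoothBumpFunction.nhds_basis_tsupport (I := I) (c := x)).mem_iff.1 hs
  exact ⟨ψ, ψ.contMDiff, h, ψ.eventuallyEq_one⟩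

/-- A vector field which is smooth near a point agrees near that point with a smooth field. -/
theorem exists_smoothField_eventuallyEq [FiniteDimensional ℝ E] [T2Space M] {x : M} {s : Set M}
    (hs : s ∈ 𝓝 x) (X : Π x : M, TangentSpace I x) (hX : CMDiff[s] ∞ (T% X)) :
    ∃ Y, SmoothField I Y ∧ ∀ᶠ y in 𝓝 x, Y y = X y := by
  obtain ⟨t, hts, ht, hxt⟩ := mem_nhds_iff.1 hs
  obtain ⟨ψ, hψ, hsupp, h1⟩ := exists_bump (I := I) (ht.mem_nhds hxt)
  refine ⟨ψ • X, ContMDiffOn.smul_section_of_tsupport hψ.contMDiffOn ht hsupp (hX.mono hts), ?_⟩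
  filter_upwards [h1] with y hy
  simp [hy]

theorem exists_smoothField_extend [FiniteDimensional ℝ E] [T2Space M] {x : M}
    (v : TangentSpace I x) :
    ∃ Y, SmoothField I Y ∧ ∀ᶠ y in 𝓝 x, Y y = FiberBundle.extend E v y := by
  obtain ⟨s, hs, h⟩   := FiberBundle.exists_contMDiffOn_extend (k := ∞) I E v
  exact exists_smoothField_eventuallyEq hs _ h

theorem exists_smoothField_apply_eq [FiniteDimensional ℝ E] [T2Space M] {x : M}
    (v : TangentSpace I x) : ∃ Y, SmoothField I Y ∧ Y x = v := by
  obtain ⟨Y, hY, h⟩ := exists_smoothField_extend v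
  exact ⟨Y, hY, by simpa using h.self_of_nhds⟩

/-- An operation on smooth vector fields which is linear over smooth functions, at a point `x`,
only depends on the value of the vector field at `x`. -/
theorem tensorial_congr [FiniteDimensional ℝ E] [T2Space M] {A : Type*} [AddCommGroup A]
    [Module ℝ A] {x : M} (T : (Π x : M, TangentSpace I x) → A)
    (hadd : ∀ X Y, SmoothField I X → SmoothField I Y → T (X + Y) = T X + T Y)
    (hsmul : ∀ (f : M → ℝ) X, CMDiff ∞ f → SmoothField I X → T (f • X) = f x • T X)
    {X Y : Π x : M, TangentSpace I x} (hX : SmoothField I X) (hY : SmoothField I Y)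
    (hXY : X x = Y x) : T X = T Y := by
  let t := trivializationAt E (TangentSpace I) x
  have hx : x ∈ t.baseSet := FiberBundle.mem_baseSet_trivializationAt' x
  let b := Module.finBasis ℝ E
  obtain ⟨ψ, hψ, hsupp, h1⟩ := exists_bump (I := I) (t.open_baseSet.mem_nhds hx)
  have hψx : ψ x = 1 := h1.self_of_nhds
  let e (i) : Π x : M, TangentSpace I x := ψ • t.localFrame b i
  have he (i) : SmoothField I (e i) :=
    ContMDiffOn.smul_section_of_tsupport hψ.contMDiffOn t.open_baseSet hsupp
      (t.contMDiffOn_localFrame_baseSet ∞ b i)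
  have key (Z : Π x : M, TangentSpace I x) (hZ : SmoothField I Z) :
      T Z = ∑ i, t.localFrameCoeff I b i x (Z x) • T (e i) := by
    let c (i) : M → ℝ := ψ • fun y ↦ t.localFrameCoeff I b i y (Z y)
    have hc (i) : CMDiff ∞ (c i) := by
      refine contMDiff_of_tsupport fun y hy ↦ ?_
      have hy' : y ∈ t.baseSet := hsupp (closure_mono (Function.support_smul_subset_left _ _) hy)
      exact (hψ y).smul (contMDiffAt_localFrameCoeff b hy' (hZ y) i)
    -- One factor ψ makes the coefficients global and the other makes the frame global, hence ψ²;
    -- its value at `x` is 1.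
    have h2 : (fun y ↦ ψ y * ψ y) • Z = fun y ↦ ∑ i, (c i • e i) y := by
      ext y
      by_cases hy : y ∈ t.baseSet
      · have := t.eq_sum_localFrameCoeff_smul (I := I) (b := b) (s := Z) hy
        simp only [Pi.smul_apply', c, e, smul_eq_mul]
        conv_lhs => rw [this]
        rw [Finset.smul_sum]
        refine Finset.sum_congr rfl fun i _ ↦ ?_
        simp only [smul_smul, Pi.mul_apply]
        ring_nf
      · have : ψ y = 0 := image_eq_zero_of_notMem_tsupport fun h ↦ hy (hsupp h)
        simp [c, e, this]
    have h0 : T 0 = 0 := by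
      simpa using hsmul (fun _ ↦ 0) 0 contMDiff_const SmoothField.zero
    have hsum (s : Finset (Fin (Module.finrank ℝ E))) :
        T (fun y ↦ ∑ i ∈ s, (c i • e i) y) = ∑ i ∈ s, T (c i • e i) := by
      classical
      induction s using Finset.induction_on with
      | empty => simpa using! h0
      | insert a s ha ih =>
        rw [Finset.sum_insert ha, ← ih, ← hadd _ _ ((he a).smul (hc a))
          (SmoothField.sum fun i _ ↦ (he i).smul (hc i))]
        congr 1
        ext y
        simp [Finset.sum_insert ha]
    have h3 := hsmul _ _ (hψ.mul hψ) hZ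
    have h4 : T ((fun y ↦ ψ y * ψ y) • Z) = T Z := by
      refine h3.trans ?_
      simp [hψx]
    rw [← h4, h2, hsum]
    refine Finset.sum_congr rfl fun i _ ↦ ?_
    rw [hsmul _ _ (hc i) (he i)]
    simp [c, hψx]
  rw [key X hX, key Y hY, hXY]

end SmoothFields

/-! ### Local orthonormal frames and smoothness of the Levi-Civita connection. -/

section OrthonormalFrame

variable {E : Type*} [NormedAddCommGroup E] [NormedSpace ℝ E] [FiniteDimensional ℝ E]
  {H : Type*} [TopologicalSpace H] {I : ModelWithCorners ℝ E H}
  {M : Type*} [TopologicalSpace M] [ChartedSpace H M] [IsManifold I ∞ M]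
  [RiemannianBundle (fun x : M ↦ TangentSpace I x)]
  [IsContMDiffRiemannianBundle I ∞ E (fun x : M ↦ TangentSpace I x)]

theorem contMDiffOn_inner {X Y : Π x : M, TangentSpace I x} {s : Set M}
    (hX : CMDiff[s] ∞ (T% X)) (hY : CMDiff[s] ∞ (T% Y)) :
    CMDiff[s] ∞ (fun p ↦ inner ℝ (X p) (Y p)) :=
  ContMDiffOn.inner_bundle (F := E) (E := fun x : M ↦ TangentSpace I x) (b := id) hX hY

theorem SmoothField.contMDiff_inner {X Y : Π x : M, TangentSpace I x}
    (hX : SmoothField I X) (hY : SmoothField I Y) :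
    CMDiff ∞ (fun p ↦ inner ℝ (X p) (Y p)) :=
  ContMDiff.inner_bundle (F := E) (E := fun x : M ↦ TangentSpace I x) (b := id) hX hY

/-- Each step of the algorithm is a rational expression in inner products with earlier vectors, and
linear independence keeps the denominators from vanishing on `s`. -/
theorem contMDiffOn_gramSchmidt {k : ℕ} {s : Set M} {X : Fin k → Π x : M, TangentSpace I x}
    (hX : ∀ i, CMDiff[s] ∞ (T% (X i))) (hli : ∀ x ∈ s, LinearIndependent ℝ (X · x)) (i : Fin k) :
    CMDiff[s] ∞ (T% fun x ↦ InnerProductSpace.gramSchmidt ℝ (X · x) i) := by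
  induction i using WellFoundedLT.induction with
  | ind i ih =>
    have h (j : Fin k) (hj : j ∈ Finset.Iio i) : CMDiff[s] ∞ (T% fun x ↦
        (inner ℝ (InnerProductSpace.gramSchmidt ℝ (X · x) j) (X i x) /
          inner ℝ (InnerProductSpace.gramSchmidt ℝ (X · x) j)
            (InnerProductSpace.gramSchmidt ℝ (X · x) j)) •
          InnerProductSpace.gramSchmidt ℝ (X · x) j) := by
      have hg := ih j (Finset.mem_Iio.1 hj)
      refine ContMDiffOn.smul_section
        ((contMDiffOn_inner hg (hX i)).div₀ (contMDiffOn_inner hg hg) fun x hx ↦ ?_) hg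
      exact inner_self_ne_zero.2 (InnerProductSpace.gramSchmidt_ne_zero j (hli x hx))
    refine (ContMDiffOn.sub_section (hX i) (ContMDiffOn.sum_section h)).congr fun x hx ↦ ?_
    congr 1
    rw [InnerProductSpace.gramSchmidt_def]
    simp [Submodule.starProjection_singleton]

/-- Around every point there is a smooth orthonormal frame, which may be taken to consist of
globally defined vector fields that are orthonormal near the point. -/
theorem exists_orthonormal_frame [T2Space M] (x : M) :
    ∃ e : Fin (Module.finrank ℝ E) → Π x : M, TangentSpace I x,
      (∀ i, SmoothField I (e i)) ∧ ∀ᶠ y in 𝓝 x, Orthonormal ℝ (e · y) := by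
  let t := trivializationAt E (TangentSpace I) x
  have hx : x ∈ t.baseSet := FiberBundle.mem_baseSet_trivializationAt' x
  let b := Module.finBasis ℝ E
  have hs : t.baseSet ∈ 𝓝 x := t.open_baseSet.mem_nhds hx
  have hfr := t.isLocalFrameOn_localFrame_baseSet I ∞ b
  have h (i) : CMDiff[t.baseSet] ∞ (T% fun x ↦
      InnerProductSpace.gramSchmidtNormed ℝ (t.localFrame b · x) i) := by
    have hg := contMDiffOn_gramSchmidt hfr.contMDiffOn (fun x hx ↦ hfr.linearIndependent hx) i
    have hne (y) (hy : y ∈ t.baseSet) := InnerProductSpace.gramSchmidt_ne_zero (𝕜 := ℝ) i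
      (hfr.linearIndependent hy)
    have h1 : CMDiff[t.baseSet] ∞ (fun y ↦
        ‖InnerProductSpace.gramSchmidt ℝ (t.localFrame b · y) i‖⁻¹) := by
      have h2 := contMDiffOn_inner hg hg
      have h3 : CMDiff[t.baseSet] ∞ (fun y ↦
        ‖InnerProductSpace.gramSchmidt ℝ (t.localFrame b · y) i‖) := by
        intro y hy
        have := (Real.contDiffAt_sqrt (n := ∞) (inner_self_ne_zero (𝕜 := ℝ).2
          (hne y hy))).contMDiffAt.comp_contMDiffWithinAt y (h2 y hy)
        refine this.congr (fun z _ ↦ norm_eq_sqrt_real_inner _)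
          (norm_eq_sqrt_real_inner _)
      exact h3.inv₀ fun y hy ↦ norm_ne_zero_iff.2 (hne y hy)
    exact h1.smul_section hg
  choose e he h1 using fun i ↦ exists_smoothField_eventuallyEq hs _ (h i)
  refine ⟨e, he, ?_⟩
  filter_upwards [Filter.eventually_all.2 h1, hs] with y hy hys
  simp_rw [hy]
  exact InnerProductSpace.gramSchmidtNormed_orthonormal (hfr.linearIndependent hys)

/-- An orthonormal family of `dim E` tangent vectors, as an orthonormal basis. -/
def onb {x : M} {e : Fin (Module.finrank ℝ E) → TangentSpace I x} (he : Orthonormal ℝ e) :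
    OrthonormalBasis (Fin (Module.finrank ℝ E)) ℝ (TangentSpace I x) :=
  OrthonormalBasis.mk he (by
    rw [he.linearIndependent.span_eq_top_of_card_eq_finrank']
    exact Fintype.card_fin _)

@[simp]
theorem onb_apply {x : M} {e : Fin (Module.finrank ℝ E) → TangentSpace I x} (he : Orthonormal ℝ e)
    (i : Fin (Module.finrank ℝ E)) : onb he i = e i := by
  simp [onb]

/-- A vector field is smooth if its inner products with smooth fields are. -/
theorem smoothField_of_inner [T2Space M] {Y : Π x : M, TangentSpace I x}
    (h : ∀ Z, SmoothField I Z → CMDiff ∞ (fun p ↦ inner ℝ (Z p) (Y p))) : SmoothField I Y := by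
  refine SmoothField.congr_nhds fun x ↦ ?_
  obtain ⟨e, he, h1⟩ := exists_orthonormal_frame (I := I) x
  refine ⟨fun y ↦ ∑ i, inner ℝ (e i y) (Y y) • e i y,
    SmoothField.sum fun i _ ↦ (he i).smul (h _ (he i)), ?_⟩
  filter_upwards [h1] with y hy
  simpa using ((onb hy).sum_repr' (Y y)).symm

theorem contMDiff_koszul {X Y Z : Π x : M, TangentSpace I x} (hX : SmoothField I X)
    (hY : SmoothField I Y) (hZ : SmoothField I Z) : CMDiff ∞ (koszul X Y Z) :=
  (((((SmoothField.mvfderiv_apply (hY.contMDiff_inner hZ) hX).add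
    (SmoothField.mvfderiv_apply (hX.contMDiff_inner hZ) hY)).sub
    (SmoothField.mvfderiv_apply (hX.contMDiff_inner hY) hZ)).add
    ((hX.mlieBracket hY).contMDiff_inner hZ)).sub ((hX.mlieBracket hZ).contMDiff_inner hY)).sub
    ((hY.mlieBracket hZ).contMDiff_inner hX)

/-- `∇_X Y` for the Levi-Civita connection. -/
def nabla (X Y : Π x : M, TangentSpace I x) (x : M) : TangentSpace I x := leviCivita Y x (X x)

/-- The connection is defined pointwise by raising an index of the Koszul form, so smoothness is
tested on inner products, which are Koszul expressions. -/
theorem SmoothField.nabla [T2Space M] {X Y : Π x : M, TangentSpace I x} (hX : SmoothField I X)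
    (hY : SmoothField I Y) : SmoothField I (nabla X Y) := by
  refine smoothField_of_inner fun Z hZ ↦ ?_
  have : (fun p ↦ inner ℝ (Z p) (SUGeom.nabla X Y p)) = fun p ↦ 1 / 2 * koszul X Y Z p := by
    ext p
    rw [real_inner_comm]
    exact inner_leviCivitaFun (hX.mdiffAt p) (hY.mdiffAt p) (hZ.mdiffAt p)
  rw [this]
  exact contMDiff_const.mul (contMDiff_koszul hX hY hZ)

end OrthonormalFrame

/-! ### The Lie bracket as a commutator of derivations. -/

section Bracket

variable {E : Type*} [NormedAddCommGroup E] [NormedSpace ℝ E] [FiniteDimensional ℝ E]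
  {H : Type*} [TopologicalSpace H] {I : ModelWithCorners ℝ E H}
  {M : Type*} [TopologicalSpace M] [ChartedSpace H M] [IsManifold I ∞ M]

theorem contMDiff_mdiffAt {F : Type*} [NormedAddCommGroup F] [NormedSpace ℝ F] {f : M → F}
    (hf : CMDiff ∞ f) (x : M) : MDiffAt f x :=
  (hf x).mdifferentiableAt (by simp)

theorem mvfderiv_clm_comp {F G : Type*} [NormedAddCommGroup F] [NormedSpace ℝ F]
    [NormedAddCommGroup G] [NormedSpace ℝ G] (L : F →L[ℝ] G) {f : M → F} {x : M}
    (hf : MDiffAt f x) (v : TangentSpace I x) :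
    mvfderiv I (fun y ↦ L (f y)) x v = L (mvfderiv I f x v) := by
  have h := mfderiv_comp x (L.contMDiff (n := 1).mdifferentiableAt one_ne_zero) hf
  simp only [mvfderiv, ContinuousLinearMap.comp_apply]
  have h2 : (fun y ↦ L (f y)) = L ∘ f := rfl
  rw [h2, h, L.mfderiv_eq]
  rfl

/-- The derivation property `[U, V] f = U (V f) - V (U f)` of the Lie bracket, for real functions. -/
theorem mvfderiv_mlieBracket_real [T2Space M] {U V : Π x : M, TangentSpace I x} {f : M → ℝ}
    (hU : SmoothField I U) (hV : SmoothField I V) (hf : CMDiff ∞ f) (x : M) :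
    mvfderiv I f x (VectorField.mlieBracket I U V x) =
      mvfderiv I (fun y ↦ mvfderiv I f y (V y)) x (U x) -
        mvfderiv I (fun y ↦ mvfderiv I f y (U y)) x (V x) := by
  -- The argument needs a field W that is nonzero at `x`; on a zero tangent space both sides vanish.
  by_cases hE : ∃ w : TangentSpace I x, w ≠ 0
  swap
  · push Not at hE
    rw [hE (U x), hE (V x), hE (VectorField.mlieBracket I U V x)]
    simp
  obtain ⟨w, hw⟩ := hE
  obtain ⟨W, hW, rfl⟩ := exists_smoothField_apply_eq w
  have m2 : minSmoothness ℝ 2 = 2 := minSmoothness_of_isRCLikeNormedField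
  have : IsManifold I (minSmoothness ℝ 2) M := by rw [m2]; infer_instance
  have : IsManifold I (minSmoothness ℝ 3) M := by
    rw [minSmoothness_of_isRCLikeNormedField]; infer_instance
  have cd {Z : Π x : M, TangentSpace I x} (hZ : SmoothField I Z) :
      CMDiffAt (minSmoothness ℝ 2) (T% Z) x := by
    rw [m2]; exact (hZ x).of_le ENat.LEInfty.out
  -- Compare the Jacobi identities for U, V, fW and for U, V, W. After expansion only a multiple of
  -- W survives, and its coefficient is the difference of the two sides of the claim.
  have J1 := VectorField.leibniz_identity_mlieBracket_apply (cd hU) (cd hV) (cd (hW.smul hf))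
  have J2 := VectorField.leibniz_identity_mlieBracket_apply (cd hU) (cd hV) (cd hW)
  have e {Z : Π x : M, TangentSpace I x} (hZ : SmoothField I Z) :
      VectorField.mlieBracket I Z (f • W) =
        (fun y ↦ mvfderiv I f y (Z y)) • W + f • VectorField.mlieBracket I Z W := by
    ext y
    rw [VectorField.mlieBracket_smul_right (contMDiff_mdiffAt hf y) (hW.mdiffAt y)]
    rfl
  have e2 {Z Z' : Π x : M, TangentSpace I x} (hZ : SmoothField I Z) (hZ' : SmoothField I Z') :
      VectorField.mlieBracket I Z (VectorField.mlieBracket I Z' (f • W)) x =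
        mvfderiv I (fun y ↦ mvfderiv I f y (Z' y)) x (Z x) • W x
        + mvfderiv I f x (Z' x) • VectorField.mlieBracket I Z W x
        + (mvfderiv I f x (Z x) • VectorField.mlieBracket I Z' W x
        + f x • VectorField.mlieBracket I Z (VectorField.mlieBracket I Z' W) x) := by
    have hd := SmoothField.mvfderiv_apply hf hZ'
    rw [e hZ', VectorField.mlieBracket_add_right ((hW.smul hd).mdiffAt x)
      (((hZ'.mlieBracket hW).smul hf).mdiffAt x),
      VectorField.mlieBracket_smul_right (contMDiff_mdiffAt hd x) (hW.mdiffAt x),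
      VectorField.mlieBracket_smul_right (contMDiff_mdiffAt hf x) ((hZ'.mlieBracket hW).mdiffAt x)]
  rw [e2 hU hV, e2 hV hU, e (hU.mlieBracket hV), J2] at J1
  have h0 : (mvfderiv I f x (VectorField.mlieBracket I U V x) -
      (mvfderiv I (fun y ↦ mvfderiv I f y (V y)) x (U x) -
        mvfderiv I (fun y ↦ mvfderiv I f y (U y)) x (V x))) • W x = 0 := by
    simp only [Pi.add_apply, Pi.smul_apply'] at J1
    rw [← sub_eq_zero] at J1
    rw [← neg_eq_zero, ← J1]
    module
  exact sub_eq_zero.1 ((smul_eq_zero.1 h0).resolve_right hw)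

/-- The derivation property `[U, V] f = U (V f) - V (U f)` of the Lie bracket. -/
theorem mvfderiv_mlieBracket [T2Space M] {F : Type*} [NormedAddCommGroup F] [NormedSpace ℝ F]
    {U V : Π x : M, TangentSpace I x} {f : M → F}
    (hU : SmoothField I U) (hV : SmoothField I V) (hf : CMDiff ∞ f) (x : M) :
    mvfderiv I f x (VectorField.mlieBracket I U V x) =
      mvfderiv I (fun y ↦ mvfderiv I f y (V y)) x (U x) -
        mvfderiv I (fun y ↦ mvfderiv I f y (U y)) x (V x) := by
  refine (SeparatingDual.eq_iff_forall_dual_eq (R := ℝ)).2 fun L ↦ ?_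
  have hL : CMDiff ∞ (fun y ↦ L (f y)) := L.contMDiff.comp hf
  have h := mvfderiv_mlieBracket_real hU hV hL x
  have e (y) (v : TangentSpace I y) : mvfderiv I (fun y ↦ L (f y)) y v = L (mvfderiv I f y v) :=
    mvfderiv_clm_comp L (contMDiff_mdiffAt hf y) v
  simp only [e] at h
  rw [mvfderiv_clm_comp L (contMDiff_mdiffAt (SmoothField.mvfderiv_apply hf hV) x),
    mvfderiv_clm_comp L (contMDiff_mdiffAt (SmoothField.mvfderiv_apply hf hU) x)] at h
  simpa using h

end Bracket

/-! ### Calculus of the Levi-Civita connection and its curvature operator. -/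

section Nabla

variable {E : Type*} [NormedAddCommGroup E] [NormedSpace ℝ E] [FiniteDimensional ℝ E]
  {H : Type*} [TopologicalSpace H] {I : ModelWithCorners ℝ E H}
  {M : Type*} [TopologicalSpace M] [ChartedSpace H M] [IsManifold I ∞ M]
  [RiemannianBundle (fun x : M ↦ TangentSpace I x)]
  [IsContMDiffRiemannianBundle I ∞ E (fun x : M ↦ TangentSpace I x)]
  {U V X Y Z : Π x : M, TangentSpace I x} {f : M → ℝ}

theorem leviCivita_add (hX : SmoothField I X) (hY : SmoothField I Y) (x : M)
    (u : TangentSpace I x) : leviCivita (X + Y) x u = leviCivita X x u + leviCivita Y x u := by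
  rw [leviCivita.isCovariantDerivativeOn.add (hX.mdiffAt x) (hY.mdiffAt x) (s := Set.univ)]
  rfl

theorem leviCivita_smul (hf : CMDiff ∞ f) (hX : SmoothField I X) (x : M) (u : TangentSpace I x) :
    leviCivita (f • X) x u = f x • leviCivita X x u + mvfderiv I f x u • X x := by
  rw [leviCivita.isCovariantDerivativeOn.leibniz (hX.mdiffAt x) (contMDiff_mdiffAt hf x)
    (s := Set.univ)]
  rfl

theorem leviCivita_sub (hX : SmoothField I X) (hY : SmoothField I Y) (x : M)
    (u : TangentSpace I x) : leviCivita (X - Y) x u = leviCivita X x u - leviCivita Y x u := by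
  have h := leviCivita_add (hX.sub hY) hY x u
  rw [sub_add_cancel] at h
  rw [h, add_sub_cancel_right]

theorem leviCivita_congr (hX : SmoothField I X) {x : M} (h : ∀ᶠ y in 𝓝 x, Y y = X y) :
    leviCivita Y x = leviCivita X x := by
  refine leviCivita.isCovariantDerivativeOn.congr_of_eventuallyEq ?_ (hX.mdiffAt x)
    (Filter.univ_mem) h
  refine (hX.mdiffAt x).congr_of_eventuallyEq ?_
  filter_upwards [h] with y hy
  rw [hy]

theorem nabla_sub_nabla (hX : SmoothField I X) (hY : SmoothField I Y) (x : M) :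
    nabla X Y x - nabla Y X x = VectorField.mlieBracket I X Y x :=
  (CovariantDerivative.torsion_eq_zero_iff _).1 leviCivita_torsion (hX.mdiffAt x) (hY.mdiffAt x)

theorem mvfderiv_inner (hY : SmoothField I Y) (hZ : SmoothField I Z) (x : M)
    (u : TangentSpace I x) : mvfderiv I (fun p ↦ inner ℝ (Y p) (Z p)) x u =
      inner ℝ (leviCivita Y x u) (Z x) + inner ℝ (Y x) (leviCivita Z x u) := by
  have h := leviCivita_metric (FiberBundle.mdifferentiableAt_extend I E u) (hY.mdiffAt x)
    (hZ.mdiffAt x)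
  simpa using h

variable (U V X) in
/-- The curvature operator `∇_U ∇_V X - ∇_V ∇_U X - ∇_{[U, V]} X`. -/
def curvOp (x : M) : TangentSpace I x :=
  nabla U (nabla V X) x - nabla V (nabla U X) x - nabla (VectorField.mlieBracket I U V) X x

/-- `curvature` uses extensions that are only known to be smooth near `x`. The connection and the
bracket are local, so global fields with the same germs compute it. -/
theorem curvature_eq_curvOp_of_eventuallyEq [T2Space M] (hU : SmoothField I U)
    (hV : SmoothField I V) (hX : SmoothField I X) {x : M} {u v w : TangentSpace I x}
    (hu : ∀ᶠ y in 𝓝 x, U y = FiberBundle.extend E u y)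
    (hv : ∀ᶠ y in 𝓝 x, V y = FiberBundle.extend E v y)
    (hw : ∀ᶠ y in 𝓝 x, X y = FiberBundle.extend E w y) :
    curvature x u v w = curvOp U V X x := by
  have hw' : ∀ᶠ y in 𝓝 x, leviCivita (FiberBundle.extend E w) y = leviCivita X y := by
    filter_upwards [hw.eventually_nhds] with y hy
    exact leviCivita_congr hX (hy.mono fun _ h ↦ h.symm)
  have h1 : ∀ᶠ y in 𝓝 x, leviCivita (FiberBundle.extend E w) y (FiberBundle.extend E v y) =
      nabla V X y := by
    filter_upwards [hw', hv] with y h1 h2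
    rw [h1, ← h2]; rfl
  have h2 : ∀ᶠ y in 𝓝 x, leviCivita (FiberBundle.extend E w) y (FiberBundle.extend E u y) =
      nabla U X y := by
    filter_upwards [hw', hu] with y h1 h2
    rw [h1, ← h2]; rfl
  have hu0 : U x = u := by simpa using hu.self_of_nhds
  have hv0 : V x = v := by simpa using hv.self_of_nhds
  rw [curvature, leviCivita_congr (hV.nabla hX) h1, leviCivita_congr (hU.nabla hX) h2,
    hw'.self_of_nhds, ← Filter.EventuallyEq.mlieBracket_vectorField_eq hu hv]
  simp only [curvOp, nabla, hu0, hv0]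

theorem curvOp_add [T2Space M] (hU : SmoothField I U) (hV : SmoothField I V)
    (hX : SmoothField I X) (hY : SmoothField I Y) (x : M) :
    curvOp U V (X + Y) x = curvOp U V X x + curvOp U V Y x := by
  have e {Z : Π x : M, TangentSpace I x} (hZ : SmoothField I Z) :
      nabla Z (X + Y) = nabla Z X + nabla Z Y := by
    ext y; exact leviCivita_add hX hY y _
  rw [curvOp, e hV, e hU, e (hU.mlieBracket hV), nabla,
    leviCivita_add (hV.nabla hX) (hV.nabla hY), nabla, leviCivita_add (hU.nabla hX) (hU.nabla hY)]
  simp only [curvOp, nabla, Pi.add_apply]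
  abel

/-- First derivatives of f cancel in the commutator; the second derivatives cancel against the
bracket term by the derivation property. -/
theorem curvOp_smul [T2Space M] (hU : SmoothField I U) (hV : SmoothField I V)
    (hf : CMDiff ∞ f) (hX : SmoothField I X) (x : M) :
    curvOp U V (f • X) x = f x • curvOp U V X x := by
  have e {Z : Π x : M, TangentSpace I x} (hZ : SmoothField I Z) :
      nabla Z (f • X) = f • nabla Z X + (fun y ↦ mvfderiv I f y (Z y)) • X := by
    ext y; exact leviCivita_smul hf hX y _
  have hd {Z : Π x : M, TangentSpace I x} (hZ : SmoothField I Z) :=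
    SmoothField.mvfderiv_apply hf hZ
  have e2 {Z Z' : Π x : M, TangentSpace I x} (hZ : SmoothField I Z) (hZ' : SmoothField I Z') :
      nabla Z (nabla Z' (f • X)) x = f x • nabla Z (nabla Z' X) x
        + mvfderiv I f x (Z x) • nabla Z' X x
        + (mvfderiv I f x (Z' x) • nabla Z X x
          + mvfderiv I (fun y ↦ mvfderiv I f y (Z' y)) x (Z x) • X x) := by
    rw [e hZ', nabla, leviCivita_add ((hZ'.nabla hX).smul hf) (hX.smul (hd hZ')),
      leviCivita_smul hf (hZ'.nabla hX), leviCivita_smul (hd hZ') hX]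
    rfl
  rw [curvOp, e2 hU hV, e2 hV hU, e (hU.mlieBracket hV)]
  simp only [curvOp, Pi.add_apply, Pi.smul_apply', mvfderiv_mlieBracket hU hV hf]
  module

/-- Tensoriality frees the last argument from the chosen extension, so that curvature can be handled
as an endomorphism in that slot and traced. -/
theorem curvature_eq_curvOp [T2Space M] (hU : SmoothField I U)
    (hV : SmoothField I V) (hX : SmoothField I X) {x : M} {u v : TangentSpace I x}
    (hu : ∀ᶠ y in 𝓝 x, U y = FiberBundle.extend E u y)
    (hv : ∀ᶠ y in 𝓝 x, V y = FiberBundle.extend E v y) :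
    curvature x u v (X x) = curvOp U V X x := by
  obtain ⟨W, hW, hw⟩ := exists_smoothField_extend (X x)
  rw [curvature_eq_curvOp_of_eventuallyEq hU hV hW hu hv hw]
  exact tensorial_congr (fun X ↦ curvOp U V X x) (fun X Y hX hY ↦ curvOp_add hU hV hX hY x)
    (fun f X hf hX ↦ curvOp_smul hU hV hf hX x) hW hX (by simpa using hw.self_of_nhds)

end Nabla

/-! ### Complex top-degree forms, determinants and traces. -/

section ComplexForms

variable {n : ℕ} {V : Type*} [AddCommGroup V] [Module ℝ V] [Module ℂ V] [IsScalarTower ℝ ℂ V]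

/-- A real alternating form with complex values that is complex linear in every argument, as a
complex alternating form. -/
def complexForm (f : V [⋀^Fin n]→ₗ[ℝ] ℂ)
    (hf : ∀ u k, f (Function.update u k (Complex.I • u k)) = Complex.I * f u) :
    V [⋀^Fin n]→ₗ[ℂ] ℂ where
  toFun := f
  map_update_add' {inst} u k x y := by
    obtain rfl := Subsingleton.elim inst (instDecidableEqFin n)
    exact f.map_update_add u k x y
  map_update_smul' {inst} u k c x := by
    obtain rfl := Subsingleton.elim inst (instDecidableEqFin n)
    have h := hf (Function.update u k x) k
    rw [Function.update_idem, Function.update_self] at h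
    have hc : c • x = c.re • x + c.im • (Complex.I • x) := by
      conv_lhs => rw [← Complex.re_add_im c]
      rw [add_smul, mul_smul, ← Complex.coe_algebraMap, algebraMap_smul, algebraMap_smul]
    rw [hc, f.map_update_add, f.map_update_smul, f.map_update_smul, h]
    simp only [Complex.real_smul, smul_eq_mul]
    conv_rhs => rw [← Complex.re_add_im c]
    ring
  map_eq_zero_of_eq' u _ _ h hij := f.map_eq_zero_of_eq u h hij

@[simp]
theorem complexForm_apply (f : V [⋀^Fin n]→ₗ[ℝ] ℂ)
    (hf : ∀ u k, f (Function.update u k (Complex.I • u k)) = Complex.I * f u) (u : Fin n → V) :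
    complexForm f hf u = f u := rfl

/-- Both forms are complex alternating of top degree, hence multiples of `e.det`. -/
theorem complexForm_unique (f g : V [⋀^Fin n]→ₗ[ℝ] ℂ)
    (hf : ∀ u k, f (Function.update u k (Complex.I • u k)) = Complex.I * f u)
    (hg : ∀ u k, g (Function.update u k (Complex.I • u k)) = Complex.I * g u)
    (e : Module.Basis (Fin n) ℂ V) (u v : Fin n → V) : g v * f u = g u * f v := by
  have h1 := AlternatingMap.eq_smul_basis_det e (complexForm f hf)
  have h2 := AlternatingMap.eq_smul_basis_det e (complexForm g hg)
  have h1' (w) : f w = f e * e.det w := congr($h1 w)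
  have h2' (w) : g w = g e * e.det w := congr($h2 w)
  rw [h1' u, h1' v, h2' u, h2' v]
  ring

theorem complexForm_basis_ne_zero (f : V [⋀^Fin n]→ₗ[ℝ] ℂ)
    (hf : ∀ u k, f (Function.update u k (Complex.I • u k)) = Complex.I * f u)
    (e : Module.Basis (Fin n) ℂ V) {u : Fin n → V} (hu : f u ≠ 0) : f e ≠ 0 := by
  intro h
  have h1 := AlternatingMap.eq_smul_basis_det e (complexForm f hf)
  have h1' : f u = f e * e.det u := congr($h1 u)
  rw [h1', h, zero_mul] at hu
  exact hu rfl

/-- When A eₖ is expanded in the basis, every off-diagonal term repeats an argument of `f`; what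
remains is the complex trace of A. -/
theorem complexForm_trace (f : V [⋀^Fin n]→ₗ[ℝ] ℂ)
    (hf : ∀ u k, f (Function.update u k (Complex.I • u k)) = Complex.I * f u)
    (e : Module.Basis (Fin n) ℂ V) (A : V →ₗ[ℂ] V) :
    ∑ k, f (Function.update e k (A (e k))) = (∑ k, e.repr (A (e k)) k) * f e := by
  rw [Finset.sum_mul]
  refine Finset.sum_congr rfl fun k _ ↦ ?_
  rw [← complexForm_apply f hf, ← complexForm_apply f hf]
  conv_lhs => rw [← e.sum_repr (A (e k))]
  rw [AlternatingMap.map_update_sum, Finset.sum_eq_single k]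
  · rw [AlternatingMap.map_update_smul, Function.update_eq_self, smul_eq_mul]
  · intro j _ hj
    rw [AlternatingMap.map_update_smul, AlternatingMap.map_update_self _ _ hj.symm, smul_zero]
  · simp

/-- A real trace is twice the real part of the complex trace, and Re(iz) = −Im z. -/
theorem trace_I_smul (e : Module.Basis (Fin n) ℂ V) (A : V →ₗ[ℂ] V) :
    LinearMap.trace ℝ V ((Complex.I • A).restrictScalars ℝ) =
      -2 * (∑ k, e.repr (A (e k)) k).im := by
  rw [LinearMap.trace_eq_matrix_trace ℝ (Complex.basisOneI.smulTower e), Matrix.trace,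
    Fintype.sum_prod_type]
  simp only [Matrix.diag, LinearMap.toMatrix_apply, Module.Basis.smulTower_apply,
    Module.Basis.smulTower_repr]
  simp [Complex.coe_basisOneI_repr]
  ring

end ComplexForms

/-! ### Forms of type (n,0) on a real vector space with J² = −1. -/

section AlmostComplex

variable {n : ℕ} {V : Type*} [AddCommGroup V] [Module ℝ V] {J : Module.End ℝ V}

/-- The complex vector space structure given by an endomorphism of square `-1`. -/
abbrev complexModule (hJ : J * J = -1) : Module ℂ V :=
  Module.compHom V (Complex.liftAux J hJ).toRingHom

theorem complexModule_smul (hJ : J * J = -1) (c : ℂ) (v : V) :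
    letI := complexModule hJ
    c • v = c.re • v + c.im • J v := by
  change Complex.liftAux J hJ c v = _
  simp [Complex.liftAux_apply, Algebra.algebraMap_eq_smul_one]

theorem complexModule_isScalarTower (hJ : J * J = -1) :
    letI := complexModule hJ
    IsScalarTower ℝ ℂ V := by
  let := complexModule hJ
  refine ⟨fun r c v ↦ ?_⟩
  rw [complexModule_smul, complexModule_smul]
  simp [mul_smul]

theorem complexModule_basis [FiniteDimensional ℝ V] (hJ : J * J = -1)
    (hn : Module.finrank ℝ V = 2 * n) :
    letI := complexModule hJ
    Nonempty (Module.Basis (Fin n) ℂ V) := by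
  let := complexModule hJ
  have := complexModule_isScalarTower hJ
  have : FiniteDimensional ℂ V := FiniteDimensional.right ℝ ℂ V
  have h := Module.finrank_mul_finrank ℝ ℂ V
  rw [hn, Complex.finrank_real_complex] at h
  exact ⟨Module.finBasisOfFinrankEq ℂ V (by omega)⟩

variable [FiniteDimensional ℝ V]

/-- Two forms of type `(n, 0)` are proportional. -/
theorem form_proportional (hJ : J * J = -1) (hn : Module.finrank ℝ V = 2 * n)
    (f g : V [⋀^Fin n]→ₗ[ℝ] ℂ)
    (hf : ∀ u k, f (Function.update u k (J (u k))) = Complex.I * f u)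
    (hg : ∀ u k, g (Function.update u k (J (u k))) = Complex.I * g u)
    (u v : Fin n → V) : g v * f u = g u * f v := by
  let := complexModule hJ
  have := complexModule_isScalarTower hJ
  obtain ⟨e⟩ := complexModule_basis hJ hn
  exact complexForm_unique f g (fun u k ↦ by simpa [complexModule_smul] using hf u k)
    (fun u k ↦ by simpa [complexModule_smul] using hg u k) e u v

/-- A complex linear endomorphism that acts trivially on a nonzero form of type `(n, 0)` has
vanishing complex trace. -/
theorem trace_eq_zero_of_form (hJ : J * J = -1) (hn : Module.finrank ℝ V = 2 * n)
    (f : V [⋀^Fin n]→ₗ[ℝ] ℂ)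
    (hf : ∀ u k, f (Function.update u k (J (u k))) = Complex.I * f u)
    {u : Fin n → V} (hu : f u ≠ 0) (A : Module.End ℝ V) (hA : A * J = J * A)
    (h : ∀ u, ∑ k, f (Function.update u k (A (u k))) = 0) :
    LinearMap.trace ℝ V (J * A) = 0 := by
  let := complexModule hJ
  have := complexModule_isScalarTower hJ
  obtain ⟨e⟩ := complexModule_basis hJ hn
  have hf' (u) (k) : f (Function.update u k (Complex.I • u k)) = Complex.I * f u := by
    simpa [complexModule_smul] using hf u k
  let AC : V →ₗ[ℂ] V :=
    { toFun := A
      map_add' := by simp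
      map_smul' c v := by
        have : A (J v) = J (A v) := congr($hA v)
        simp [complexModule_smul, this] }
  have h1 := complexForm_trace f hf' e AC
  have h2 : ∑ k, e.repr (AC (e k)) k = 0 :=
    (mul_eq_zero.1 (h1.symm.trans (h e))).resolve_right (complexForm_basis_ne_zero f hf' e hu)
  -- The complex trace of A has just been shown to vanish, and JA is multiplication by i after A.
  have h3 := trace_I_smul e AC
  rw [h2] at h3
  have h4 : (Complex.I • AC).restrictScalars ℝ = J * A := by
    ext v
    change Complex.I • A v = J (A v)
    simp [complexModule_smul]
  rw [← h4, h3]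
  simp

end AlmostComplex

/-! ### Orthonormal bases, the trace form, and u(n), su(n) inside so(2n). -/

section InnerAlgebra

variable {V : Type*} [NormedAddCommGroup V] [InnerProductSpace ℝ V] [FiniteDimensional ℝ V]
  {ι ι' : Type*} [Fintype ι] [Fintype ι']

/-- Expand one basis in the other and apply Parseval. The geometric quantities are defined with
`stdOrthonormalBasis`, of which no regularity in the point is known; this lets smooth local frames
replace it. -/
theorem sum_bilin_eq_of_orthonormalBasis {W : Type*} [AddCommGroup W] [Module ℝ W]
    (b : OrthonormalBasis ι ℝ V) (b' : OrthonormalBasis ι' ℝ V) (B : V →ₗ[ℝ] V →ₗ[ℝ] W) :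
    ∑ i, B (b i) (b i) = ∑ j, B (b' j) (b' j) := by
  classical
  have h (i : ι) : B (b i) (b i) =
      ∑ j, ∑ k, (inner ℝ (b' j) (b i) * inner ℝ (b i) (b' k)) • B (b' j) (b' k) := by
    conv_lhs => rw [← b'.sum_repr' (b i)]
    simp only [map_sum, map_smul, LinearMap.sum_apply, LinearMap.smul_apply, Finset.smul_sum,
      smul_smul, real_inner_comm (b i)]
    rw [Finset.sum_comm]
    simp only [mul_comm]
  simp_rw [h]
  rw [Finset.sum_comm]
  refine Finset.sum_congr rfl fun j _ ↦ ?_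
  rw [Finset.sum_comm, Finset.sum_eq_single j]
  · rw [← Finset.sum_smul, b.sum_inner_mul_inner]
    simp
  · intro k _ hk
    rw [← Finset.sum_smul, b.sum_inner_mul_inner, b'.inner_eq_zero hk.symm, zero_smul]
  · simp

/-- The Hilbert-Schmidt norm of a multilinear map does not depend on the orthonormal basis. -/
theorem sum_norm_sq_eq_of_orthonormalBasis {n : ℕ} {b : OrthonormalBasis ι ℝ V}
    {b' : OrthonormalBasis ι' ℝ V} (f : MultilinearMap ℝ (fun _ : Fin n ↦ V) ℂ) :
    ∑ s : Fin n → ι, ‖f fun k ↦ b (s k)‖ ^ 2 = ∑ s : Fin n → ι', ‖f fun k ↦ b' (s k)‖ ^ 2 := by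
  classical
  have h (s : Fin n → ι) : ‖f fun k ↦ b (s k)‖ ^ 2 = ∑ t : Fin n → ι', ∑ r : Fin n → ι',
      (∏ k, inner ℝ (b' (t k)) (b (s k)) * inner ℝ (b (s k)) (b' (r k))) *
        inner ℝ (f fun k ↦ b' (t k)) (f fun k ↦ b' (r k)) := by
    have : (f fun k ↦ b (s k)) = ∑ t : Fin n → ι',
        (∏ k, inner ℝ (b' (t k)) (b (s k))) • f fun k ↦ b' (t k) := by
      conv_lhs => enter [2, k]; rw [← b'.sum_repr' (b (s k))]
      rw [f.map_sum]
      refine Finset.sum_congr rfl fun t _ ↦ ?_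
      rw [f.map_smul_univ]
    rw [← real_inner_self_eq_norm_sq, this, sum_inner]
    refine Finset.sum_congr rfl fun t _ ↦ ?_
    rw [inner_sum]
    refine Finset.sum_congr rfl fun r _ ↦ ?_
    rw [real_inner_smul_left, real_inner_smul_right, ← mul_assoc, ← Finset.prod_mul_distrib]
    refine congrArg₂ _ (Finset.prod_congr rfl fun k _ ↦ ?_) rfl
    rw [real_inner_comm (b (s k)) (b' (r k))]
  simp_rw [h]
  rw [Finset.sum_comm]
  refine Finset.sum_congr rfl fun t _ ↦ ?_
  rw [Finset.sum_comm]
  simp_rw [← Finset.sum_mul]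
  have h2 (r : Fin n → ι') : ∑ s : Fin n → ι,
      ∏ k, inner ℝ (b' (t k)) (b (s k)) * inner ℝ (b (s k)) (b' (r k)) =
      ∏ k, inner ℝ (b' (t k)) (b' (r k)) := by
    -- The sum over multi-indices of a product factors into one Parseval sum for each slot.
    rw [← Finset.prod_congr rfl fun k _ ↦ b.sum_inner_mul_inner (b' (t k)) (b' (r k)),
      Finset.prod_univ_sum, Fintype.piFinset_univ]
  simp_rw [h2]
  rw [Finset.sum_eq_single t]
  · simp
  · intro r _ hr
    obtain ⟨k, hk⟩ := Function.ne_iff.1 hr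
    rw [Finset.prod_eq_zero (Finset.mem_univ k) (b'.inner_eq_zero hk.symm), zero_mul]
  · simp

/-- A skew rotation of the arguments of a multilinear map leaves its Hilbert-Schmidt norm
infinitesimally invariant. -/
theorem sum_inner_update_skew {n : ℕ} (b : OrthonormalBasis ι ℝ V)
    (f : MultilinearMap ℝ (fun _ : Fin n ↦ V) ℂ) (A : Module.End ℝ V) (hA : A ∈ soAlg V)
    (k : Fin n) :
    ∑ s : Fin n → ι, inner ℝ (f fun k ↦ b (s k))
      (f (Function.update (fun k ↦ b (s k)) k (A (b (s k))))) = 0 := by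
  classical
  -- A symmetric form is paired with a skew matrix here: exchanging the two summation indices
  -- changes the sign.
  have key : ∀ g : V →ₗ[ℝ] ℂ, ∑ i, inner ℝ (g (b i)) (g (A (b i))) = 0 := by
    intro g
    have h (i) : inner ℝ (g (b i)) (g (A (b i))) =
        ∑ j, inner ℝ (b j) (A (b i)) * inner ℝ (g (b i)) (g (b j)) := by
      conv_lhs => rw [← b.sum_repr' (A (b i))]
      simp only [map_sum, map_smul, inner_sum, real_inner_smul_right]
    simp_rw [h]
    have h2 : ∑ i, ∑ j, inner ℝ (b j) (A (b i)) * inner ℝ (g (b i)) (g (b j)) =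
        -∑ i, ∑ j, inner ℝ (b j) (A (b i)) * inner ℝ (g (b i)) (g (b j)) := by
      conv_lhs => rw [Finset.sum_comm]
      rw [← Finset.sum_neg_distrib]
      refine Finset.sum_congr rfl fun i _ ↦ ?_
      rw [← Finset.sum_neg_distrib]
      refine Finset.sum_congr rfl fun j _ ↦ ?_
      have := hA (b i) (b j)
      rw [real_inner_comm (g (b i)) (g (b j)), real_inner_comm (A (b i)) (b j)]
      linear_combination (inner ℝ (g (b i)) (g (b j))) * this
    linarith
  -- Freeze all indices but the `k`-th one; the form is then a linear map in the remaining argument.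
  rw [← (Equiv.funSplitAt k ι).symm.sum_comp, Fintype.sum_prod_type_right]
  refine Finset.sum_eq_zero fun s _ ↦ ?_
  let m : Fin n → V := fun j ↦ if h : j = k then 0 else b (s ⟨j, h⟩)
  have hm (i : ι) : (fun j ↦ b ((Equiv.funSplitAt k ι).symm (i, s) j)) =
      Function.update m k (b i) := by
    ext j
    by_cases h : j = k
    · subst h; simp [Equiv.funSplitAt, Equiv.piSplitAt]
    · simp [Equiv.funSplitAt, Equiv.piSplitAt, h, m]
  have hk (i : ι) : (Equiv.funSplitAt k ι).symm (i, s) k = i := by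
    simp [Equiv.funSplitAt, Equiv.piSplitAt]
  rw [← key (f.toLinearMap m k)]
  refine Finset.sum_congr rfl fun i _ ↦ ?_
  rw [hm, hk, Function.update_idem]
  rfl

variable {J : Module.End ℝ V}

theorem trace_skew {A : Module.End ℝ V} (hA : A ∈ soAlg V) : LinearMap.trace ℝ V A = 0 := by
  rw [LinearMap.trace_eq_sum_inner A (stdOrthonormalBasis ℝ V)]
  refine Finset.sum_eq_zero fun i _ ↦ ?_
  have := hA (stdOrthonormalBasis ℝ V i) (stdOrthonormalBasis ℝ V i)
  rw [real_inner_comm] at this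
  linarith

/-- For skew A, tr(A²) = −Σ|A eᵢ|². This definiteness is behind the uniqueness of both intrinsic
torsions. -/
theorem eq_zero_of_trace_mul_self {A : Module.End ℝ V} (hA : A ∈ soAlg V)
    (h : LinearMap.trace ℝ V (A * A) = 0) : A = 0 := by
  rw [LinearMap.trace_eq_sum_inner _ (stdOrthonormalBasis ℝ V)] at h
  have h2 (i) : inner ℝ (stdOrthonormalBasis ℝ V i) ((A * A) (stdOrthonormalBasis ℝ V i)) =
      -‖A (stdOrthonormalBasis ℝ V i)‖ ^ 2 := by
    rw [← real_inner_self_eq_norm_sq, hA]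
    simp
  simp_rw [h2] at h
  rw [Finset.sum_neg_distrib, neg_eq_zero, Finset.sum_eq_zero_iff_of_nonneg (by simp)] at h
  refine (stdOrthonormalBasis ℝ V).toBasis.ext fun i ↦ ?_
  simpa using h i (Finset.mem_univ i)

variable (hJ : ∀ u, J (J u) = -u) (hJi : ∀ u v, inner ℝ (J u) (J v) = inner ℝ u v)
include hJ

theorem J_mul_J : J * J = -1 := by
  ext u; simp [hJ]

/-- An endomorphism anticommuting with `J` is trace orthogonal to those commuting with `J`. -/
theorem trace_mul_eq_zero_of_anticomm {A B : Module.End ℝ V} (hA : A * J = -(J * A))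
    (hB : B * J = J * B) : LinearMap.trace ℝ V (A * B) = 0 := by
  -- The left side is tr(AB), because moving J through AB changes the sign once; the right side is
  -- −tr(AB).
  have h1 : LinearMap.trace ℝ V (J * (A * B * J)) = LinearMap.trace ℝ V (A * B * J * J) :=
    LinearMap.trace_mul_comm ℝ _ _
  have h2 : J * (A * B * J) = A * B := by
    calc J * (A * B * J) = (J * A) * (B * J) := by noncomm_ring
      _ = -(A * J) * (J * B) := by rw [hB, hA, neg_neg]
      _ = -(A * (J * J) * B) := by noncomm_ring
      _ = A * B := by rw [J_mul_J hJ]; noncomm_ring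
  have h3 : A * B * J * J = -(A * B) := by
    rw [mul_assoc, J_mul_J hJ]; noncomm_ring
  rw [h2, h3, map_neg] at h1
  linarith

theorem mem_perpAlg_uAlg_of_anticomm {A : Module.End ℝ V} (hA : A ∈ soAlg V)
    (hAJ : A * J = -(J * A)) : A ∈ perpAlg (uAlg J) :=
  ⟨hA, fun _ hB ↦ trace_mul_eq_zero_of_anticomm hJ hAJ hB.2⟩

theorem eq_zero_of_mem_uAlg_of_mem_perpAlg {A : Module.End ℝ V} (h : A ∈ uAlg J)
    (h' : A ∈ perpAlg (uAlg J)) : A = 0 :=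
  eq_zero_of_trace_mul_self h.1 (h'.2 A h)

theorem eq_zero_of_mem_suAlg_of_mem_perpAlg {A : Module.End ℝ V} (h : A ∈ suAlg J)
    (h' : A ∈ perpAlg (suAlg J)) : A = 0 :=
  eq_zero_of_trace_mul_self h.1.1 (h'.2 A h)

theorem perpAlg_uAlg_le : perpAlg (uAlg J) ≤ perpAlg (suAlg J) :=
  fun _ hA ↦ ⟨hA.1, fun B hB ↦ hA.2 B hB.1⟩

theorem trace_J_mul_J : LinearMap.trace ℝ V (J * J) = -(Module.finrank ℝ V : ℝ) := by
  rw [J_mul_J hJ, map_neg, LinearMap.trace_one]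

include hJi

theorem J_mem_soAlg : J ∈ soAlg V := fun u v ↦ by
  rw [← hJi u, hJ]; simp

theorem inner_J_left (u v : V) : inner ℝ (J u) v = -inner ℝ u (J v) := J_mem_soAlg hJ hJi u v

theorem J_mem_perpAlg_suAlg : J ∈ perpAlg (suAlg J) :=
  ⟨J_mem_soAlg hJ hJi, fun B hB ↦ by rw [LinearMap.trace_mul_comm]; exact hB.2⟩

/-- Here `B` and `C` are twice the components of A that commute and anticommute with J. Since `C` is
trace orthogonal to `B`, pairing A with `B` leaves ½ tr(B²) = 0, so `B` vanishes by definiteness. -/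
theorem anticomm_of_mem_perpAlg {A : Module.End ℝ V} (h : A ∈ perpAlg (uAlg J)) :
    A * J = -(J * A) := by
  have hJs := inner_J_left hJ hJi
  let B : Module.End ℝ V := A - J * A * J
  let C : Module.End ℝ V := A + J * A * J
  have h1 : J * A * J * J = -(J * A) := by rw [mul_assoc, J_mul_J hJ]; noncomm_ring
  have h2 : J * (J * A * J) = -(A * J) := by
    rw [← mul_assoc, ← mul_assoc, J_mul_J hJ]; noncomm_ring
  have hBs : B ∈ soAlg V := fun u v ↦ by
    have := h.1 (J u) (J v)
    simp only [B, LinearMap.sub_apply, Module.End.mul_apply, inner_sub_left, inner_sub_right,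
      h.1 u v, hJs, this]
    rw [← inner_J_left hJ hJi u (A (J v)), hJs]; ring
  have hB : B ∈ uAlg J := by
    refine ⟨hBs, ?_⟩
    simp only [B, sub_mul, mul_sub, h1, h2]
    abel
  have hC : C * J = -(J * C) := by
    simp only [C, add_mul, mul_add, h1, h2]
    abel
  have h3 := h.2 B hB
  have h4 := trace_mul_eq_zero_of_anticomm hJ hC hB.2
  have h5 : A * B = (1 / 2 : ℝ) • (B * B + C * B) := by
    rw [← add_mul]
    have : B + C = (2 : ℝ) • A := by simp only [B, C]; module
    rw [this, smul_mul_assoc, smul_smul]; norm_num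
  have h6 : LinearMap.trace ℝ V (B * B) = 0 := by
    rw [h5, map_smul, map_add, h4] at h3
    simpa using h3
  have h7 : A = J * A * J := sub_eq_zero.1 (eq_zero_of_trace_mul_self hBs h6)
  conv_lhs => rw [h7, h1]

end InnerAlgebra

/-! ### Pointwise contractions producing the two scalar quantities. -/

section TorsionAlgebra

variable {V : Type*} [NormedAddCommGroup V] [InnerProductSpace ℝ V] [FiniteDimensional ℝ V]
  {ι : Type*} [Fintype ι] {J : Module.End ℝ V}

theorem scalarPart_eq (A : Module.End ℝ V) :
    scalarPart J A = (-(1 / (Module.finrank ℝ V : ℝ)) * LinearMap.trace ℝ V (A * J)) • J := by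
  rw [scalarPart, LinearMap.trace_eq_sum_inner _ (stdOrthonormalBasis ℝ V)]
  simp only [Module.End.mul_apply, real_inner_comm (stdOrthonormalBasis ℝ V _)]

theorem charVector_eq (b : OrthonormalBasis ι ℝ V) (ξ : V →ₗ[ℝ] Module.End ℝ V) :
    charVector ξ = ∑ i, ξ (b i) (b i) :=
  sum_bilin_eq_of_orthonormalBasis (stdOrthonormalBasis ℝ V) b ξ

variable (J) in
/-- The double trace `∑ᵢⱼ g([ξ_{eᵢ}, ξ_{eⱼ}]_ℝ eⱼ, eᵢ)`. -/
def scalarAlt (ξ : V →ₗ[ℝ] Module.End ℝ V) : ℝ :=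
  let e := stdOrthonormalBasis ℝ V
  ∑ i, ∑ j, -(1 / (Module.finrank ℝ V : ℝ)) * LinearMap.trace ℝ V (⁅ξ (e i), ξ (e j)⁆ * J) *
    inner ℝ (J (e j)) (e i)

/-- A multiple of J contributes to a double trace through g(J eⱼ, eᵢ), the coefficients of J eⱼ; so
double traces of scalar parts collapse to single sums. -/
theorem sum_sum_mul_inner (b : OrthonormalBasis ι ℝ V) (F : V →ₗ[ℝ] V →ₗ[ℝ] ℝ) :
    ∑ i, ∑ j, F (b i) (b j) * inner ℝ (J (b j)) (b i) = ∑ j, F (J (b j)) (b j) := by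
  rw [Finset.sum_comm]
  refine Finset.sum_congr rfl fun j _ ↦ ?_
  conv_rhs => rw [← b.sum_repr' (J (b j))]
  simp only [map_sum, map_smul, LinearMap.sum_apply, LinearMap.smul_apply, smul_eq_mul]
  refine Finset.sum_congr rfl fun i _ ↦ ?_
  rw [real_inner_comm, mul_comm]

/-- The bilinear form `tr([ξ_u, ξ_v] J)`. -/
def traceBracket (J : Module.End ℝ V) (ξ : V →ₗ[ℝ] Module.End ℝ V) : V →ₗ[ℝ] V →ₗ[ℝ] ℝ :=
  LinearMap.mk₂ ℝ (fun u v ↦ LinearMap.trace ℝ V (⁅ξ u, ξ v⁆ * J))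
    (by simp [Ring.lie_def, add_mul, mul_add, sub_mul]; intros; ring)
    (by simp [Ring.lie_def, sub_mul, mul_sub])
    (by simp [Ring.lie_def, add_mul, mul_add, sub_mul]; intros; ring)
    (by simp [Ring.lie_def, sub_mul, mul_sub])

/-- This form is available in every orthonormal basis and serves to prove continuity in a local
frame. -/
theorem scalarAlt_eq (b : OrthonormalBasis ι ℝ V) (ξ : V →ₗ[ℝ] Module.End ℝ V) :
    scalarAlt J ξ = -(1 / (Module.finrank ℝ V : ℝ)) *
      ∑ j, LinearMap.trace ℝ V (⁅ξ (J (b j)), ξ (b j)⁆ * J) := by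
  have h := sum_sum_mul_inner (J := J) (stdOrthonormalBasis ℝ V) (traceBracket J ξ)
  have h2 := sum_bilin_eq_of_orthonormalBasis (stdOrthonormalBasis ℝ V) b
    (traceBracket J ξ ∘ₗ J)
  simp only [traceBracket, LinearMap.comp_apply, LinearMap.mk₂_apply] at h h2
  rw [← h2, ← h, scalarAlt, Finset.mul_sum]
  simp only [Finset.mul_sum, mul_assoc]

variable (hJ : ∀ u, J (J u) = -u) (hJi : ∀ u v, inner ℝ (J u) (J v) = inner ℝ u v)
include hJ hJi

/-- J is an isometry, so the vectors J eᵢ form another orthonormal basis. -/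
theorem sum_bilin_J {W : Type*} [AddCommGroup W] [Module ℝ W]
    (b : OrthonormalBasis ι ℝ V) (B : V →ₗ[ℝ] V →ₗ[ℝ] W) :
    ∑ i, B (J (b i)) (J (b i)) = ∑ j, B (b j) (b j) := by
  let L : V ≃ₗᵢ[ℝ] V :=
    (LinearMap.isometryOfInner J hJi).toLinearIsometryEquiv rfl
  exact sum_bilin_eq_of_orthonormalBasis (b.map L) b B

variable {ξ : V →ₗ[ℝ] Module.End ℝ V} (hs : ∀ u, ξ u ∈ soAlg V)
  (ha : ∀ u, ξ u * J = -(J * ξ u))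
include hs ha

/-- The bracket [ξ_u, ξ_v] commutes with J, so only its ℝJ-component survives. The mixed brackets,
such as [ξ_u, θ_v J] = 2θ_v ξ_u J, anticommute with J; they are left unchanged and have no
ℝJ-component. -/
theorem suPerpPart_bracket (θ : V →ₗ[ℝ] ℝ) (u v : V) :
    suPerpPart J ⁅ξ u + θ u • J, ξ v + θ v • J⁆ =
      (-(1 / (Module.finrank ℝ V : ℝ)) * LinearMap.trace ℝ V (⁅ξ u, ξ v⁆ * J)) • J +
        (2 * θ v) • (ξ u * J) - (2 * θ u) • (ξ v * J) := by
  have hJJ := J_mul_J hJ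
  have ha' (u) : J * ξ u = -(ξ u * J) := by rw [ha, neg_neg]
  have h1 : ⁅ξ u + θ u • J, ξ v + θ v • J⁆ =
      ⁅ξ u, ξ v⁆ + (2 * θ v) • (ξ u * J) - (2 * θ u) • (ξ v * J) := by
    simp only [Ring.lie_def, add_mul, mul_add, smul_mul_assoc, mul_smul_comm, ha']
    module
  have ht (u) : LinearMap.trace ℝ V (ξ u * J * J) = 0 := by
    rw [mul_assoc, hJJ, mul_neg_one, map_neg, trace_skew (hs u), neg_zero]
  have h2 (u) : J * (ξ u * J) * J = ξ u * J := by
    rw [← mul_assoc, ha', neg_mul, neg_mul, mul_assoc, mul_assoc, hJJ]; noncomm_ring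
  have h3 : J * ⁅ξ u, ξ v⁆ * J = -⁅ξ u, ξ v⁆ := by
    have h (u v) : J * (ξ u * ξ v) * J = -(ξ u * ξ v) := by
      rw [mul_assoc, mul_assoc, ha, mul_neg, mul_neg, ← mul_assoc (ξ u), ha, neg_mul, mul_neg,
        neg_neg, mul_assoc, ← mul_assoc, hJJ]
      noncomm_ring
    rw [Ring.lie_def, mul_sub, sub_mul, h, h]
    abel
  rw [h1, suPerpPart, scalarPart_eq]
  simp only [mul_add, mul_sub, add_mul, sub_mul, mul_smul_comm, smul_mul_assoc, h2, h3, map_add,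
    map_sub, map_smul, ht]
  module

/-- With χ = `charVector ξ`, each of the two mixed terms contracts to 2θ(Jχ) = −2 g(Y, χ), which
accounts for the coefficient −4. -/
theorem sum_suPerpPart_bracket {θ : V →ₗ[ℝ] ℝ} {Y : V} (hθ : ∀ v, θ v = inner ℝ Y (J v)) :
    ∑ i, ∑ j, inner ℝ (suPerpPart J ⁅ξ (stdOrthonormalBasis ℝ V i) +
        θ (stdOrthonormalBasis ℝ V i) • J, ξ (stdOrthonormalBasis ℝ V j) +
        θ (stdOrthonormalBasis ℝ V j) • J⁆ (stdOrthonormalBasis ℝ V j))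
        (stdOrthonormalBasis ℝ V i) =
      scalarAlt J ξ - 4 * inner ℝ Y (charVector ξ) := by
  simp only [suPerpPart_bracket hJ hJi hs ha, LinearMap.add_apply, LinearMap.sub_apply,
    LinearMap.smul_apply, Module.End.mul_apply, inner_add_left, inner_sub_left,
    real_inner_smul_left, Finset.sum_add_distrib, Finset.sum_sub_distrib]
  set e := stdOrthonormalBasis ℝ V
  have hχ : J (charVector ξ) = -∑ j, ξ (e j) (J (e j)) := by
    rw [charVector_eq e, map_sum, ← Finset.sum_neg_distrib]
    refine Finset.sum_congr rfl fun j _ ↦ ?_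
    have : ξ (e j) (J (e j)) = -J (ξ (e j) (e j)) := congr($(ha (e j)) (e j))
    rw [this, neg_neg]
  have hθχ : θ (J (charVector ξ)) = -inner ℝ Y (charVector ξ) := by
    rw [hθ, hJ, inner_neg_right]
  have h2 : ∑ i, ∑ j, 2 * θ (e j) * inner ℝ (ξ (e i) (J (e j))) (e i) =
      -2 * inner ℝ Y (charVector ξ) := by
    have h (j) : ∑ i, inner ℝ (ξ (e i) (J (e j))) (e i) = inner ℝ (e j) (J (charVector ξ)) := by
      rw [← neg_neg (inner ℝ (e j) (J (charVector ξ))), ← inner_J_left hJ hJi, charVector_eq e,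
        inner_sum, ← Finset.sum_neg_distrib]
      exact Finset.sum_congr rfl fun i _ ↦ hs _ _ _
    rw [Finset.sum_comm]
    simp_rw [← Finset.mul_sum, h, mul_assoc]
    rw [← Finset.mul_sum, neg_mul, ← mul_neg, ← hθχ]
    conv_rhs => rw [← e.sum_repr' (J (charVector ξ))]
    simp only [map_sum, map_smul, smul_eq_mul, mul_comm]
  have h3 : ∑ i, ∑ j, 2 * θ (e i) * inner ℝ (ξ (e j) (J (e j))) (e i) =
      2 * inner ℝ Y (charVector ξ) := by
    have h (i) : ∑ j, inner ℝ (ξ (e j) (J (e j))) (e i) =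
        -inner ℝ (e i) (J (charVector ξ)) := by
      rw [hχ, inner_neg_right, neg_neg, real_inner_comm, sum_inner]
    simp_rw [← Finset.mul_sum, h, mul_assoc]
    rw [← Finset.mul_sum, ← neg_neg (inner ℝ Y (charVector ξ)), ← hθχ]
    conv_rhs => rw [← e.sum_repr' (J (charVector ξ))]
    simp only [map_sum, map_smul, smul_eq_mul, mul_comm, mul_neg, Finset.sum_neg_distrib]
  rw [h2, h3, scalarAlt]
  ring

/-- In the application `B` is ∇Y and the bracketed expression in `hR` is dθ. Its contraction Σ dθ(J
eⱼ, eⱼ) is 2 tr B − 4 g(Y, χ): the trace occurs twice because J is an isometry, and Σ ξ(eⱼ, J eⱼ) =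
−Jχ, Σ ξ(J eⱼ, eⱼ) = Jχ. -/
theorem sum_scalarPart_curvature {R : V → V → Module.End ℝ V} {B : Module.End ℝ V} {Y : V}
    (hR : ∀ u v, LinearMap.trace ℝ V (J * R u v) = Module.finrank ℝ V *
        (inner ℝ (B u) (J v) - inner ℝ (B v) (J u) + 2 * inner ℝ Y (J (ξ u v))
          - 2 * inner ℝ Y (J (ξ v u))) + LinearMap.trace ℝ V (J * ⁅ξ u, ξ v⁆)) :
    ∑ i, ∑ j, inner ℝ (scalarPart J (R (stdOrthonormalBasis ℝ V i) (stdOrthonormalBasis ℝ V j))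
      (stdOrthonormalBasis ℝ V j)) (stdOrthonormalBasis ℝ V i) =
      scalarAlt J ξ - 2 * LinearMap.trace ℝ V B + 4 * inner ℝ Y (charVector ξ) := by
  set e := stdOrthonormalBasis ℝ V
  -- In dimension zero the factor 1/dim V has a default value, but all sums are empty.
  rcases eq_or_ne (Module.finrank ℝ V) 0 with h0 | h0
  · have : IsEmpty (Fin (Module.finrank ℝ V)) := by rw [h0]; infer_instance
    simp [scalarAlt, charVector, LinearMap.trace_eq_sum_inner _ e]
  have h0' : (Module.finrank ℝ V : ℝ) ≠ 0 := by exact_mod_cast h0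
  let F : V →ₗ[ℝ] V →ₗ[ℝ] ℝ := LinearMap.mk₂ ℝ
    (fun u v ↦ inner ℝ (B u) (J v) - inner ℝ (B v) (J u) + 2 * inner ℝ Y (J (ξ u v))
      - 2 * inner ℝ Y (J (ξ v u)))
    (by intros; simp [inner_add_left, inner_add_right]; ring)
    (by intros; simp [real_inner_smul_left, real_inner_smul_right]; ring)
    (by intros; simp [inner_add_left, inner_add_right]; ring)
    (by intros; simp [real_inner_smul_left, real_inner_smul_right]; ring)
  have h1 (i j) : inner ℝ (scalarPart J (R (e i) (e j)) (e j)) (e i) =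
      -(1 / (Module.finrank ℝ V : ℝ)) * LinearMap.trace ℝ V (⁅ξ (e i), ξ (e j)⁆ * J) *
        inner ℝ (J (e j)) (e i) - F (e i) (e j) * inner ℝ (J (e j)) (e i) := by
    rw [scalarPart_eq, LinearMap.trace_mul_comm ℝ _ J, hR, LinearMap.smul_apply,
      real_inner_smul_left, LinearMap.trace_mul_comm ℝ J]
    simp only [F, LinearMap.mk₂_apply]
    field_simp
    ring
  simp_rw [h1, Finset.sum_sub_distrib]
  rw [sum_sum_mul_inner, scalarAlt]
  have hJξ : ∑ j, ξ (e j) (J (e j)) = -J (charVector ξ) := by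
    rw [charVector_eq e, map_sum, ← Finset.sum_neg_distrib]
    exact Finset.sum_congr rfl fun j _ ↦ congr($(ha (e j)) (e j))
  have hJξ' : ∑ j, ξ (J (e j)) (e j) = J (charVector ξ) := by
    have h := sum_bilin_J hJ hJi e (ξ.compl₂ J)
    simp only [LinearMap.compl₂_apply, hJ, map_neg, Finset.sum_neg_distrib, hJξ] at h
    exact neg_injective h
  have hB : ∑ j, inner ℝ (B (J (e j))) (J (e j)) = LinearMap.trace ℝ V B := by
    rw [LinearMap.trace_eq_sum_inner B e]
    have h := sum_bilin_J hJ hJi e ((innerₗ V).compl₂ B)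
    simpa only [LinearMap.compl₂_apply, innerₗ_apply_apply, real_inner_comm] using h
  have hB' : ∑ j, inner ℝ (B (e j)) (J (J (e j))) = -LinearMap.trace ℝ V B := by
    rw [LinearMap.trace_eq_sum_inner B e]
    simp only [hJ, inner_neg_right, Finset.sum_neg_distrib, real_inner_comm]
  have hF : ∑ j, F (J (e j)) (e j) =
      2 * LinearMap.trace ℝ V B - 4 * inner ℝ Y (charVector ξ) := by
    simp only [F, LinearMap.mk₂_apply, Finset.sum_sub_distrib, Finset.sum_add_distrib, hB, hB',
      ← Finset.mul_sum, ← inner_sum, ← map_sum, hJξ, hJξ']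
    simp only [hJ, map_neg, inner_neg_right]
    ring
  rw [hF]
  ring

end TorsionAlgebra

/-! ### Vanishing of the characteristic vector on W₁, W₂ and W₃. -/

section GrayHervella

theorem eq_zero_of_eq_neg {V : Type*} [AddCommGroup V] [Module ℝ V] {x : V} (h : x = -x) :
    x = 0 := by
  have h2 : (2 : ℝ) • x = 0 := by rw [two_smul]; nth_rewrite 2 [h]; exact add_neg_cancel x
  exact (smul_eq_zero.1 h2).resolve_left two_ne_zero

variable {V : Type*} [NormedAddCommGroup V] [InnerProductSpace ℝ V] [FiniteDimensional ℝ V]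
  {J : Module.End ℝ V} (hJ : ∀ u, J (J u) = -u) (hJi : ∀ u v, inner ℝ (J u) (J v) = inner ℝ u v)

theorem charVector_eq_zero_of_classW1 {ξ : V →ₗ[ℝ] Module.End ℝ V} (h : ξ ∈ classW1 J) :
    charVector ξ = 0 :=
  Finset.sum_eq_zero fun _ _ ↦ eq_zero_of_eq_neg (h.2 _ _)

-- The cyclic identity and anticommutation with J force ξ_{Ju}(Jv) = −ξ_u v. Summing over the basis
-- J eᵢ instead of eᵢ then changes the sign of the characteristic vector without changing its value.
include hJ hJi in
theorem charVector_eq_zero_of_classW2 {ξ : V →ₗ[ℝ] Module.End ℝ V} (h : ξ ∈ classW2 J) :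
    charVector ξ = 0 := by
  have hs (u) : ξ u ∈ soAlg V := (h.1 u).1
  have ha (u v) : ξ u (J v) = -J (ξ u v) :=
    congr($(anticomm_of_mem_perpAlg hJ hJi (h.1 u)) v)
  have hJs := inner_J_left hJ hJi
  have hA (u v w) : inner ℝ (ξ u v) w + inner ℝ (ξ (J u) (J v)) w = 0 := by
    have c (u v w) : inner ℝ (ξ u v) w + inner ℝ (ξ (J u) (J v)) w +
        (inner ℝ (ξ w u) v + inner ℝ (ξ (J w) (J u)) v) = 0 := by
      have e1 := h.2 u v w
      have e2 := h.2 v (J w) (J u)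
      have e3 : inner ℝ (ξ v (J w)) (J u) = -inner ℝ (ξ v w) u := by
        rw [ha, inner_neg_left, hJi]
      have e4 : inner ℝ (ξ (J u) v) (J w) = inner ℝ (ξ (J u) (J v)) w := by
        rw [ha, inner_neg_left, hJs, neg_neg]
      linarith
    -- By `c` the quantity changes sign under a cyclic permutation; this has order three, so the
    -- quantity equals its own negative.
    linarith [c u v w, c w u v, c v w u]
  have h2 := sum_bilin_J hJ hJi (stdOrthonormalBasis ℝ V) ξ
  have h3 : ∑ i, ξ (J (stdOrthonormalBasis ℝ V i)) (J (stdOrthonormalBasis ℝ V i)) =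
      -charVector ξ := by
    rw [charVector, ← Finset.sum_neg_distrib]
    refine Finset.sum_congr rfl fun i _ ↦ ext_inner_right ℝ fun w ↦ ?_
    rw [inner_neg_left]
    linarith [hA (stdOrthonormalBasis ℝ V i) (stdOrthonormalBasis ℝ V i) w]
  rw [h3] at h2
  exact (eq_zero_of_eq_neg (h2.symm))

include hJ hJi in
theorem charVector_eq_zero {ξ : V →ₗ[ℝ] Module.End ℝ V}
    (h : ξ ∈ classW1 J ⊔ classW2 J ⊔ classW3 J) : charVector ξ = 0 := by
  obtain ⟨ζ, hζ, ξ₃, h₃, rfl⟩ := Submodule.mem_sup.1 h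
  obtain ⟨ξ₁, h₁, ξ₂, h₂, rfl⟩ := Submodule.mem_sup.1 hζ
  have e1 := charVector_eq_zero_of_classW1 h₁
  have e2 := charVector_eq_zero_of_classW2 hJ hJi h₂
  have e3 := h₃.2.2
  simp only [charVector] at e1 e2 e3 ⊢
  simp [Finset.sum_add_distrib, e1, e2, e3]

end GrayHervella

/-! ### Tensors obtained from operations on vector fields. -/

section Tensorial

variable {E : Type*} [NormedAddCommGroup E] [NormedSpace ℝ E] [FiniteDimensional ℝ E]
  {H : Type*} [TopologicalSpace H] {I : ModelWithCorners ℝ E H}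
  {M : Type*} [TopologicalSpace M] [ChartedSpace H M] [IsManifold I ∞ M] [T2Space M]

theorem mvfderiv_congr {F : Type*} [NormedAddCommGroup F] [NormedSpace ℝ F] {f g : M → F} {x : M}
    (h : ∀ᶠ y in 𝓝 x, f y = g y) (u : TangentSpace I x) :
    mvfderiv I f x u = mvfderiv I g x u := by
  have h1 := Filter.EventuallyEq.mfderiv_eq (I := I) (I' := 𝓘(ℝ, F)) h
  change mfderiv I 𝓘(ℝ, F) f x u = mfderiv I 𝓘(ℝ, F) g x u
  rw [h1]
  rfl

/-- An arbitrary smooth vector field with a given value at a point. -/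
def smoothExt {x : M} (v : TangentSpace I x) : Π x : M, TangentSpace I x :=
  (exists_smoothField_apply_eq v).choose

theorem smoothField_smoothExt {x : M} (v : TangentSpace I x) : SmoothField I (smoothExt v) :=
  (exists_smoothField_apply_eq v).choose_spec.1

@[simp]
theorem smoothExt_self {x : M} (v : TangentSpace I x) : smoothExt v x = v :=
  (exists_smoothField_apply_eq v).choose_spec.2

/-- The fields are exchanged one argument at a time, by induction on the set of arguments already
replaced. -/
theorem tensorial_pi_congr {ι : Type*} [Fintype ι] [DecidableEq ι] {A : Type*} [AddCommGroup A]
    [Module ℝ A] {x : M} (T : (ι → Π x : M, TangentSpace I x) → A)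
    (hadd : ∀ X k Y Z, (∀ i, SmoothField I (X i)) → SmoothField I Y → SmoothField I Z →
      T (Function.update X k (Y + Z)) = T (Function.update X k Y) + T (Function.update X k Z))
    (hsmul : ∀ X k (f : M → ℝ) Y, (∀ i, SmoothField I (X i)) → CMDiff ∞ f → SmoothField I Y →
      T (Function.update X k (f • Y)) = f x • T (Function.update X k Y))
    {X Y : ι → Π x : M, TangentSpace I x} (hX : ∀ i, SmoothField I (X i))
    (hY : ∀ i, SmoothField I (Y i)) (hXY : ∀ i, X i x = Y i x) : T X = T Y := by
  suffices h : ∀ s : Finset ι, T (s.piecewise Y X) = T X by simpa using (h Finset.univ).symm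
  intro s
  induction s using Finset.induction_on with
  | empty => simp
  | insert a s ha ih =>
    have hZ (i) : SmoothField I (s.piecewise Y X i) := by
      by_cases h : i ∈ s <;> simp [h, hX, hY]
    rw [Finset.piecewise_insert, ← ih]
    have e : s.piecewise Y X = Function.update (s.piecewise Y X) a (X a) := by
      rw [eq_comm, Function.update_eq_self_iff]; simp [ha]
    conv_rhs => rw [e]
    exact tensorial_congr (fun W ↦ T (Function.update (s.piecewise Y X) a W))
      (fun U V hU hV ↦ hadd _ _ _ _ hZ hU hV) (fun f U hf hU ↦ hsmul _ _ _ _ hZ hf hU)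
      (hY a) (hX a) (hXY a).symm

theorem exists_multilinearMap {n : ℕ} {A : Type*} [AddCommGroup A]
    [Module ℝ A] {x : M} (T : (Fin n → Π x : M, TangentSpace I x) → A)
    (hadd : ∀ X k Y Z, (∀ i, SmoothField I (X i)) → SmoothField I Y → SmoothField I Z →
      T (Function.update X k (Y + Z)) = T (Function.update X k Y) + T (Function.update X k Z))
    (hsmul : ∀ X k (f : M → ℝ) Y, (∀ i, SmoothField I (X i)) → CMDiff ∞ f → SmoothField I Y →
      T (Function.update X k (f • Y)) = f x • T (Function.update X k Y)) :
    ∃ L : MultilinearMap ℝ (fun _ : Fin n ↦ TangentSpace I x) A,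
      ∀ X : Fin n → Π x : M, TangentSpace I x, (∀ i, SmoothField I (X i)) →
        L (fun i ↦ X i x) = T X := by
  have hupd (v : Fin n → TangentSpace I x) (k : Fin n) (X : Π x : M, TangentSpace I x)
      (hX : SmoothField I X) (i : Fin n) :
      SmoothField I (Function.update (fun i ↦ smoothExt (v i)) k X i) := by
    rcases eq_or_ne i k with rfl | h
    · simpa
    · simp [h, smoothField_smoothExt]
  have hval (v : Fin n → TangentSpace I x) (k : Fin n) (X : Π x : M, TangentSpace I x)
      (hX : SmoothField I X) :
      T (fun i ↦ smoothExt (Function.update v k (X x) i)) =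
        T (Function.update (fun i ↦ smoothExt (v i)) k X) := by
    refine tensorial_pi_congr T hadd hsmul (fun i ↦ smoothField_smoothExt _) (hupd v k X hX)
      fun i ↦ ?_
    rcases eq_or_ne i k with rfl | h <;> simp [*]
  refine ⟨⟨fun v ↦ T fun i ↦ smoothExt (v i), ?_, ?_⟩, fun X hX ↦ tensorial_pi_congr T hadd hsmul
      (fun i ↦ smoothField_smoothExt _) hX fun i ↦ by simp⟩
  · intro inst v k a b
    obtain rfl := Subsingleton.elim inst (instDecidableEqFin n)
    have ha := smoothField_smoothExt a
    have hb := smoothField_smoothExt b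
    have h := hadd _ k _ _ (fun i ↦ smoothField_smoothExt (v i)) ha hb
    rw [← hval _ _ _ ha, ← hval _ _ _ hb, ← hval _ _ _ (ha.add hb)] at h
    simpa using h
  · intro inst v k c a
    obtain rfl := Subsingleton.elim inst (instDecidableEqFin n)
    have ha := smoothField_smoothExt a
    have h := hsmul _ k (fun _ ↦ c) _ (fun i ↦ smoothField_smoothExt (v i)) contMDiff_const ha
    rw [← hval _ _ _ ha, ← hval _ _ _ (ha.smul contMDiff_const)] at h
    simpa using h

/-- This turns the formulas for ∇J, the curvature and the derivative of the torsion into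
endomorphisms of a single tangent space, to which traces apply. -/
theorem exists_linearMap {A : Type*} [AddCommGroup A]
    [Module ℝ A] {x : M} (T : (Π x : M, TangentSpace I x) → A)
    (hadd : ∀ X Y, SmoothField I X → SmoothField I Y → T (X + Y) = T X + T Y)
    (hsmul : ∀ (f : M → ℝ) X, CMDiff ∞ f → SmoothField I X → T (f • X) = f x • T X) :
    ∃ L : TangentSpace I x →ₗ[ℝ] A,
      ∀ X : Π x : M, TangentSpace I x, SmoothField I X → L (X x) = T X := by
  refine ⟨⟨⟨fun v ↦ T (smoothExt v), fun a b ↦ ?_⟩, fun c a ↦ ?_⟩, fun X hX ↦ tensorial_congr T hadd hsmul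
      (smoothField_smoothExt _) hX (by simp)⟩
  · have ha := smoothField_smoothExt a
    have hb := smoothField_smoothExt b
    rw [← hadd _ _ ha hb]
    exact tensorial_congr T hadd hsmul (smoothField_smoothExt _) (ha.add hb) (by simp)
  · have ha := smoothField_smoothExt a
    refine .trans ?_ (hsmul (fun _ ↦ c) _ contMDiff_const ha)
    exact tensorial_congr T hadd hsmul (smoothField_smoothExt _) (ha.smul contMDiff_const)
      (by simp)

end Tensorial

/-! ### The intrinsic torsion of the U(n)-structure. -/

section TorsionU

variable {n : ℕ} {M : Type*} [TopologicalSpace M]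
  [ChartedSpace (EuclideanSpace ℝ (Fin (2 * n))) M] [IsManifold (𝓡 (2 * n)) ∞ M]
  [RiemannianBundle (fun x : M ↦ TangentSpace (𝓡 (2 * n)) x)]
  [IsContMDiffRiemannianBundle (𝓡 (2 * n)) ∞ (EuclideanSpace ℝ (Fin (2 * n)))
    (fun x : M ↦ TangentSpace (𝓡 (2 * n)) x)] [T2Space M]

namespace SUStructure

variable (S : SUStructure n M) {X Y U V : Π x : M, TangentSpace (𝓡 (2 * n)) x}

/-- The vector field `JX`. -/
def JX (X : Π x : M, TangentSpace (𝓡 (2 * n)) x) (x : M) : TangentSpace (𝓡 (2 * n)) x := S.J x (X x)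

theorem smoothField_JX (hX : SmoothField (𝓡 (2 * n)) X) : SmoothField (𝓡 (2 * n)) (S.JX X) :=
  ContMDiff.clm_bundle_apply S.J_smooth hX

theorem JX_JX (X : Π x : M, TangentSpace (𝓡 (2 * n)) x) : S.JX (S.JX X) = -X := by
  ext x; exact S.J_J x _

theorem inner_Jend (x : M) (u v : TangentSpace (𝓡 (2 * n)) x) :
    inner ℝ (S.Jend x u) (S.Jend x v) = inner ℝ u v := S.inner_J_J x u v

theorem inner_J_eq_neg (x : M) (u v : TangentSpace (𝓡 (2 * n)) x) :
    inner ℝ (S.J x u) v = -inner ℝ u (S.J x v) :=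
  inner_J_left (J := S.Jend x) (S.J_J x) (S.inner_Jend x) u v

theorem leviCivita_neg {x : M} (hX : SmoothField (𝓡 (2 * n)) X) (u : TangentSpace (𝓡 (2 * n)) x) :
    leviCivita (-X) x u = -leviCivita X x u := by
  have h := leviCivita_sub SmoothField.zero hX x u
  rw [zero_sub] at h
  rw [h, CovariantDerivative.zero]
  simp

theorem exists_nablaJ (x : M) (u : TangentSpace (𝓡 (2 * n)) x) :
    ∃ L : Module.End ℝ (TangentSpace (𝓡 (2 * n)) x), ∀ X, SmoothField (𝓡 (2 * n)) X →
      L (X x) = leviCivita (S.JX X) x u - S.J x (leviCivita X x u) := by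
  refine exists_linearMap (fun X ↦ leviCivita (S.JX X) x u - S.J x (leviCivita X x u)) ?_ ?_
  · intro X Y hX hY
    have : S.JX (X + Y) = S.JX X + S.JX Y := by ext y; simp [JX]
    rw [this, leviCivita_add hX hY, leviCivita_add (S.smoothField_JX hX) (S.smoothField_JX hY)]
    simp only [map_add]
    abel
  · intro f X hf hX
    have : S.JX (f • X) = f • S.JX X := by ext y; simp [JX]
    rw [this, leviCivita_smul hf hX, leviCivita_smul hf (S.smoothField_JX hX)]
    simp only [map_add, map_smul, JX]
    module

/-- The covariant derivative `(∇_u J)` at `x`. -/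
def nablaJ (x : M) (u : TangentSpace (𝓡 (2 * n)) x) : Module.End ℝ (TangentSpace (𝓡 (2 * n)) x) :=
  (S.exists_nablaJ x u).choose

theorem nablaJ_apply (x : M) (u : TangentSpace (𝓡 (2 * n)) x) (hX : SmoothField (𝓡 (2 * n)) X) :
    S.nablaJ x u (X x) = leviCivita (S.JX X) x u - S.J x (leviCivita X x u) :=
  (S.exists_nablaJ x u).choose_spec X hX

theorem end_ext {x : M} {A B : Module.End ℝ (TangentSpace (𝓡 (2 * n)) x)}
    (h : ∀ X, SmoothField (𝓡 (2 * n)) X → A (X x) = B (X x)) : A = B := by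
  ext v
  simpa using h (smoothExt v) (smoothField_smoothExt v)

/-- Differentiate J² = −1. -/
theorem nablaJ_anticomm (x : M) (u : TangentSpace (𝓡 (2 * n)) x) :
    S.nablaJ x u * S.Jend x = -(S.Jend x * S.nablaJ x u) := by
  refine end_ext fun X hX ↦ ?_
  have h := S.nablaJ_apply x u (S.smoothField_JX hX)
  rw [S.JX_JX, leviCivita_neg hX] at h
  change S.nablaJ x u (S.J x (X x)) = -S.J x (S.nablaJ x u (X x))
  rw [show S.J x (X x) = S.JX X x from rfl, h, S.nablaJ_apply x u hX, map_sub, S.J_J]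
  abel

/-- Differentiate g(JX, Y) = −g(X, JY), using that ∇ is metric. -/
theorem nablaJ_mem_soAlg (x : M) (u : TangentSpace (𝓡 (2 * n)) x) :
    S.nablaJ x u ∈ soAlg (TangentSpace (𝓡 (2 * n)) x) := by
  intro v w
  have hX := smoothField_smoothExt (I := 𝓡 (2 * n)) v
  have hY := smoothField_smoothExt (I := 𝓡 (2 * n)) w
  have h1 := mvfderiv_inner (S.smoothField_JX hX) hY x u
  have h2 := mvfderiv_inner hX (S.smoothField_JX hY) x u
  have e : (fun p ↦ inner ℝ (S.JX (smoothExt v) p) (smoothExt w p)) =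
      -fun p ↦ inner ℝ (smoothExt v p) (S.JX (smoothExt w) p) := by
    ext p; exact S.inner_J_eq_neg p _ _
  rw [e, mvfderiv_neg, _root_.neg_apply, h2] at h1
  have e1 := S.nablaJ_apply x u hX
  have e2 := S.nablaJ_apply x u hY
  simp only [smoothExt_self, JX] at e1 e2 h1
  rw [e1, e2, inner_sub_left, inner_sub_right, S.inner_J_eq_neg x (leviCivita _ x u),
    ← neg_neg (inner ℝ v (S.J x _)), ← S.inner_J_eq_neg x v (leviCivita _ x u)]
  change -(_ + inner ℝ v (leviCivita (S.JX (smoothExt w)) x u)) =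
    inner ℝ (leviCivita (S.JX (smoothExt v)) x u) w + _ at h1
  linarith

/-- The tensor `-(1/2) J (∇_u J)`, which is the intrinsic torsion of the `U(n)`-structure. -/
def xiU (x : M) : TangentSpace (𝓡 (2 * n)) x →ₗ[ℝ] Module.End ℝ (TangentSpace (𝓡 (2 * n)) x) where
  toFun u := (-(1 / 2 : ℝ)) • (S.Jend x * S.nablaJ x u)
  map_add' u v := by
    refine end_ext fun X hX ↦ ?_
    simp only [LinearMap.smul_apply, LinearMap.add_apply, Module.End.mul_apply,
      S.nablaJ_apply x _ hX, map_add, map_sub]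
    module
  map_smul' c u := by
    refine end_ext fun X hX ↦ ?_
    simp only [LinearMap.smul_apply, Module.End.mul_apply,
      S.nablaJ_apply x _ hX, map_smul, map_sub, RingHom.id_apply]
    module

theorem xiU_apply (x : M) (u v : TangentSpace (𝓡 (2 * n)) x) :
    S.xiU x u v = (-(1 / 2 : ℝ)) • S.J x (S.nablaJ x u v) := rfl

theorem nablaJ_eq (x : M) (u v : TangentSpace (𝓡 (2 * n)) x) :
    S.nablaJ x u v = (2 : ℝ) • S.J x (S.xiU x u v) := by
  rw [xiU_apply, map_smul, S.J_J]; module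

theorem xiU_anticomm_apply (x : M) (u v : TangentSpace (𝓡 (2 * n)) x) :
    S.xiU x u (S.J x v) = -S.J x (S.xiU x u v) := by
  have h : S.nablaJ x u (S.J x v) = -S.J x (S.nablaJ x u v) :=
    congr($(S.nablaJ_anticomm x u) v)
  simp only [xiU_apply, h, map_neg, map_smul, S.J_J]
  module

theorem xiU_anticomm (x : M) (u : TangentSpace (𝓡 (2 * n)) x) :
    S.xiU x u * S.Jend x = -(S.Jend x * S.xiU x u) :=
  LinearMap.ext fun v ↦ S.xiU_anticomm_apply x u v

theorem xiU_mem_soAlg (x : M) (u : TangentSpace (𝓡 (2 * n)) x) :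
    S.xiU x u ∈ soAlg (TangentSpace (𝓡 (2 * n)) x) := fun v w ↦ by
  have h : S.nablaJ x u (S.J x w) = -S.J x (S.nablaJ x u w) :=
    congr($(S.nablaJ_anticomm x u) w)
  simp only [xiU_apply, real_inner_smul_left, real_inner_smul_right, S.inner_J_eq_neg,
    S.nablaJ_mem_soAlg x u v, h, inner_neg_right, neg_neg]
  ring

/-- The commutator [ξ_u, J] = −2Jξ_u cancels ∇_u J = 2Jξ_u. -/
theorem deformed_xiU_JX (x : M) (u : TangentSpace (𝓡 (2 * n)) x)
    (hX : SmoothField (𝓡 (2 * n)) X) :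
    deformed S.xiU (S.JX X) x u = S.J x (deformed S.xiU X x u) := by
  have h := S.nablaJ_apply x u hX
  rw [S.nablaJ_eq, eq_sub_iff_add_eq] at h
  rw [deformed, deformed, ← h, map_add, JX, S.xiU_anticomm_apply]
  module

theorem isTorsionU_xiU : S.IsTorsionU S.xiU :=
  ⟨fun x u ↦ mem_perpAlg_uAlg_of_anticomm (S.J_J x) (S.xiU_mem_soAlg x u) (S.xiU_anticomm x u),
    fun _ hX x u ↦ S.deformed_xiU_JX x u hX⟩

theorem sub_comm_of_parallelJ
    {ξ ζ : Π x : M, TangentSpace (𝓡 (2 * n)) x →ₗ[ℝ] Module.End ℝ (TangentSpace (𝓡 (2 * n)) x)}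
    (hξ : S.ParallelJ ξ) (hζ : S.ParallelJ ζ) (x : M) (u : TangentSpace (𝓡 (2 * n)) x) :
    (ξ x u - ζ x u) * S.Jend x = S.Jend x * (ξ x u - ζ x u) := by
  refine end_ext fun X hX ↦ ?_
  have h1 := hξ X hX x u
  have h2 := hζ X hX x u
  simp only [deformed, map_add] at h1 h2
  simp only [Module.End.mul_apply, LinearMap.sub_apply, map_sub, ContinuousLinearMap.coe_coe]
  rw [← sub_eq_zero] at h1 h2 ⊢
  rw [← sub_self (0 : TangentSpace (𝓡 (2 * n)) x)]
  nth_rewrite 1 [← h1]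
  rw [← h2]
  abel

/-- `torsionU` is an `epsilon` choice and is identified by uniqueness: the difference of two
solutions commutes with J and is orthogonal to u(n), hence is zero. -/
theorem torsionU_eq : S.torsionU = S.xiU := by
  have h : S.IsTorsionU (Classical.epsilon S.IsTorsionU) :=
    Classical.epsilon_spec ⟨_, S.isTorsionU_xiU⟩
  funext x
  refine LinearMap.ext fun u ↦ sub_eq_zero.1 ?_
  have hp := sub_mem (h.1 x u) (S.isTorsionU_xiU.1 x u)
  exact eq_zero_of_mem_uAlg_of_mem_perpAlg (S.J_J x)
    ⟨hp.1, S.sub_comm_of_parallelJ h.2 S.isTorsionU_xiU.2 x u⟩ hp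

theorem smoothField_xiU (hU : SmoothField (𝓡 (2 * n)) U) (hX : SmoothField (𝓡 (2 * n)) X) :
    SmoothField (𝓡 (2 * n)) (fun x ↦ S.xiU x (U x) (X x)) := by
  have h : (fun x ↦ S.xiU x (U x) (X x)) = (-(1 / 2 : ℝ)) •
      S.JX (nabla U (S.JX X) - S.JX (nabla U X)) := by
    ext x
    rw [xiU_apply, S.nablaJ_apply x _ hX]
    rfl
  rw [h]
  exact (S.smoothField_JX ((hU.nabla (S.smoothField_JX hX)).sub
    (S.smoothField_JX (hU.nabla hX)))).const_smul _

/-- The `U(n)`-connection `∇ + ξ^{U(n)}`, on vector fields. -/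
def nablaU (U X : Π x : M, TangentSpace (𝓡 (2 * n)) x) (x : M) : TangentSpace (𝓡 (2 * n)) x :=
  deformed S.xiU X x (U x)

theorem smoothField_nablaU (hU : SmoothField (𝓡 (2 * n)) U) (hX : SmoothField (𝓡 (2 * n)) X) :
    SmoothField (𝓡 (2 * n)) (S.nablaU U X) :=
  (hU.nabla hX).add (S.smoothField_xiU hU hX)

end SUStructure

end TorsionU

/-! ### The derivative of Ψ under the U(n)-connection. -/

section TorsionSU

variable {n : ℕ} {M : Type*} [TopologicalSpace M]
  [ChartedSpace (EuclideanSpace ℝ (Fin (2 * n))) M] [IsManifold (𝓡 (2 * n)) ∞ M]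
  [RiemannianBundle (fun x : M ↦ TangentSpace (𝓡 (2 * n)) x)]
  [IsContMDiffRiemannianBundle (𝓡 (2 * n)) ∞ (EuclideanSpace ℝ (Fin (2 * n)))
    (fun x : M ↦ TangentSpace (𝓡 (2 * n)) x)] [T2Space M]

theorem finrank_tangentSpace_two_mul (x : M) :
    Module.finrank ℝ (TangentSpace (𝓡 (2 * n)) x) = 2 * n :=
  finrank_euclideanSpace_fin

theorem deformed_add
    {ξ : Π x : M, TangentSpace (𝓡 (2 * n)) x →ₗ[ℝ] Module.End ℝ (TangentSpace (𝓡 (2 * n)) x)}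
    {X Y : Π x : M, TangentSpace (𝓡 (2 * n)) x} (hX : SmoothField (𝓡 (2 * n)) X)
    (hY : SmoothField (𝓡 (2 * n)) Y) (x : M) (u : TangentSpace (𝓡 (2 * n)) x) :
    SUStructure.deformed ξ (X + Y) x u =
      SUStructure.deformed ξ X x u + SUStructure.deformed ξ Y x u := by
  simp only [SUStructure.deformed, leviCivita_add hX hY, Pi.add_apply, map_add]
  abel

theorem deformed_smul
    {ξ : Π x : M, TangentSpace (𝓡 (2 * n)) x →ₗ[ℝ] Module.End ℝ (TangentSpace (𝓡 (2 * n)) x)}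
    {X : Π x : M, TangentSpace (𝓡 (2 * n)) x} {f : M → ℝ} (hf : ContMDiff (𝓡 (2 * n)) 𝓘(ℝ, ℝ) ∞ f)
    (hX : SmoothField (𝓡 (2 * n)) X) (x : M) (u : TangentSpace (𝓡 (2 * n)) x) :
    SUStructure.deformed ξ (f • X) x u =
      f x • SUStructure.deformed ξ X x u + mvfderiv (𝓡 (2 * n)) f x u • X x := by
  simp only [SUStructure.deformed, leviCivita_smul hf hX, Pi.smul_apply', map_smul]
  module

theorem deformed_linear
    {ξ : Π x : M, TangentSpace (𝓡 (2 * n)) x →ₗ[ℝ] Module.End ℝ (TangentSpace (𝓡 (2 * n)) x)}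
    {X : Π x : M, TangentSpace (𝓡 (2 * n)) x} (x : M) (u v : TangentSpace (𝓡 (2 * n)) x) (c : ℝ) :
    SUStructure.deformed ξ X x (u + c • v) =
      SUStructure.deformed ξ X x u + c • SUStructure.deformed ξ X x v := by
  simp only [SUStructure.deformed, map_add, map_smul, LinearMap.add_apply, LinearMap.smul_apply]
  module

namespace SUStructure

variable (S : SUStructure n M) {X Y U V : Π x : M, TangentSpace (𝓡 (2 * n)) x}

theorem contMDiff_Ψ {X : Fin n → Π x : M, TangentSpace (𝓡 (2 * n)) x}
    (hX : ∀ k, SmoothField (𝓡 (2 * n)) (X k)) : 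
    ContMDiff (𝓡 (2 * n)) 𝓘(ℝ, ℂ) ∞ (fun x ↦ S.Ψ x fun k ↦ X k x) :=
  S.Ψ_smooth X hX

/-- `(∇^{U(n)}_u Ψ)(X₁, …, Xₙ)` at `x`. -/
def nablaΨ (x : M) (u : TangentSpace (𝓡 (2 * n)) x)
    (X : Fin n → Π x : M, TangentSpace (𝓡 (2 * n)) x) : ℂ :=
  mvfderiv (𝓡 (2 * n)) (fun y ↦ S.Ψ y fun k ↦ X k y) x u -
    ∑ k, S.Ψ x (Function.update (fun k ↦ X k x) k (deformed S.xiU (X k) x u))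

theorem update_apply_field (X : Fin n → Π x : M, TangentSpace (𝓡 (2 * n)) x) (k : Fin n)
    (Y : Π x : M, TangentSpace (𝓡 (2 * n)) x) (y : M) :
    (fun j ↦ Function.update X k Y j y) = Function.update (fun j ↦ X j y) k (Y y) := by
  ext j
  rcases eq_or_ne j k with rfl | h <;> simp [*]

theorem smoothField_update {X : Fin n → Π x : M, TangentSpace (𝓡 (2 * n)) x}
    (hX : ∀ k, SmoothField (𝓡 (2 * n)) (X k)) (k : Fin n) (hY : SmoothField (𝓡 (2 * n)) Y)
    (j : Fin n) : SmoothField (𝓡 (2 * n)) (Function.update X k Y j) := by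
  rcases eq_or_ne j k with rfl | h <;> simp [*]

/-- The sum in the definition of `nablaΨ`, split into the term of a distinguished index and the
other ones. -/
theorem sum_update_eq
    {ξ : Π x : M, TangentSpace (𝓡 (2 * n)) x →ₗ[ℝ] Module.End ℝ (TangentSpace (𝓡 (2 * n)) x)}
    (X : Fin n → Π x : M, TangentSpace (𝓡 (2 * n)) x) (k : Fin n)
    (x : M) (u : TangentSpace (𝓡 (2 * n)) x) :
    ∑ j, S.Ψ x (Function.update (fun j ↦ Function.update X k Y j x) j
        (deformed ξ (Function.update X k Y j) x u)) =
      S.Ψ x (Function.update (fun j ↦ X j x) k (deformed ξ Y x u)) +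
        ∑ j ∈ Finset.univ.erase k, S.Ψ x (Function.update (Function.update (fun j ↦ X j x) j
          (deformed ξ (X j) x u)) k (Y x)) := by
  rw [← Finset.add_sum_erase _ _ (Finset.mem_univ k)]
  congr 1
  · rw [update_apply_field, Function.update_idem, Function.update_self]
  · refine Finset.sum_congr rfl fun j hj ↦ ?_
    have h := Finset.ne_of_mem_erase hj
    rw [update_apply_field, Function.update_comm h, Function.update_of_ne h]

theorem nablaΨ_add (x : M) (u : TangentSpace (𝓡 (2 * n)) x)
    {X : Fin n → Π x : M, TangentSpace (𝓡 (2 * n)) x} (k : Fin n)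
    (hX : ∀ k, SmoothField (𝓡 (2 * n)) (X k)) (hY : SmoothField (𝓡 (2 * n)) Y)
    (hV : SmoothField (𝓡 (2 * n)) V) :
    S.nablaΨ x u (Function.update X k (Y + V)) =
      S.nablaΨ x u (Function.update X k Y) + S.nablaΨ x u (Function.update X k V) := by
  have h1 := S.contMDiff_Ψ (smoothField_update hX k hY)
  have h2 := S.contMDiff_Ψ (smoothField_update hX k hV)
  have e : (fun y ↦ S.Ψ y fun j ↦ Function.update X k (Y + V) j y) =
      (fun y ↦ S.Ψ y fun j ↦ Function.update X k Y j y) +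
        fun y ↦ S.Ψ y fun j ↦ Function.update X k V j y := by
    ext y
    simp only [update_apply_field, Pi.add_apply, AlternatingMap.map_update_add]
  simp only [nablaΨ, sum_update_eq]
  rw [e, mvfderiv_add (contMDiff_mdiffAt h1 x) (contMDiff_mdiffAt h2 x), deformed_add hY hV]
  simp only [_root_.add_apply, Pi.add_apply, AlternatingMap.map_update_add,
    Finset.sum_add_distrib]
  ring

/-- The derivative of f appears once from the function Ψ(X₁, …, Xₙ) and once from the connection,
with opposite signs. -/
theorem nablaΨ_smul (x : M) (u : TangentSpace (𝓡 (2 * n)) x)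
    {X : Fin n → Π x : M, TangentSpace (𝓡 (2 * n)) x} (k : Fin n) {f : M → ℝ}
    (hX : ∀ k, SmoothField (𝓡 (2 * n)) (X k)) (hf : ContMDiff (𝓡 (2 * n)) 𝓘(ℝ, ℝ) ∞ f)
    (hY : SmoothField (𝓡 (2 * n)) Y) :
    S.nablaΨ x u (Function.update X k (f • Y)) = f x • S.nablaΨ x u (Function.update X k Y) := by
  have h1 := S.contMDiff_Ψ (smoothField_update hX k hY)
  have e : (fun y ↦ S.Ψ y fun j ↦ Function.update X k (f • Y) j y) =
      f • (fun y ↦ S.Ψ y fun j ↦ Function.update X k Y j y) := by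
    ext y
    simp only [update_apply_field, Pi.smul_apply', AlternatingMap.map_update_smul]
  simp only [nablaΨ, sum_update_eq]
  rw [e, mvfderiv_smul (contMDiff_mdiffAt hf x) (contMDiff_mdiffAt h1 x), deformed_smul hf hY]
  simp only [_root_.add_apply, _root_.smul_apply, ContinuousLinearMap.smulRight_apply,
    Pi.smul_apply', AlternatingMap.map_update_add, AlternatingMap.map_update_smul,
    ← Finset.smul_sum, update_apply_field]
  module

/-- The U(n)-connection preserves J, so the derivative of Ψ is again of type (n,0). -/
theorem nablaΨ_J (x : M) (u : TangentSpace (𝓡 (2 * n)) x)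
    {X : Fin n → Π x : M, TangentSpace (𝓡 (2 * n)) x} (k : Fin n)
    (hX : ∀ k, SmoothField (𝓡 (2 * n)) (X k)) :
    S.nablaΨ x u (Function.update X k (S.JX (X k))) = Complex.I * S.nablaΨ x u X := by
  have h1 := S.contMDiff_Ψ hX
  have hJ (y) (v : Fin n → TangentSpace (𝓡 (2 * n)) y) (w : TangentSpace (𝓡 (2 * n)) y) :
      S.Ψ y (Function.update v k (S.J y w)) = Complex.I * S.Ψ y (Function.update v k w) := by
    have := S.Ψ_J y (Function.update v k w) k
    rwa [Function.update_idem, Function.update_self] at this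
  have e : (fun y ↦ S.Ψ y fun j ↦ Function.update X k (S.JX (X k)) j y) =
      fun y ↦ ContinuousLinearMap.mul ℝ ℂ Complex.I (S.Ψ y fun j ↦ X j y) := by
    ext y
    rw [update_apply_field, JX, hJ, Function.update_eq_self]
    rfl
  rw [nablaΨ, sum_update_eq, e, mvfderiv_clm_comp _ (contMDiff_mdiffAt h1 x), nablaΨ,
    S.deformed_xiU_JX x u (hX k), hJ]
  simp only [JX, hJ, ← Finset.mul_sum]
  have h2 := S.sum_update_eq (ξ := S.xiU) (Y := X k) X k x u
  rw [Function.update_eq_self] at h2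
  rw [h2]
  simp only [ContinuousLinearMap.mul_apply']
  ring

/-- When Xᵢ = Xⱼ, the terms of index i and j differ by a transposition and cancel; every other term
repeats an argument. -/
theorem nablaΨ_eq_zero (x : M) (u : TangentSpace (𝓡 (2 * n)) x)
    {X : Fin n → Π x : M, TangentSpace (𝓡 (2 * n)) x} {i j : Fin n} (hij : i ≠ j)
    (h : X i = X j) : S.nablaΨ x u X = 0 := by
  have e : (fun y ↦ S.Ψ y fun k ↦ X k y) = fun _ ↦ 0 := by
    ext y; exact (S.Ψ y).map_eq_zero_of_eq _ (by rw [h]) hij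
  have h2 : ∑ k, S.Ψ x (Function.update (fun k ↦ X k x) k (deformed S.xiU (X k) x u)) =
      S.Ψ x (Function.update (fun k ↦ X k x) i (deformed S.xiU (X i) x u)) +
      S.Ψ x (Function.update (fun k ↦ X k x) j (deformed S.xiU (X j) x u)) := by
    refine Fintype.sum_eq_add i j hij fun k hk ↦ (S.Ψ x).map_eq_zero_of_eq _ ?_ hij
    rw [Function.update_of_ne hk.1.symm, Function.update_of_ne hk.2.symm, h]
  have h3 : Function.update (fun k ↦ X k x) j (deformed S.xiU (X j) x u) =
      Function.update (fun k ↦ X k x) i (deformed S.xiU (X i) x u) ∘ Equiv.swap i j := by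
    ext k
    rcases eq_or_ne k i with rfl | hi
    · simp [hij, hij.symm, h]
    rcases eq_or_ne k j with rfl | hj
    · simp [h]
    · simp [hi, hj, Equiv.swap_apply_of_ne_of_ne]
  rw [nablaΨ, h2, h3, (S.Ψ x).map_swap _ hij, e, mvfderiv_const]
  simp

theorem nablaΨ_linear (x : M) (u v : TangentSpace (𝓡 (2 * n)) x) (c : ℝ)
    (X : Fin n → Π x : M, TangentSpace (𝓡 (2 * n)) x) :
    S.nablaΨ x (u + c • v) X = S.nablaΨ x u X + c • S.nablaΨ x v X := by
  simp only [nablaΨ, deformed_linear, AlternatingMap.map_update_add,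
    AlternatingMap.map_update_smul, map_add, map_smul, Finset.sum_add_distrib, ← Finset.smul_sum]
  module

theorem exists_nablaΨ (x : M) (u : TangentSpace (𝓡 (2 * n)) x) :
    ∃ L : TangentSpace (𝓡 (2 * n)) x [⋀^Fin n]→ₗ[ℝ] ℂ,
      (∀ X : Fin n → Π x : M, TangentSpace (𝓡 (2 * n)) x, (∀ k, SmoothField (𝓡 (2 * n)) (X k)) →
        L (fun k ↦ X k x) = S.nablaΨ x u X) ∧
      ∀ v k, L (Function.update v k (S.Jend x (v k))) = Complex.I * L v := by
  obtain ⟨L, hL⟩ := exists_multilinearMap (fun X ↦ S.nablaΨ x u X)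
    (fun X k Y V hX hY hV ↦ S.nablaΨ_add x u k hX hY hV)
    (fun X k f Y hX hf hY ↦ S.nablaΨ_smul x u k hX hf hY)
  have hL' (v) : L v = S.nablaΨ x u fun k ↦ smoothExt (v k) := by
    simpa using hL (fun k ↦ smoothExt (v k)) fun k ↦ smoothField_smoothExt _
  refine ⟨{ L with map_eq_zero_of_eq' := fun v i j h hij ↦ ?_ }, hL, fun v k ↦ ?_⟩
  · exact (hL' v).trans (S.nablaΨ_eq_zero x u hij (by rw [h]))
  · have hv (j) := smoothField_smoothExt (I := 𝓡 (2 * n)) (v j)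
    have h := S.nablaΨ_J x u k hv
    rw [← hL _ (smoothField_update hv k (S.smoothField_JX (hv k))), ← hL' v,
      update_apply_field] at h
    simpa [JX] using! h

theorem exists_Ψ_ne_zero (x : M) : ∃ v, S.Ψ x v ≠ 0 := by
  by_contra! h
  simpa [h] using S.Ψ_norm x

/-- The complex number `α(u)` with `∇^{U(n)}_u Ψ = α(u) Ψ`. -/
def alphaΨ (x : M) (u : TangentSpace (𝓡 (2 * n)) x) : ℂ :=
  S.nablaΨ x u (fun k ↦ smoothExt ((S.exists_Ψ_ne_zero x).choose k)) /
    S.Ψ x (S.exists_Ψ_ne_zero x).choose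

/-- Forms of type (n,0) are proportional, so the factor read off on one tuple where Ψ is nonzero is
valid on all tuples. -/
theorem nablaΨ_eq (x : M) (u : TangentSpace (𝓡 (2 * n)) x)
    {X : Fin n → Π x : M, TangentSpace (𝓡 (2 * n)) x} (hX : ∀ k, SmoothField (𝓡 (2 * n)) (X k)) :
    S.nablaΨ x u X = S.alphaΨ x u * S.Ψ x fun k ↦ X k x := by
  obtain ⟨L, hL, hLJ⟩ := S.exists_nablaΨ x u
  set v := (S.exists_Ψ_ne_zero x).choose with hv
  have hv0 : S.Ψ x v ≠ 0 := (S.exists_Ψ_ne_zero x).choose_spec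
  have h := form_proportional (J_mul_J (J := S.Jend x) (S.J_J x)) (finrank_tangentSpace_two_mul x)
    (S.Ψ x) L (S.Ψ_J x) hLJ v (fun k ↦ X k x)
  have h2 := hL (fun k ↦ smoothExt (v k)) fun k ↦ smoothField_smoothExt _
  simp only [smoothExt_self] at h2
  rw [hL X hX, h2] at h
  rw [alphaΨ, ← hv, div_mul_eq_mul_div, eq_div_iff hv0, h]

theorem alphaΨ_linear (x : M) (u v : TangentSpace (𝓡 (2 * n)) x) (c : ℝ) :
    S.alphaΨ x (u + c • v) = S.alphaΨ x u + c • S.alphaΨ x v := by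
  simp only [alphaΨ, nablaΨ_linear, add_div, Complex.real_smul, mul_div_assoc]

end SUStructure

end TorsionSU

/-! ### Derivatives of squared norms and finite sums. -/

section NormDerivative

variable {E : Type*} [NormedAddCommGroup E] [NormedSpace ℝ E]
  {H : Type*} [TopologicalSpace H] {I : ModelWithCorners ℝ E H}
  {M : Type*} [TopologicalSpace M] [ChartedSpace H M] [IsManifold I ∞ M]

theorem mvfderiv_norm_sq {F : Type*} [NormedAddCommGroup F] [InnerProductSpace ℝ F] {f : M → F}
    {x : M} (hf : MDiffAt f x) (u : TangentSpace I x) :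
    mvfderiv I (fun y ↦ ‖f y‖ ^ 2) x u = 2 * inner ℝ (f x) (mvfderiv I f x u) := by
  have h1 := (hasStrictFDerivAt_norm_sq (f x)).hasFDerivAt
  have h := mfderiv_comp x h1.differentiableAt.mdifferentiableAt hf
  have h2 : (fun y ↦ ‖f y‖ ^ 2) = (fun z : F ↦ ‖z‖ ^ 2) ∘ f := rfl
  simp only [mvfderiv, ContinuousLinearMap.comp_apply]
  rw [h2, h, mfderiv_eq_fderiv, h1.fderiv]
  simp [two_smul, two_mul]
  rfl

theorem mvfderiv_finset_sum {F ι : Type*} [NormedAddCommGroup F] [NormedSpace ℝ F] {f : ι → M → F}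
    {x : M} (s : Finset ι) (hf : ∀ i, MDiffAt (f i) x) (u : TangentSpace I x) :
    mvfderiv I (fun y ↦ ∑ i ∈ s, f i y) x u = ∑ i ∈ s, mvfderiv I (f i) x u := by
  classical
  have hd (s : Finset ι) : MDiffAt (fun y ↦ ∑ i ∈ s, f i y) x := by
    induction s using Finset.induction_on with
    | empty => simpa using mdifferentiableAt_const
    | insert a s ha ih => simp only [Finset.sum_insert ha]; exact (hf a).add ih
  induction s using Finset.induction_on with
  | empty => simp [mvfderiv_const]
  | insert a s ha ih =>
    simp only [Finset.sum_insert ha, ← ih]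
    have h := mvfderiv_add (hf a) (hd s)
    exact congr($h u)

end NormDerivative

/-! ### The 1-form θ and the intrinsic torsion of the SU(n)-structure. -/

section TorsionSU

variable {n : ℕ} {M : Type*} [TopologicalSpace M]
  [ChartedSpace (EuclideanSpace ℝ (Fin (2 * n))) M] [IsManifold (𝓡 (2 * n)) ∞ M]
  [RiemannianBundle (fun x : M ↦ TangentSpace (𝓡 (2 * n)) x)]
  [IsContMDiffRiemannianBundle (𝓡 (2 * n)) ∞ (EuclideanSpace ℝ (Fin (2 * n)))
    (fun x : M ↦ TangentSpace (𝓡 (2 * n)) x)] [T2Space M]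

namespace SUStructure

variable (S : SUStructure n M) {X Y U V : Π x : M, TangentSpace (𝓡 (2 * n)) x}

theorem mvfderiv_inner_deformed (hX : SmoothField (𝓡 (2 * n)) X) (hY : SmoothField (𝓡 (2 * n)) Y)
    (x : M) (u : TangentSpace (𝓡 (2 * n)) x) :
    mvfderiv (𝓡 (2 * n)) (fun p ↦ inner ℝ (X p) (Y p)) x u =
      inner ℝ (deformed S.xiU X x u) (Y x) + inner ℝ (X x) (deformed S.xiU Y x u) := by
  rw [mvfderiv_inner hX hY, deformed, deformed, inner_add_left, inner_add_right,
    S.xiU_mem_soAlg x u (X x)]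
  ring

/-- Unit length says that Σ|Ψ(e_s)|² = n! in a local orthonormal frame. Its derivative is 2 n! Re α
plus the effect of an infinitesimal rotation of the frame, which is zero. -/
theorem alphaΨ_re (x : M) (u : TangentSpace (𝓡 (2 * n)) x) : (S.alphaΨ x u).re = 0 := by
  obtain ⟨e, he, ho⟩ := exists_orthonormal_frame (I := 𝓡 (2 * n)) x
  let g (s : Fin n → Fin (Module.finrank ℝ (EuclideanSpace ℝ (Fin (2 * n))))) (y : M) : ℂ :=
    S.Ψ y fun k ↦ e (s k) y
  have hsum : ∀ᶠ y in 𝓝 x, ∑ s, ‖g s y‖ ^ 2 = (n.factorial : ℝ) := by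
    filter_upwards [ho] with y hy
    have h := S.Ψ_norm y
    have h2 := sum_norm_sq_eq_of_orthonormalBasis
      (b := stdOrthonormalBasis ℝ (TangentSpace (𝓡 (2 * n)) y)) (b' := onb hy)
      (S.Ψ y).toMultilinearMap
    simp only [AlternatingMap.coe_multilinearMap, onb_apply] at h2
    rw [h2] at h
    have : (n.factorial : ℝ) ≠ 0 := by positivity
    field_simp at h
    exact h
  have hg (s : Fin n → Fin (Module.finrank ℝ (EuclideanSpace ℝ (Fin (2 * n))))) :=
    S.contMDiff_Ψ fun k ↦ he (s k)
  have hgd (s) : MDifferentiableAt (𝓡 (2 * n)) 𝓘(ℝ, ℂ) (g s) x := contMDiff_mdiffAt (hg s) x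
  have hgd2 (s) : MDifferentiableAt (𝓡 (2 * n)) 𝓘(ℝ, ℝ) (fun y ↦ ‖g s y‖ ^ 2) x :=
    (contDiff_norm_sq ℝ (n := 1)).contMDiff.mdifferentiable (by simp) _ |>.comp x (hgd s)
  have hx := ho.self_of_nhds
  let b := onb hx
  -- The connection matrix of the frame in the direction `u`; it is skew because the inner products
  -- of the frame are constant near `x`.
  let A : Module.End ℝ (TangentSpace (𝓡 (2 * n)) x) :=
    b.toBasis.constr ℝ fun i ↦ deformed S.xiU (e i) x u
  have hA (i) : A (e i x) = deformed S.xiU (e i) x u := by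
    have := b.toBasis.constr_basis ℝ (fun i ↦ deformed S.xiU (e i) x u) i
    rw [OrthonormalBasis.coe_toBasis, onb_apply] at this
    exact this
  have hAs : A ∈ soAlg (TangentSpace (𝓡 (2 * n)) x) := by
    have : (innerₗ (TangentSpace (𝓡 (2 * n)) x)) ∘ₗ A =
        -(innerₗ (TangentSpace (𝓡 (2 * n)) x)).compl₂ A := by
      refine LinearMap.ext_basis b.toBasis b.toBasis fun i j ↦ ?_
      have h1 := S.mvfderiv_inner_deformed (he i) (he j) x u
      have h2 : mvfderiv (𝓡 (2 * n)) (fun p ↦ inner ℝ (e i p) (e j p)) x u = 0 := by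
        rw [mvfderiv_congr (g := fun _ ↦ if i = j then (1 : ℝ) else 0), mvfderiv_const]
        · rfl
        · filter_upwards [ho] with y hy
          exact orthonormal_iff_ite.1 hy i j
      rw [h2] at h1
      simp only [b, OrthonormalBasis.coe_toBasis, onb_apply, LinearMap.comp_apply, innerₗ_apply_apply,
        LinearMap.neg_apply, LinearMap.compl₂_apply, hA]
      linarith
    intro v w
    simpa using congr($this v w)
  have h0 : ∑ s, 2 * inner ℝ (g s x) (mvfderiv (𝓡 (2 * n)) (g s) x u) = 0 := by
    have h := mvfderiv_congr hsum u
    rw [mvfderiv_finset_sum _ hgd2, mvfderiv_const] at h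
    simp only [mvfderiv_norm_sq (hgd _)] at h
    exact h
  have hD (s) : mvfderiv (𝓡 (2 * n)) (g s) x u = S.alphaΨ x u * g s x +
      ∑ k, S.Ψ x (Function.update (fun k ↦ e (s k) x) k (A (e (s k) x))) := by
    have h := S.nablaΨ_eq x u fun k ↦ he (s k)
    rw [nablaΨ, sub_eq_iff_eq_add] at h
    simpa only [hA] using h
  have hin (z w : ℂ) : inner ℝ z (w * z) = w.re * ‖z‖ ^ 2 := by
    rw [← Complex.normSq_eq_norm_sq, Complex.normSq_apply]
    simp [Complex.inner]
    ring
  have hk (k) := sum_inner_update_skew b (S.Ψ x).toMultilinearMap A hAs k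
  simp only [AlternatingMap.coe_multilinearMap, b, onb_apply] at hk
  simp only [hD, inner_add_right, hin, inner_sum, mul_add, Finset.sum_add_distrib] at h0
  simp only [← Finset.mul_sum] at h0
  rw [Finset.sum_comm (s := Finset.univ)] at h0
  simp only [g] at h0 hsum
  simp only [hk, hsum.self_of_nhds] at h0
  have : (n.factorial : ℝ) ≠ 0 := by positivity
  simpa [this] using h0

/-- The real linear form `θ` with `∇^{U(n)}_u Ψ = i n θ(u) Ψ`. -/
def thetaΨ (x : M) : TangentSpace (𝓡 (2 * n)) x →ₗ[ℝ] ℝ where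
  toFun u := (S.alphaΨ x u).im / n
  map_add' u v := by
    have h := S.alphaΨ_linear x u v 1
    rw [one_smul, one_smul] at h
    rw [h, Complex.add_im, add_div]
  map_smul' c u := by
    have h0 : S.alphaΨ x 0 = 0 := by simpa using S.alphaΨ_linear x 0 0 1
    have h := S.alphaΨ_linear x 0 u c
    rw [zero_add, h0, zero_add] at h
    simp [h, mul_div_assoc]

theorem alphaΨ_eq (x : M) (u : TangentSpace (𝓡 (2 * n)) x) :
    S.alphaΨ x u = Complex.I * (n * S.thetaΨ x u : ℝ) := by
  have h : n * S.thetaΨ x u = (S.alphaΨ x u).im := by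
    -- For n = 0 the quotient defining θ takes its default value, but the tangent space is zero.
    rcases n.eq_zero_or_pos with rfl | hn
    · have : Subsingleton (TangentSpace (𝓡 (2 * 0)) x) :=
        inferInstanceAs (Subsingleton (EuclideanSpace ℝ (Fin 0)))
      have h0 : S.alphaΨ x 0 = 0 := by simpa using S.alphaΨ_linear x 0 0 1
      simp [Subsingleton.elim u 0, h0]
    · change n * ((S.alphaΨ x u).im / n) = _
      field_simp
  rw [h]
  apply Complex.ext <;> simp [alphaΨ_re]

theorem contMDiff_nablaΨ (hU : SmoothField (𝓡 (2 * n)) U)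
    {X : Fin n → Π x : M, TangentSpace (𝓡 (2 * n)) x} (hX : ∀ k, SmoothField (𝓡 (2 * n)) (X k)) :
    ContMDiff (𝓡 (2 * n)) 𝓘(ℝ, ℂ) ∞ (fun x ↦ S.nablaΨ x (U x) X) := by
  refine (SmoothField.mvfderiv_apply (S.contMDiff_Ψ hX) hU).sub (contMDiff_finsetSum fun k _ ↦ ?_)
  simpa only [update_apply_field] using!
    S.contMDiff_Ψ (smoothField_update hX k (S.smoothField_nablaU hU (hX k)))

/-- Near a point, α is the quotient of (∇^{U(n)}Ψ)(X₁, …, Xₙ) by Ψ(X₁, …, Xₙ) for fixed smooth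
fields with nonzero denominator; the pointwise choices in `alphaΨ` drop out. -/
theorem contMDiff_thetaΨ (hU : SmoothField (𝓡 (2 * n)) U) :
    ContMDiff (𝓡 (2 * n)) 𝓘(ℝ, ℝ) ∞ (fun x ↦ S.thetaΨ x (U x)) := by
  intro x
  obtain ⟨v, hv⟩ := S.exists_Ψ_ne_zero x
  have hX (k) := smoothField_smoothExt (I := 𝓡 (2 * n)) (v k)
  have h1 := S.contMDiff_Ψ hX
  have h2 : S.Ψ x (fun k ↦ smoothExt (v k) x) ≠ 0 := by simpa using hv
  have h3 := ((contDiff_mul (𝕜 := ℝ) (𝔸 := ℂ) (n := ∞)).contMDiff _).comp x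
    ((S.contMDiff_nablaΨ hU hX x).prodMk_space ((contDiffAt_inv ℝ h2).contMDiffAt.comp x (h1 x)))
  have h4 := (Complex.imCLM.contMDiff (n := ∞) _).comp x h3
  have h5 := ((ContinuousLinearMap.mul ℝ ℝ ((n : ℝ)⁻¹)).contMDiff (n := ∞) _).comp x h4
  refine h5.congr_of_eventuallyEq ?_
  filter_upwards [h1.continuous.continuousAt.eventually_ne h2] with y hy
  have := S.nablaΨ_eq y (U y) hX
  change (S.alphaΨ y (U y)).im / n = (n : ℝ)⁻¹ * (S.nablaΨ y (U y) (fun k ↦ smoothExt (v k)) *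
    (S.Ψ y fun k ↦ smoothExt (v k) y)⁻¹ : ℂ).im
  rw [this, mul_inv_cancel_right₀ hy, div_eq_inv_mul]

/-- The vector field `Y` with `θ(V) = g(Y, JV)`. -/
def leeField (x : M) : TangentSpace (𝓡 (2 * n)) x :=
  ∑ i, -S.thetaΨ x (S.J x (stdOrthonormalBasis ℝ (TangentSpace (𝓡 (2 * n)) x) i)) •
    stdOrthonormalBasis ℝ (TangentSpace (𝓡 (2 * n)) x) i

theorem inner_leeField (x : M) (v : TangentSpace (𝓡 (2 * n)) x) :
    inner ℝ (S.leeField x) v = -S.thetaΨ x (S.J x v) := by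
  conv_rhs => rw [← (stdOrthonormalBasis ℝ (TangentSpace (𝓡 (2 * n)) x)).sum_repr' v]
  simp only [leeField, sum_inner, map_sum, map_smul, real_inner_smul_left, inner_neg_left, smul_eq_mul,
    ← Finset.sum_neg_distrib, neg_smul]
  exact Finset.sum_congr rfl fun i _ ↦ by ring

theorem thetaΨ_eq (x : M) (v : TangentSpace (𝓡 (2 * n)) x) :
    S.thetaΨ x v = inner ℝ (S.leeField x) (S.J x v) := by
  rw [inner_leeField, S.J_J, map_neg, neg_neg]

theorem smoothField_leeField : SmoothField (𝓡 (2 * n)) S.leeField := by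
  refine smoothField_of_inner fun Z hZ ↦ ?_
  have : (fun p ↦ inner ℝ (Z p) (S.leeField p)) = fun p ↦ -S.thetaΨ p (S.JX Z p) := by
    ext p; rw [real_inner_comm, inner_leeField]; rfl
  rw [this]
  exact (S.contMDiff_thetaΨ (S.smoothField_JX hZ)).neg

/-- The tensor `ξ^{U(n)} + θ ⊗ J`, which is the intrinsic torsion of the `SU(n)`-structure. -/
def xiSU (x : M) : TangentSpace (𝓡 (2 * n)) x →ₗ[ℝ] Module.End ℝ (TangentSpace (𝓡 (2 * n)) x) :=
  S.xiU x + (S.thetaΨ x).smulRight (S.Jend x)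

theorem xiSU_apply (x : M) (u : TangentSpace (𝓡 (2 * n)) x) :
    S.xiSU x u = S.xiU x u + S.thetaΨ x u • S.Jend x := rfl

theorem deformed_xiSU (X : Π x : M, TangentSpace (𝓡 (2 * n)) x) (x : M)
    (u : TangentSpace (𝓡 (2 * n)) x) :
    deformed S.xiSU X x u = deformed S.xiU X x u + S.thetaΨ x u • S.J x (X x) :=
  (add_assoc _ _ _).symm

theorem parallelJ_xiSU : S.ParallelJ S.xiSU := fun X hX x u ↦ by
  have h := S.deformed_xiU_JX x u hX
  simp only [deformed_xiSU, map_add, map_smul, ← h]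
  rfl

/-- Each of the n arguments receives an additional θJ, and Ψ turns every J into i; the total i n θ Ψ
is exactly the defect αΨ. -/
theorem parallelΨ_xiSU : S.ParallelΨ S.xiSU := fun X hX x u ↦ by
  have h := S.nablaΨ_eq x u hX
  rw [nablaΨ, sub_eq_iff_eq_add] at h
  simp only [deformed_xiSU, AlternatingMap.map_update_add, AlternatingMap.map_update_smul, S.Ψ_J,
    Finset.sum_add_distrib]
  rw [h, alphaΨ_eq]
  simp
  ring

theorem isTorsionSU_xiSU : S.IsTorsionSU S.xiSU :=
  ⟨fun x u ↦ add_mem (perpAlg_uAlg_le (S.J_J x) (S.isTorsionU_xiU.1 x u))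
    (Submodule.smul_mem _ _ (J_mem_perpAlg_suAlg (S.J_J x) (S.inner_Jend x))),
    S.parallelJ_xiSU, S.parallelΨ_xiSU⟩

/-- The difference of two solutions commutes with J and acts trivially on Ψ, so its complex trace
vanishes and it lies in su(n); it is also orthogonal to su(n). -/
theorem torsionSU_eq : S.torsionSU = S.xiSU := by
  have h : S.IsTorsionSU (Classical.epsilon S.IsTorsionSU) :=
    Classical.epsilon_spec ⟨_, S.isTorsionSU_xiSU⟩
  set ζ := Classical.epsilon S.IsTorsionSU
  change ζ = _
  funext x
  refine LinearMap.ext fun u ↦ sub_eq_zero.1 ?_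
  have hp := sub_mem (h.1 x u) (S.isTorsionSU_xiSU.1 x u)
  have hc := S.sub_comm_of_parallelJ h.2.1 S.isTorsionSU_xiSU.2.1 x u
  refine eq_zero_of_mem_suAlg_of_mem_perpAlg (S.J_J x) ⟨⟨hp.1, hc⟩, ?_⟩ hp
  obtain ⟨v, hv⟩ := S.exists_Ψ_ne_zero x
  rw [LinearMap.trace_mul_comm]
  refine trace_eq_zero_of_form (J_mul_J (J := S.Jend x) (S.J_J x)) (finrank_tangentSpace_two_mul x)
    (S.Ψ x) (S.Ψ_J x) hv _ hc fun w ↦ ?_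
  have h1 := h.2.2 (fun k ↦ smoothExt (w k)) (fun k ↦ smoothField_smoothExt _) x u
  have h2 := S.parallelΨ_xiSU (fun k ↦ smoothExt (w k)) (fun k ↦ smoothField_smoothExt _) x u
  rw [h1] at h2
  simp only [deformed, AlternatingMap.map_update_add, Finset.sum_add_distrib, smoothExt_self,
    add_right_inj] at h2
  simp only [LinearMap.sub_apply, AlternatingMap.map_update_sub, Finset.sum_sub_distrib, h2, sub_self]

theorem trace_xiU_mul_J (x : M) (u : TangentSpace (𝓡 (2 * n)) x) :
    LinearMap.trace ℝ _ (S.xiU x u * S.Jend x) = 0 :=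
  trace_mul_eq_zero_of_anticomm (S.J_J x) (S.xiU_anticomm x u) rfl

/-- ξ^{U(n)} is trace orthogonal to J, and tr(J²) = −2n normalises the remaining term θJ. -/
theorem componentW5_eq (hn : 0 < n) (x : M) (u : TangentSpace (𝓡 (2 * n)) x) :
    S.componentW5 x u = S.thetaΨ x u • S.Jend x := by
  have : (n : ℝ) ≠ 0 := by positivity
  rw [componentW5, torsionSU_eq, scalarPart_eq, xiSU_apply, add_mul, map_add, trace_xiU_mul_J,
    smul_mul_assoc, map_smul, trace_J_mul_J (S.J_J x), finrank_tangentSpace_two_mul]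
  congr 1
  push_cast
  field_simp
  simp [mul_comm]

/-- The W₅-component is θ ⊗ J, so `hη` says θ = η ∘ J once it is evaluated on a nonzero vector. In
particular η is smooth although this is not assumed. -/
theorem inner_leeField_eq (η : Π x : M, TangentSpace (𝓡 (2 * n)) x →L[ℝ] ℝ)
    (hη : ∀ (x : M) (u v : TangentSpace (𝓡 (2 * n)) x),
      S.componentW5 x u v = η x (S.J x u) • S.J x v) (x : M) (v : TangentSpace (𝓡 (2 * n)) x) :
    inner ℝ (S.leeField x) v = η x v := by
  rcases n.eq_zero_or_pos with rfl | hn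
  · have : Subsingleton (TangentSpace (𝓡 (2 * 0)) x) :=
      inferInstanceAs (Subsingleton (EuclideanSpace ℝ (Fin 0)))
    simp [Subsingleton.elim v 0]
  · have : Nontrivial (TangentSpace (𝓡 (2 * n)) x) := by
      apply Module.nontrivial_of_finrank_pos (R := ℝ)
      rw [finrank_tangentSpace_two_mul]
      omega
    obtain ⟨w, hw⟩ := exists_ne (0 : TangentSpace (𝓡 (2 * n)) x)
    have hJw : S.J x w ≠ 0 := fun h ↦ hw (by simpa [h] using S.J_J x w)
    have h := hη x (S.J x v) w
    rw [S.componentW5_eq hn, S.J_J, map_neg] at h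
    have h2 : S.thetaΨ x (S.J x v) = -η x v := smul_left_injective ℝ hJw h
    rw [inner_leeField, h2, neg_neg]

end SUStructure

end TorsionSU

/-! ### Curvature of the SU(n)-connection and the pointwise identity. -/

section CurvatureIdentity

variable {n : ℕ} {M : Type*} [TopologicalSpace M]
  [ChartedSpace (EuclideanSpace ℝ (Fin (2 * n))) M] [IsManifold (𝓡 (2 * n)) ∞ M]
  [RiemannianBundle (fun x : M ↦ TangentSpace (𝓡 (2 * n)) x)]
  [IsContMDiffRiemannianBundle (𝓡 (2 * n)) ∞ (EuclideanSpace ℝ (Fin (2 * n)))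
    (fun x : M ↦ TangentSpace (𝓡 (2 * n)) x)] [T2Space M]

/-- Updates at distinct indices commute. This symmetry cancels the terms in which U and V
differentiate different arguments of Ψ. -/
theorem sum_sum_erase_update_comm {ι A : Type*} [Fintype ι] [DecidableEq ι] [AddCommGroup A]
    {W : Type*} (f : (ι → W) → A) (X Y Z : ι → W) :
    ∑ k, ∑ j ∈ Finset.univ.erase k, f (Function.update (Function.update X j (Y j)) k (Z k)) =
      ∑ k, ∑ j ∈ Finset.univ.erase k, f (Function.update (Function.update X j (Z j)) k (Y k)) := by
  simp only [← Finset.filter_ne', Finset.sum_filter]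
  rw [Finset.sum_comm]
  refine Finset.sum_congr rfl fun k _ ↦ Finset.sum_congr rfl fun j _ ↦ ?_
  rcases eq_or_ne j k with rfl | h
  · simp
  · rw [if_pos h.symm, if_pos h, Function.update_comm h.symm]

namespace SUStructure

variable (S : SUStructure n M) {X Y U V : Π x : M, TangentSpace (𝓡 (2 * n)) x}

/-- The `SU(n)`-connection `∇ + ξ`, on vector fields. -/
def nablaSU (U X : Π x : M, TangentSpace (𝓡 (2 * n)) x) (x : M) : TangentSpace (𝓡 (2 * n)) x :=
  deformed S.xiSU X x (U x)

theorem nablaSU_eq (U X : Π x : M, TangentSpace (𝓡 (2 * n)) x) :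
    S.nablaSU U X = nabla U X + (fun x ↦ S.xiU x (U x) (X x)) +
      (fun x ↦ S.thetaΨ x (U x)) • S.JX X := by
  ext x; exact S.deformed_xiSU X x (U x)

theorem smoothField_nablaSU (hU : SmoothField (𝓡 (2 * n)) U) (hX : SmoothField (𝓡 (2 * n)) X) :
    SmoothField (𝓡 (2 * n)) (S.nablaSU U X) := by
  rw [nablaSU_eq]
  exact ((hU.nabla hX).add (S.smoothField_xiU hU hX)).add
    ((S.smoothField_JX hX).smul (S.contMDiff_thetaΨ hU))

/-- The curvature operator of the `SU(n)`-connection `∇ + ξ`. -/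
def curvSU (U V X : Π x : M, TangentSpace (𝓡 (2 * n)) x) (x : M) : TangentSpace (𝓡 (2 * n)) x :=
  S.nablaSU U (S.nablaSU V X) x - S.nablaSU V (S.nablaSU U X) x -
    S.nablaSU (VectorField.mlieBracket (𝓡 (2 * n)) U V) X x

theorem curvSU_JX (hU : SmoothField (𝓡 (2 * n)) U) (hV : SmoothField (𝓡 (2 * n)) V)
    (hX : SmoothField (𝓡 (2 * n)) X) (x : M) :
    S.curvSU U V (S.JX X) x = S.J x (S.curvSU U V X x) := by
  have h {W Z : Π x : M, TangentSpace (𝓡 (2 * n)) x} (hZ : SmoothField (𝓡 (2 * n)) Z) :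
      S.nablaSU W (S.JX Z) = S.JX (S.nablaSU W Z) := by
    ext y; exact S.parallelJ_xiSU Z hZ y (W y)
  rw [curvSU, h hX, h hX, h hX, h (S.smoothField_nablaSU hV hX), h (S.smoothField_nablaSU hU hX)]
  simp only [curvSU, map_sub]
  rfl

theorem mvfderiv_Ψ {X : Fin n → Π x : M, TangentSpace (𝓡 (2 * n)) x}
    (hX : ∀ k, SmoothField (𝓡 (2 * n)) (X k)) (U : Π x : M, TangentSpace (𝓡 (2 * n)) x) (x : M) :
    mvfderiv (𝓡 (2 * n)) (fun y ↦ S.Ψ y fun k ↦ X k y) x (U x) =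
      ∑ k, S.Ψ x (fun j ↦ Function.update X k (S.nablaSU U (X k)) j x) := by
  rw [S.parallelΨ_xiSU X hX x (U x)]
  simp only [update_apply_field]
  rfl

theorem mvfderiv_mvfderiv_Ψ {X : Fin n → Π x : M, TangentSpace (𝓡 (2 * n)) x}
    (hX : ∀ k, SmoothField (𝓡 (2 * n)) (X k)) (hV : SmoothField (𝓡 (2 * n)) V)
    (U : Π x : M, TangentSpace (𝓡 (2 * n)) x) (x : M) :
    mvfderiv (𝓡 (2 * n)) (fun y ↦ mvfderiv (𝓡 (2 * n)) (fun y ↦ S.Ψ y fun k ↦ X k y) y (V y))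
        x (U x) =
      ∑ k, S.Ψ x (Function.update (fun j ↦ X j x) k (S.nablaSU U (S.nablaSU V (X k)) x)) +
      ∑ k, ∑ j ∈ Finset.univ.erase k, S.Ψ x (Function.update (Function.update (fun j ↦ X j x) j
          (S.nablaSU U (X j) x)) k (S.nablaSU V (X k) x)) := by
  simp only [S.mvfderiv_Ψ hX V]
  have hs (k) := smoothField_update hX k (S.smoothField_nablaSU hV (hX k))
  rw [mvfderiv_finset_sum _ fun k ↦ contMDiff_mdiffAt (S.contMDiff_Ψ (hs k)) x,
    ← Finset.sum_add_distrib]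
  refine Finset.sum_congr rfl fun k _ ↦ ?_
  rw [S.parallelΨ_xiSU _ (hs k) x (U x)]
  exact S.sum_update_eq (ξ := S.xiSU) X k x (U x)

/-- Apply [U, V]f = U(Vf) − V(Uf) to f = Ψ(X₁, …, Xₙ). As Ψ is parallel, all derivatives fall on the
arguments, and only those with both on the same argument remain. -/
theorem sum_Ψ_curvSU {X : Fin n → Π x : M, TangentSpace (𝓡 (2 * n)) x}
    (hX : ∀ k, SmoothField (𝓡 (2 * n)) (X k)) (hU : SmoothField (𝓡 (2 * n)) U)
    (hV : SmoothField (𝓡 (2 * n)) V) (x : M) :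
    ∑ k, S.Ψ x (Function.update (fun j ↦ X j x) k (S.curvSU U V (X k) x)) = 0 := by
  have h := mvfderiv_mlieBracket hU hV (S.contMDiff_Ψ hX) x
  rw [S.mvfderiv_mvfderiv_Ψ hX hU, S.mvfderiv_mvfderiv_Ψ hX hV, S.mvfderiv_Ψ hX,
    sum_sum_erase_update_comm (S.Ψ x), add_sub_add_right_eq_sub] at h
  simp only [update_apply_field] at h
  simp only [curvSU, AlternatingMap.map_update_sub, Finset.sum_sub_distrib, h, sub_self]

theorem leviCivita_JX (hX : SmoothField (𝓡 (2 * n)) X) (x : M) (u : TangentSpace (𝓡 (2 * n)) x) :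
    leviCivita (S.JX X) x u = S.J x (leviCivita X x u) + (2 : ℝ) • S.J x (S.xiU x u (X x)) := by
  rw [← S.nablaJ_eq, S.nablaJ_apply x u hX]
  abel

/-- `K` is the derivative along U of the endomorphism field ξ_V. Differentiating ξ_V J = −Jξ_V with
∇_U J = 2Jξ_U gives KJ + JK = −2J[ξ_U, ξ_V], so tr(JK) contains no derivative of ξ. -/
theorem exists_nablaXi (U : Π x : M, TangentSpace (𝓡 (2 * n)) x) (hV : SmoothField (𝓡 (2 * n)) V) (x : M) :
    ∃ K : Module.End ℝ (TangentSpace (𝓡 (2 * n)) x), (∀ X, SmoothField (𝓡 (2 * n)) X →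
      K (X x) = leviCivita (fun y ↦ S.xiU y (V y) (X y)) x (U x) -
        S.xiU x (V x) (leviCivita X x (U x))) ∧
      LinearMap.trace ℝ _ (S.Jend x * K) =
        -LinearMap.trace ℝ _ (S.Jend x * ⁅S.xiU x (U x), S.xiU x (V x)⁆) := by
  obtain ⟨K, hK⟩ := exists_linearMap (x := x) (I := 𝓡 (2 * n))
    (fun X ↦ leviCivita (fun y ↦ S.xiU y (V y) (X y)) x (U x) -
        S.xiU x (V x) (leviCivita X x (U x)))
    (fun X Y hX hY ↦ by
      have : (fun y ↦ S.xiU y (V y) ((X + Y) y)) =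
          (fun y ↦ S.xiU y (V y) (X y)) + fun y ↦ S.xiU y (V y) (Y y) := by
        ext y; simp
      rw [this, leviCivita_add hX hY, leviCivita_add (S.smoothField_xiU hV hX)
        (S.smoothField_xiU hV hY), map_add]
      abel)
    (fun f X hf hX ↦ by
      have : (fun y ↦ S.xiU y (V y) ((f • X) y)) = f • (fun y ↦ S.xiU y (V y) (X y)) := by
        ext y; simp
      rw [this, leviCivita_smul hf hX, leviCivita_smul hf (S.smoothField_xiU hV hX), map_add,
        map_smul, map_smul]
      module)
  refine ⟨K, hK, ?_⟩
  set a := S.xiU x (U x) with ha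
  set b := S.xiU x (V x) with hb
  have h : K * S.Jend x = -(S.Jend x * K) - (2 : ℝ) • (S.Jend x * ⁅a, b⁆) := by
    refine end_ext fun X hX ↦ ?_
    have e1 := hK _ (S.smoothField_JX hX)
    have e2 := hK _ hX
    have e3 : (fun y ↦ S.xiU y (V y) (S.JX X y)) = -S.JX fun y ↦ S.xiU y (V y) (X y) := by
      ext y; exact S.xiU_anticomm_apply y (V y) (X y)
    have hs := S.smoothField_xiU hV hX
    rw [e3, leviCivita_neg (S.smoothField_JX hs), S.leviCivita_JX hX, S.leviCivita_JX hs, map_add,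
      map_smul, S.xiU_anticomm_apply, S.xiU_anticomm_apply] at e1
    change K (S.JX X x) = -(S.J x (K (X x))) - (2 : ℝ) • S.J x (a (b (X x)) - b (a (X x)))
    rw [e1, e2, map_sub, map_sub]
    module
  have h2 := congrArg (LinearMap.trace ℝ _) h
  rw [LinearMap.trace_mul_comm, map_sub, map_neg, map_smul, smul_eq_mul] at h2
  linarith

/-- The exterior derivative of `θ` on a pair of vector fields. -/
def dTheta (U V : Π x : M, TangentSpace (𝓡 (2 * n)) x) (x : M) : ℝ :=
  mvfderiv (𝓡 (2 * n)) (fun y ↦ S.thetaΨ y (V y)) x (U x) -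
    mvfderiv (𝓡 (2 * n)) (fun y ↦ S.thetaΨ y (U y)) x (V x) -
    S.thetaΨ x (VectorField.mlieBracket (𝓡 (2 * n)) U V x)

theorem mvfderiv_thetaΨ (hV : SmoothField (𝓡 (2 * n)) V) (x : M) (u : TangentSpace (𝓡 (2 * n)) x) :
    mvfderiv (𝓡 (2 * n)) (fun y ↦ S.thetaΨ y (V y)) x u =
      inner ℝ (leviCivita S.leeField x u) (S.J x (V x)) +
        inner ℝ (S.leeField x) (S.J x (leviCivita V x u)) +
        2 * inner ℝ (S.leeField x) (S.J x (S.xiU x u (V x))) := by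
  have : (fun y ↦ S.thetaΨ y (V y)) = fun y ↦ inner ℝ (S.leeField y) (S.JX V y) := by
    ext y; exact S.thetaΨ_eq y _
  rw [this, mvfderiv_inner S.smoothField_leeField (S.smoothField_JX hV), S.leviCivita_JX hV,
    inner_add_right, real_inner_smul_right, add_assoc]
  rfl

/-- The derivatives of U and V cancel against θ([U, V]) since ∇ is torsion free. There remain ∇Y and
the contribution of ∇J = 2Jξ. -/
theorem dTheta_eq (hU : SmoothField (𝓡 (2 * n)) U) (hV : SmoothField (𝓡 (2 * n)) V) (x : M) :
    S.dTheta U V x = inner ℝ (leviCivita S.leeField x (U x)) (S.J x (V x)) -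
      inner ℝ (leviCivita S.leeField x (V x)) (S.J x (U x)) +
      2 * inner ℝ (S.leeField x) (S.J x (S.xiU x (U x) (V x))) -
      2 * inner ℝ (S.leeField x) (S.J x (S.xiU x (V x) (U x))) := by
  rw [dTheta, S.mvfderiv_thetaΨ hV, S.mvfderiv_thetaΨ hU, thetaΨ_eq, ← nabla_sub_nabla hU hV,
    map_sub, inner_sub_right]
  simp only [nabla]
  ring

/-- The last bracket collects the terms symmetric in U and V, which drop out of the curvature. -/
theorem nablaSU_nablaSU (hV : SmoothField (𝓡 (2 * n)) V)
    (hX : SmoothField (𝓡 (2 * n)) X) (x : M) :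
    S.nablaSU U (S.nablaSU V X) x = nabla U (nabla V X) x +
      (leviCivita (fun y ↦ S.xiU y (V y) (X y)) x (U x) - S.xiU x (V x) (leviCivita X x (U x))) +
      S.xiU x (U x) (S.xiU x (V x) (X x)) +
      mvfderiv (𝓡 (2 * n)) (fun y ↦ S.thetaΨ y (V y)) x (U x) • S.J x (X x) +
      (S.xiU x (U x) (leviCivita X x (V x)) + S.xiU x (V x) (leviCivita X x (U x)) +
      S.thetaΨ x (V x) • S.J x (leviCivita X x (U x)) +
      S.thetaΨ x (U x) • S.J x (leviCivita X x (V x)) +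
      S.thetaΨ x (V x) • S.J x (S.xiU x (U x) (X x)) +
      S.thetaΨ x (U x) • S.J x (S.xiU x (V x) (X x)) -
      (S.thetaΨ x (U x) * S.thetaΨ x (V x)) • X x) := by
  have h1 := hV.nabla hX
  have h2 := S.smoothField_xiU hV hX
  have h3 := (S.smoothField_JX hX).smul (S.contMDiff_thetaΨ hV)
  rw [S.nablaSU_eq U]
  simp only [Pi.add_apply, Pi.smul_apply', JX]
  rw [nabla, S.nablaSU_eq V, leviCivita_add (h1.add h2) h3, leviCivita_add h1 h2,
    leviCivita_smul (S.contMDiff_thetaΨ hV) (S.smoothField_JX hX), S.leviCivita_JX hX]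
  simp only [Pi.add_apply, Pi.smul_apply', JX, map_add, map_smul, S.J_J, nabla,
    S.xiU_anticomm_apply]
  module

/-- The curvature `Q` of ∇ + ξ satisfies tr(JQ) = 0, since it commutes with J and annihilates Ψ. In
this trace `K − L` gives −2 tr(J[ξ_u, ξ_v]), the bracket gives +1 times the same, ξ_{[U,V]} gives
nothing and dθ J gives −2n dθ; solving for tr(JR) is the claim. -/
theorem trace_curvature (x : M) (u v : TangentSpace (𝓡 (2 * n)) x) :
    ∃ R : Module.End ℝ (TangentSpace (𝓡 (2 * n)) x), (R : _ → _) = curvature x u v ∧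
      LinearMap.trace ℝ _ (S.Jend x * R) =
        Module.finrank ℝ (TangentSpace (𝓡 (2 * n)) x) *
          (inner ℝ (leviCivita S.leeField x u) (S.J x v) -
            inner ℝ (leviCivita S.leeField x v) (S.J x u) +
            2 * inner ℝ (S.leeField x) (S.J x (S.xiU x u v)) -
            2 * inner ℝ (S.leeField x) (S.J x (S.xiU x v u))) +
        LinearMap.trace ℝ _ (S.Jend x * ⁅S.xiU x u, S.xiU x v⁆) := by
  obtain ⟨U, hU, hu⟩ := exists_smoothField_extend u
  obtain ⟨V, hV, hv⟩ := exists_smoothField_extend v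
  have hux : U x = u := by simpa using hu.self_of_nhds
  have hvx : V x = v := by simpa using hv.self_of_nhds
  obtain ⟨R, hR⟩ := exists_linearMap (x := x) (I := 𝓡 (2 * n)) (fun X ↦ curvOp U V X x)
    (fun X Y hX hY ↦ curvOp_add hU hV hX hY x) (fun f X hf hX ↦ curvOp_smul hU hV hf hX x)
  refine ⟨R, ?_, ?_⟩
  · ext w : 1
    have h := hR _ (smoothField_smoothExt w)
    have h2 := curvature_eq_curvOp hU hV (smoothField_smoothExt w) hu hv
    rw [smoothExt_self] at h h2
    rw [h, h2]
  obtain ⟨K, hK, hKt⟩ := S.exists_nablaXi U hV x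
  obtain ⟨L, hL, hLt⟩ := S.exists_nablaXi V hU x
  let Q : Module.End ℝ (TangentSpace (𝓡 (2 * n)) x) := R + K - L + ⁅S.xiU x (U x), S.xiU x (V x)⁆ -
    S.xiU x (VectorField.mlieBracket (𝓡 (2 * n)) U V x) + S.dTheta U V x • S.Jend x
  have hQ (X) (hX : SmoothField (𝓡 (2 * n)) X) : Q (X x) = S.curvSU U V X x := by
    have hb : S.nablaSU (VectorField.mlieBracket (𝓡 (2 * n)) U V) X x = _ :=
      S.deformed_xiSU X x _
    rw [curvSU, S.nablaSU_nablaSU hV hX, S.nablaSU_nablaSU hU hX, hb, deformed, ← hK X hX,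
      ← hL X hX]
    simp only [Q, LinearMap.add_apply, LinearMap.sub_apply, LinearMap.smul_apply, hR X hX, curvOp,
      dTheta, Ring.lie_def, Module.End.mul_apply, ContinuousLinearMap.coe_coe]
    simp only [nabla]
    module
  have hQJ : Q * S.Jend x = S.Jend x * Q := by
    refine end_ext fun X hX ↦ ?_
    change Q (S.JX X x) = S.J x (Q (X x))
    rw [hQ _ (S.smoothField_JX hX), hQ _ hX, S.curvSU_JX hU hV hX]
  have hQt : LinearMap.trace ℝ _ (S.Jend x * Q) = 0 := by
    obtain ⟨w, hw⟩ := S.exists_Ψ_ne_zero x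
    refine trace_eq_zero_of_form (J_mul_J (J := S.Jend x) (S.J_J x))
      (finrank_tangentSpace_two_mul x) (S.Ψ x) (S.Ψ_J x) hw Q hQJ fun w ↦ ?_
    have h := S.sum_Ψ_curvSU (fun k ↦ smoothField_smoothExt (w k)) hU hV x
    simpa only [← hQ _ (smoothField_smoothExt _), smoothExt_self] using h
  have hξt : LinearMap.trace ℝ _
      (S.Jend x * S.xiU x (VectorField.mlieBracket (𝓡 (2 * n)) U V x)) = 0 := by
    rw [LinearMap.trace_mul_comm, trace_xiU_mul_J]
  have hlie : ⁅S.xiU x (V x), S.xiU x (U x)⁆ = -⁅S.xiU x (U x), S.xiU x (V x)⁆ :=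
    by rw [Ring.lie_def, Ring.lie_def, neg_sub]
  simp only [Q, mul_add, mul_sub, map_add, map_sub, hKt, hLt, hξt, mul_smul_comm, map_smul,
    trace_J_mul_J (S.J_J x), hlie, mul_neg, map_neg, smul_eq_mul] at hQt
  rw [S.dTheta_eq hU hV, hux, hvx] at hQt
  linarith

theorem sReal_eq (x : M) : S.sReal x = scalarAlt (S.Jend x) (S.xiU x) -
    2 * LinearMap.trace ℝ _ (leviCivita S.leeField x).toLinearMap +
      4 * inner ℝ (S.leeField x) (S.charU x) := by
  choose R hR hRt using S.trace_curvature x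
  have h := sum_scalarPart_curvature (S.J_J x) (S.inner_Jend x) (S.xiU_mem_soAlg x)
    (S.xiU_anticomm x) (B := (leviCivita S.leeField x).toLinearMap) hRt
  rw [charU, torsionU_eq, ← h]
  simp only [hR]
  rfl

theorem sAlt_eq (x : M) : S.sAlt x = scalarAlt (S.Jend x) (S.xiU x) -
    4 * inner ℝ (S.leeField x) (S.charU x) := by
  have h := sum_suPerpPart_bracket (S.J_J x) (S.inner_Jend x) (S.xiU_mem_soAlg x)
    (S.xiU_anticomm x) (S.thetaΨ_eq x)
  rw [charU, torsionU_eq, ← h, sAlt, torsionSU_eq]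
  rfl

theorem sReal_sub_sAlt (x : M) : S.sReal x - S.sAlt x = 8 * inner ℝ (S.leeField x) (S.charU x) -
    2 * LinearMap.trace ℝ _ (leviCivita S.leeField x).toLinearMap := by
  rw [sReal_eq, sAlt_eq]; ring

end SUStructure

end CurvatureIdentity

/-! ### Jacobi's formula for the derivative of a determinant. -/

section Determinant

variable {m : ℕ} {F : Type*} [NormedAddCommGroup F] [NormedSpace ℝ F]

/-- The determinant is multilinear in the rows, and replacing one row by its derivative is evaluated
by Cramer's rule. -/
theorem hasFDerivAt_matrix_det {G : F → Matrix (Fin m) (Fin m) ℝ} {G' : Fin m → Fin m → F →L[ℝ] ℝ}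
    {y : F} (h : ∀ i j, HasFDerivAt (fun y ↦ G y i j) (G' i j) y) :
    HasFDerivAt (fun y ↦ (G y).det) (∑ i, ∑ j, (G y).adjugate j i • G' i j) y := by
  let f : ContinuousMultilinearMap ℝ (fun _ : Fin m ↦ Fin m → ℝ) ℝ :=
    { (Matrix.detRowAlternating (n := Fin m) (R := ℝ)).toMultilinearMap with
      cont := Continuous.matrix_det (A := fun B : Matrix (Fin m) (Fin m) ℝ ↦ B) continuous_id }
  have hg (i) : HasFDerivAt (fun y j ↦ G y i j) (ContinuousLinearMap.pi (G' i)) y :=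
    hasFDerivAt_pi.2 (h i)
  refine (HasFDerivAt.multilinear_comp (f := f) hg).congr_fderiv ?_
  ext u
  simp only [_root_.sum_apply, ContinuousLinearMap.comp_apply, _root_.smul_apply, smul_eq_mul]
  refine Finset.sum_congr rfl fun i _ ↦ ?_
  have h1 := Matrix.cramer_transpose_apply (G y) (fun j ↦ G' i j u) i
  rw [Matrix.cramer_eq_adjugate_mulVec, ← Matrix.adjugate_transpose] at h1
  exact h1.symm

/-- BG + GBᵀ is the derivative of a Gram matrix G under a metric connection with matrix B; this
computes the resulting derivative of det G. -/
theorem sum_sum_adjugate_mul (G B : Matrix (Fin m) (Fin m) ℝ) :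
    ∑ i, ∑ j, G.adjugate j i * (B * G + G * B.transpose) i j = 2 * G.det * B.trace := by
  have h : ∑ i, ∑ j, G.adjugate j i * (B * G + G * B.transpose) i j =
      ((B * G + G * B.transpose) * G.adjugate).trace := by
    simp only [Matrix.trace, Matrix.diag, Matrix.mul_apply (N := G.adjugate), mul_comm]
  rw [h, add_mul, Matrix.trace_add, mul_assoc, Matrix.mul_adjugate,
    Matrix.trace_mul_comm (G * B.transpose), ← mul_assoc, Matrix.adjugate_mul]
  simp [Matrix.trace_smul, two_mul, add_mul]

end Determinant

/-! ### Coordinate fields and derivatives in a chart. -/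

section Charts

variable {m : ℕ} {M : Type*} [TopologicalSpace M]
  [ChartedSpace (EuclideanSpace ℝ (Fin m)) M] [IsManifold (𝓡 m) ∞ M]

/-- The coordinate vector field `∂ᵢ` of the preferred chart around `c`. -/
def coordField (c : M) (i : Fin m) : Π x : M, TangentSpace (𝓡 m) x :=
  (trivializationAt (EuclideanSpace ℝ (Fin m)) (TangentSpace (𝓡 m)) c).localFrame
    (EuclideanSpace.basisFun (Fin m) ℝ).toBasis i

/-- The coefficient of `∂ᵢ` in a vector field, which is zero outside of the chart. -/
def coordCoeff (c : M) (i : Fin m) (Z : Π x : M, TangentSpace (𝓡 m) x) (x : M) : ℝ :=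
  (trivializationAt (EuclideanSpace ℝ (Fin m)) (TangentSpace (𝓡 m)) c).localFrameCoeff (𝓡 m)
    (EuclideanSpace.basisFun (Fin m) ℝ).toBasis i x (Z x)

/-- The coordinate basis of a tangent space. -/
def coordBasis {c x : M} (hx : x ∈ (chartAt (EuclideanSpace ℝ (Fin m)) c).source) :
    Module.Basis (Fin m) ℝ (TangentSpace (𝓡 m) x) :=
  (trivializationAt (EuclideanSpace ℝ (Fin m)) (TangentSpace (𝓡 m)) c).basisAt
    (EuclideanSpace.basisFun (Fin m) ℝ).toBasis hx

theorem coordField_eq_coordBasis {c x : M}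
    (hx : x ∈ (chartAt (EuclideanSpace ℝ (Fin m)) c).source) (i : Fin m) :
    coordField c i x = coordBasis hx i :=
  Trivialization.localFrame_apply_of_mem_baseSet _ _ hx

theorem coordCoeff_eq {c x : M} (hx : x ∈ (chartAt (EuclideanSpace ℝ (Fin m)) c).source)
    (i : Fin m) (Z : Π x : M, TangentSpace (𝓡 m) x) :
    coordCoeff c i Z x = (coordBasis hx).repr (Z x) i :=
  Trivialization.localFrameCoeff_apply_of_mem_baseSet _ _ hx Z i

theorem eq_sum_coordCoeff {c x : M} (hx : x ∈ (chartAt (EuclideanSpace ℝ (Fin m)) c).source)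
    (Z : Π x : M, TangentSpace (𝓡 m) x) :
    Z x = ∑ i, coordCoeff c i Z x • coordField c i x := by
  simp only [coordCoeff_eq hx, coordField_eq_coordBasis hx]
  exact ((coordBasis hx).sum_repr (Z x)).symm

theorem contMDiffOn_coordField (c : M) (i : Fin m) :
    ContMDiffOn (𝓡 m) (𝓡 m).tangent ∞
      (fun x ↦ (⟨x, coordField c i x⟩ : TangentBundle (𝓡 m) M))
      (chartAt (EuclideanSpace ℝ (Fin m)) c).source :=
  Trivialization.contMDiffOn_localFrame_baseSet ∞ _ _ i

theorem contMDiffOn_coordCoeff (c : M) (i : Fin m) {Z : Π x : M, TangentSpace (𝓡 m) x}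
    (hZ : SmoothField (𝓡 m) Z) : ContMDiffOn (𝓡 m) 𝓘(ℝ, ℝ) ∞ (coordCoeff c i Z)
      (chartAt (EuclideanSpace ℝ (Fin m)) c).source :=
  contMDiffOn_baseSet_localFrameCoeff (I := 𝓡 m) (k := ∞)
    (e := trivializationAt (EuclideanSpace ℝ (Fin m)) (TangentSpace (𝓡 m)) c)
    (EuclideanSpace.basisFun (Fin m) ℝ).toBasis (s := Z) hZ.contMDiffOn i

/-- This links the frame of the trivialization to the derivatives of the inverse chart in
`gramMatrix`. The equality lives in the model space because the two tangent spaces have different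
base points syntactically. -/
theorem coordField_eq_mfderiv {c x : M} {y : EuclideanSpace ℝ (Fin m)}
    (hx : x ∈ (chartAt (EuclideanSpace ℝ (Fin m)) c).source)
    (hy : chartAt (EuclideanSpace ℝ (Fin m)) c x = y) (i : Fin m) :
    @Eq (EuclideanSpace ℝ (Fin m)) (coordField c i x)
      (mfderiv (𝓡 m) (𝓡 m) (chartAt (EuclideanSpace ℝ (Fin m)) c).symm y
        (EuclideanSpace.single i 1)) := by
  subst hy
  have h := TangentBundle.symmL_trivializationAt (𝕜 := ℝ) (I := 𝓡 m) hx
  have h2 : coordField c i x =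
      (trivializationAt (EuclideanSpace ℝ (Fin m)) (TangentSpace (𝓡 m)) c).symmL ℝ x
        (EuclideanSpace.single i 1) := by
    rw [coordField_eq_coordBasis hx, coordBasis]
    simp [Trivialization.basisAt]
    exact (Trivialization.symmL_apply _ hx _).symm
  rw [h2, h]
  simp [mfderivWithin_univ, mfld_simps]
  rfl

theorem fderiv_comp_chart_symm {F : Type*} [NormedAddCommGroup F] [NormedSpace ℝ F] {f : M → F}
    {c x : M} {y : EuclideanSpace ℝ (Fin m)}
    (hx : x ∈ (chartAt (EuclideanSpace ℝ (Fin m)) c).source)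
    (hy : chartAt (EuclideanSpace ℝ (Fin m)) c x = y)
    (hf : MDifferentiableAt (𝓡 m) 𝓘(ℝ, F) f x) (i : Fin m) :
    fderiv ℝ (fun y ↦ f ((chartAt (EuclideanSpace ℝ (Fin m)) c).symm y)) y
      (EuclideanSpace.single i 1) = mvfderiv (𝓡 m) f x (coordField c i x) := by
  have h := coordField_eq_mfderiv hx hy i
  have hyt : y ∈ (chartAt (EuclideanSpace ℝ (Fin m)) c).target :=
    hy ▸ (chartAt (EuclideanSpace ℝ (Fin m)) c).map_source hx
  obtain rfl : x = (chartAt (EuclideanSpace ℝ (Fin m)) c).symm y := by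
    rw [← hy, OpenPartialHomeomorph.left_inv _ hx]
  have h2 := mfderiv_comp y hf (mdifferentiableAt_atlas_symm (I := 𝓡 m)
    (chart_mem_atlas (EuclideanSpace ℝ (Fin m)) c) hyt)
  rw [← mfderiv_eq_fderiv]
  change mfderiv (𝓡 m) 𝓘(ℝ, F) (f ∘ (chartAt (EuclideanSpace ℝ (Fin m)) c).symm) y
    (EuclideanSpace.single i 1) = _
  rw [h2]
  exact congrArg (mvfderiv (𝓡 m) f _) h.symm

theorem gramMatrix_apply [RiemannianBundle (fun x : M ↦ TangentSpace (𝓡 m) x)] {c : M}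
    {y : EuclideanSpace ℝ (Fin m)}
    (hy : y ∈ (chartAt (EuclideanSpace ℝ (Fin m)) c).target) (i j : Fin m) :
    gramMatrix m c y i j =
      inner ℝ (coordField c i ((chartAt (EuclideanSpace ℝ (Fin m)) c).symm y))
        (coordField c j ((chartAt (EuclideanSpace ℝ (Fin m)) c).symm y)) := by
  have h (k) := coordField_eq_mfderiv ((chartAt (EuclideanSpace ℝ (Fin m)) c).map_target hy)
    ((chartAt (EuclideanSpace ℝ (Fin m)) c).right_inv hy) k
  exact (congrArg₂ (fun v w : TangentSpace (𝓡 m)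
    ((chartAt (EuclideanSpace ℝ (Fin m)) c).symm y) ↦ (inner ℝ v w : ℝ)) (h i) (h j)).symm

theorem exists_contMDiff_eventuallyEq [T2Space M] {F : Type*} [NormedAddCommGroup F]
    [NormedSpace ℝ F] {f : M → F} {s : Set M} {x : M} (hs : s ∈ 𝓝 x)
    (hf : ContMDiffOn (𝓡 m) 𝓘(ℝ, F) ∞ f s) :
    ∃ g, ContMDiff (𝓡 m) 𝓘(ℝ, F) ∞ g ∧ ∀ᶠ y in 𝓝 x, g y = f y := by
  obtain ⟨t, hts, ht, hxt⟩ := mem_nhds_iff.1 hs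
  obtain ⟨ψ, hψ, hsupp, h1⟩ := exists_bump (I := 𝓡 m) (ht.mem_nhds hxt)
  refine ⟨fun y ↦ ψ y • f y, contMDiff_of_tsupport fun y hy ↦ ?_, ?_⟩
  · have := hsupp (tsupport_smul_subset_left ψ f hy)
    exact (hψ y).smul ((hf.mono hts).contMDiffAt (ht.mem_nhds this))
  filter_upwards [h1] with y hy
  simp [hy]

end Charts

/-! ### The divergence in local coordinates. -/

section LocalDivergence

variable {m : ℕ} {M : Type*} [TopologicalSpace M]
  [ChartedSpace (EuclideanSpace ℝ (Fin m)) M] [IsManifold (𝓡 m) ∞ M]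
  [RiemannianBundle (fun x : M ↦ TangentSpace (𝓡 m) x)]

/-- The density `√(det g)` of the Riemannian volume in the preferred chart around `c`. -/
def volDensity (c : M) (y : EuclideanSpace ℝ (Fin m)) : ℝ := √(gramMatrix m c y).det

theorem det_gramMatrix_pos {c : M} {y : EuclideanSpace ℝ (Fin m)}
    (hy : y ∈ (chartAt (EuclideanSpace ℝ (Fin m)) c).target) : 0 < (gramMatrix m c y).det := by
  have hx := (chartAt (EuclideanSpace ℝ (Fin m)) c).map_target hy
  have h : gramMatrix m c y = Matrix.gram ℝ (coordBasis hx) := by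
    ext i j
    rw [gramMatrix_apply hy, coordField_eq_coordBasis hx, coordField_eq_coordBasis hx,
      Matrix.gram_apply]
  rw [h]
  exact (Matrix.posDef_gram_of_linearIndependent (coordBasis hx).linearIndependent).det_pos

variable [IsContMDiffRiemannianBundle (𝓡 m) ∞ (EuclideanSpace ℝ (Fin m))
    (fun x : M ↦ TangentSpace (𝓡 m) x)]

theorem contDiffOn_gramMatrix (c : M) (i j : Fin m) :
    ContDiffOn ℝ ∞ (fun y ↦ gramMatrix m c y i j)
      (chartAt (EuclideanSpace ℝ (Fin m)) c).target := by
  have h := (contMDiffOn_inner (contMDiffOn_coordField c i) (contMDiffOn_coordField c j)).comp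
    (contMDiffOn_chart_symm (I := 𝓡 m) (x := c) (n := ∞))
    fun y hy ↦ (chartAt (EuclideanSpace ℝ (Fin m)) c).map_target hy
  exact (contMDiffOn_iff_contDiffOn.1 h).congr fun y hy ↦ gramMatrix_apply hy i j

theorem contDiffOn_det_gramMatrix (c : M) :
    ContDiffOn ℝ ∞ (fun y ↦ (gramMatrix m c y).det)
      (chartAt (EuclideanSpace ℝ (Fin m)) c).target := by
  simp only [Matrix.det_apply]
  exact ContDiffOn.sum fun σ _ ↦ (contDiffOn_prod fun i _ ↦ contDiffOn_gramMatrix c _ _).const_smul _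

theorem contDiffOn_volDensity (c : M) :
    ContDiffOn ℝ ∞ (volDensity c) (chartAt (EuclideanSpace ℝ (Fin m)) c).target :=
  (contDiffOn_det_gramMatrix c).sqrt fun _ hy ↦ (det_gramMatrix_pos hy).ne'

variable [T2Space M]

theorem leviCivita_sum {ι : Type*} (s : Finset ι) {X : ι → Π x : M, TangentSpace (𝓡 m) x}
    (hX : ∀ i, SmoothField (𝓡 m) (X i)) (x : M) (u : TangentSpace (𝓡 m) x) :
    leviCivita (∑ i ∈ s, X i) x u = ∑ i ∈ s, leviCivita (X i) x u := by
  classical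
  induction s using Finset.induction_on with
  | empty => simp [CovariantDerivative.zero]
  | insert a s ha ih =>
    rw [Finset.sum_insert ha, Finset.sum_insert ha, leviCivita_add (hX a) _, ih]
    convert SmoothField.sum (s := s) fun i _ ↦ hX i using 1
    ext; simp

/-- A frame of globally defined vector fields that agree with the coordinate fields near a point
satisfies `∇_{∂ᵢ} ∂ⱼ = ∇_{∂ⱼ} ∂ᵢ` there. -/
theorem nabla_coordField_comm {c x : M} (hx : x ∈ (chartAt (EuclideanSpace ℝ (Fin m)) c).source)
    {D : Fin m → Π x : M, TangentSpace (𝓡 m) x} (hD : ∀ i, SmoothField (𝓡 m) (D i))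
    (hDc : ∀ i, ∀ᶠ y in 𝓝 x, D i y = coordField c i y) (i j : Fin m) :
    nabla (D i) (D j) x = nabla (D j) (D i) x := by
  rw [← sub_eq_zero, nabla_sub_nabla (hD i) (hD j)]
  have hs := (chartAt (EuclideanSpace ℝ (Fin m)) c).open_source.mem_nhds hx
  -- A global function agreeing with the chart near `x`: its derivatives along the fields `D k` are
  -- locally constant, so it annihilates their brackets, and its differential at `x` gives the
  -- coordinates of a vector.
  obtain ⟨f, hf, hfc⟩ := exists_contMDiff_eventuallyEq (F := EuclideanSpace ℝ (Fin m)) hs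
    (contMDiffOn_chart (I := 𝓡 m) (x := c) (n := ∞))
  have hfD (k) : ∀ᶠ y in 𝓝 x, mvfderiv (𝓡 m) f y (D k y) = EuclideanSpace.single k 1 := by
    filter_upwards [hDc k, hfc.eventually_nhds, hs] with y hy hfy hys
    rw [hy, ← fderiv_comp_chart_symm hys rfl (contMDiff_mdiffAt hf y)]
    have hyt := (chartAt (EuclideanSpace ℝ (Fin m)) c).map_source hys
    have : (fun z ↦ f ((chartAt (EuclideanSpace ℝ (Fin m)) c).symm z)) =ᶠ[
        𝓝 (chartAt (EuclideanSpace ℝ (Fin m)) c y)] id := by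
      have ht := (chartAt (EuclideanSpace ℝ (Fin m)) c).continuousAt_symm hyt
      rw [ContinuousAt, OpenPartialHomeomorph.left_inv _ hys] at ht
      filter_upwards [ht.eventually hfy,
        (chartAt (EuclideanSpace ℝ (Fin m)) c).open_target.mem_nhds hyt] with z hz hzt
      rw [hz, OpenPartialHomeomorph.right_inv _ hzt, id]
    rw [this.fderiv_eq, fderiv_id]
    rfl
  have h0 : mvfderiv (𝓡 m) f x (VectorField.mlieBracket (𝓡 m) (D i) (D j) x) = 0 := by
    rw [mvfderiv_mlieBracket (hD i) (hD j) hf, mvfderiv_congr (hfD j), mvfderiv_congr (hfD i),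
      mvfderiv_const, mvfderiv_const]
    simp
  set v := VectorField.mlieBracket (𝓡 m) (D i) (D j) x
  rw [← (coordBasis hx).sum_repr v]
  have hv (w : TangentSpace (𝓡 m) x) (k) :
      (mvfderiv (𝓡 m) f x w) k = (coordBasis hx).repr w k := by
    have hb (l) : mvfderiv (𝓡 m) f x (coordBasis hx l) = EuclideanSpace.single l 1 := by
      rw [← coordField_eq_coordBasis hx, ← (hDc l).self_of_nhds, (hfD l).self_of_nhds]
    conv_lhs => rw [← (coordBasis hx).sum_repr w]
    simp only [map_sum, map_smul, hb]
    simp [Pi.single_apply]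
  exact Finset.sum_eq_zero fun k _ ↦ by rw [← hv, h0]; simp

/-- In a chart, `div Z √(det g) = ∂ᵢ(√(det g) Zⁱ)`. -/
theorem sum_fderiv_volDensity_mul {c : M} {y : EuclideanSpace ℝ (Fin m)}
    (hy : y ∈ (chartAt (EuclideanSpace ℝ (Fin m)) c).target)
    {Z : Π x : M, TangentSpace (𝓡 m) x}
    (hW : ∀ k, ContMDiff (𝓡 m) 𝓘(ℝ, ℝ) ∞ (coordCoeff c k Z)) :
    ∑ k, fderiv ℝ (fun y ↦ volDensity c y *
        coordCoeff c k Z ((chartAt (EuclideanSpace ℝ (Fin m)) c).symm y)) y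
          (EuclideanSpace.single k 1) =
      volDensity c y * LinearMap.trace ℝ _ (leviCivita Z
        ((chartAt (EuclideanSpace ℝ (Fin m)) c).symm y)).toLinearMap := by
  set x := (chartAt (EuclideanSpace ℝ (Fin m)) c).symm y with hxy
  have hx : x ∈ (chartAt (EuclideanSpace ℝ (Fin m)) c).source :=
    (chartAt (EuclideanSpace ℝ (Fin m)) c).map_target hy
  have hxc : chartAt (EuclideanSpace ℝ (Fin m)) c x = y :=
    (chartAt (EuclideanSpace ℝ (Fin m)) c).right_inv hy
  have hs := (chartAt (EuclideanSpace ℝ (Fin m)) c).open_source.mem_nhds hx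
  have ht := (chartAt (EuclideanSpace ℝ (Fin m)) c).open_target.mem_nhds hy
  choose D hD hDc using fun k ↦ exists_smoothField_eventuallyEq hs (coordField c k)
    (contMDiffOn_coordField c k)
  let b := coordBasis hx
  have hDx (k) : D k x = b k := by
    rw [(hDc k).self_of_nhds, coordField_eq_coordBasis hx]
  have hdiff {F : Type} [NormedAddCommGroup F] [NormedSpace ℝ F] {f : M → F}
      (hf : ContMDiff (𝓡 m) 𝓘(ℝ, F) ∞ f) : HasFDerivAt
      (fun y ↦ f ((chartAt (EuclideanSpace ℝ (Fin m)) c).symm y))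
      (fderiv ℝ (fun y ↦ f ((chartAt (EuclideanSpace ℝ (Fin m)) c).symm y)) y) y := by
    refine DifferentiableAt.hasFDerivAt ?_
    exact ((hf.comp_contMDiffOn (contMDiffOn_chart_symm (I := 𝓡 m) (x := c) (n := ∞))).contDiffOn.contDiffAt
      ht).differentiableAt (by simp)
  have hdir {F : Type} [NormedAddCommGroup F] [NormedSpace ℝ F] {f : M → F}
      (hf : ContMDiff (𝓡 m) 𝓘(ℝ, F) ∞ f) (k : Fin m) :
      fderiv ℝ (fun y ↦ f ((chartAt (EuclideanSpace ℝ (Fin m)) c).symm y)) y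
        (EuclideanSpace.single k 1) = mvfderiv (𝓡 m) f x (b k) := by
    rw [fderiv_comp_chart_symm hx hxc (contMDiff_mdiffAt hf x), coordField_eq_coordBasis hx]
  let G := gramMatrix m c y
  -- Row i holds the coefficients of ∇_{∂ₖ}∂ᵢ. Metric compatibility gives ∂ₖG = BₖG + GBₖᵀ, hence
  -- ∂ₖ√(det G) = √(det G) tr Bₖ.
  let B (k : Fin m) : Matrix (Fin m) (Fin m) ℝ :=
    Matrix.of fun i j ↦ b.repr (leviCivita (D i) x (b k)) j
  have hG (i j) : G i j = inner ℝ (b i) (b j) := by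
    rw [← hDx, ← hDx, (hDc i).self_of_nhds, (hDc j).self_of_nhds]
    exact gramMatrix_apply hy i j
  have hgram (i j) : HasFDerivAt (fun y ↦ gramMatrix m c y i j) (fderiv ℝ (fun y ↦
      inner ℝ (D i ((chartAt (EuclideanSpace ℝ (Fin m)) c).symm y))
        (D j ((chartAt (EuclideanSpace ℝ (Fin m)) c).symm y))) y) y := by
    refine (hdiff ((hD i).contMDiff_inner (hD j))).congr_of_eventuallyEq ?_
    have hc := (chartAt (EuclideanSpace ℝ (Fin m)) c).continuousAt_symm hy
    filter_upwards [hc.eventually (hDc i), hc.eventually (hDc j), ht] with z hi hj hz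
    rw [gramMatrix_apply hz, hi, hj]
  have hgk (i j k) : fderiv ℝ (fun y ↦
      (inner ℝ (D i ((chartAt (EuclideanSpace ℝ (Fin m)) c).symm y))
        (D j ((chartAt (EuclideanSpace ℝ (Fin m)) c).symm y)) : ℝ)) y (EuclideanSpace.single k 1) =
      (B k * G + G * (B k).transpose) i j := by
    rw [hdir ((hD i).contMDiff_inner (hD j)), mvfderiv_inner (hD i) (hD j), hDx, hDx]
    simp only [Matrix.add_apply, Matrix.mul_apply, Matrix.transpose_apply, B, Matrix.of_apply, hG]
    congr 1
    · conv_lhs => rw [← b.sum_repr (leviCivita (D i) x (b k))]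
      simp only [sum_inner, real_inner_smul_left]
    · conv_lhs => rw [← b.sum_repr (leviCivita (D j) x (b k))]
      simp only [inner_sum, real_inner_smul_right]
      exact Finset.sum_congr rfl fun l _ ↦ mul_comm _ _
  have hGpos : 0 < G.det := det_gramMatrix_pos hy
  have hsq := (hasFDerivAt_matrix_det hgram).sqrt hGpos.ne'
  have hprod (k) := hsq.mul (hdiff (hW k))
  have hterm (k) : fderiv ℝ (fun y ↦ volDensity c y *
        coordCoeff c k Z ((chartAt (EuclideanSpace ℝ (Fin m)) c).symm y)) y
          (EuclideanSpace.single k 1) = volDensity c y * (mvfderiv (𝓡 m) (coordCoeff c k Z) x (b k) +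
            coordCoeff c k Z x * (B k).trace) := by
    have h1 : (∑ i, ∑ j, (gramMatrix m c y).adjugate j i • fderiv ℝ (fun y ↦
      (inner ℝ (D i ((chartAt (EuclideanSpace ℝ (Fin m)) c).symm y))
        (D j ((chartAt (EuclideanSpace ℝ (Fin m)) c).symm y)) : ℝ)) y)
          (EuclideanSpace.single k 1) = 2 * G.det * (B k).trace := by
      rw [← sum_sum_adjugate_mul]
      simp only [_root_.sum_apply, _root_.smul_apply, smul_eq_mul, hgk]
      rfl
    have h2 := (hprod k).fderiv
    change fderiv ℝ (fun y ↦ volDensity c y *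
        coordCoeff c k Z ((chartAt (EuclideanSpace ℝ (Fin m)) c).symm y)) y = _ at h2
    rw [h2]
    simp only [_root_.add_apply, _root_.smul_apply, smul_eq_mul, h1, hdir (hW k)]
    change √G.det * _ + coordCoeff c k Z x * _ = √G.det * _
    have h3 : √G.det * √G.det = G.det := Real.mul_self_sqrt hGpos.le
    have h4 : √G.det ≠ 0 := (Real.sqrt_pos.2 hGpos).ne'
    change _ + coordCoeff c k Z x * (1 / (2 * √G.det) * _) = _
    nth_rewrite 3 [← h3]
    field_simp
  have hZD : ∀ᶠ z in 𝓝 x, Z z = (∑ k, coordCoeff c k Z • D k) z := by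
    filter_upwards [hs, Filter.eventually_all.2 hDc] with z hz hzD
    rw [eq_sum_coordCoeff hz Z]
    simp [hzD]
  have hZD' (u : TangentSpace (𝓡 m) x) : leviCivita Z x u =
      ∑ k, (coordCoeff c k Z x • leviCivita (D k) x u +
        mvfderiv (𝓡 m) (coordCoeff c k Z) x u • D k x) := by
    have hsm (k) := (hD k).smul (hW k)
    have hsum : SmoothField (𝓡 m) (∑ k, coordCoeff c k Z • D k) := by
      convert SmoothField.sum (s := Finset.univ) fun k _ ↦ hsm k using 1
      ext; simp
    rw [leviCivita_congr hsum hZD, leviCivita_sum _ hsm]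
    exact Finset.sum_congr rfl fun k _ ↦ leviCivita_smul (hW k) (hD k) x u
  have htr : LinearMap.trace ℝ _ (leviCivita Z x).toLinearMap = ∑ k,
      (mvfderiv (𝓡 m) (coordCoeff c k Z) x (b k) + coordCoeff c k Z x * (B k).trace) := by
    rw [LinearMap.trace_eq_matrix_trace ℝ b]
    simp only [Matrix.trace, Matrix.diag, LinearMap.toMatrix_apply, ContinuousLinearMap.coe_coe,
      hZD', map_sum, map_add, map_smul, Finsupp.coe_finsetSum, Finset.sum_apply, Finsupp.add_apply,
      Finsupp.smul_apply, smul_eq_mul, hDx, Module.Basis.repr_self]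
    rw [Finset.sum_comm]
    refine Finset.sum_congr rfl fun k _ ↦ ?_
    rw [Finset.sum_add_distrib, add_comm, ← Finset.mul_sum]
    congr 1
    · simp [Finsupp.single_apply]
    · congr 1
      refine Finset.sum_congr rfl fun i _ ↦ ?_
      -- The divergence contains ∇_{∂ᵢ}∂ₖ and the density contains ∇_{∂ₖ}∂ᵢ; vanishing torsion
      -- identifies them.
      have h := nabla_coordField_comm hx hD hDc i k
      simp only [nabla, hDx] at h
      simp only [B, Matrix.of_apply, h]
  rw [htr, Finset.mul_sum]
  exact Finset.sum_congr rfl fun k _ ↦ hterm k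

end LocalDivergence

/-! ### Integration in a chart and independence of the chart. -/

section ChartIntegral

variable {m : ℕ} {M : Type*} [TopologicalSpace M]
  [ChartedSpace (EuclideanSpace ℝ (Fin m)) M] [IsManifold (𝓡 m) ∞ M]
  [RiemannianBundle (fun x : M ↦ TangentSpace (𝓡 m) x)]
  [IsContMDiffRiemannianBundle (𝓡 m) ∞ (EuclideanSpace ℝ (Fin m))
    (fun x : M ↦ TangentSpace (𝓡 m) x)] [T2Space M]

/-- Integrate by parts against the constant function 1. -/
theorem integral_fderiv_eq_zero {h : EuclideanSpace ℝ (Fin m) → ℝ} (hh : ContDiff ℝ 1 h)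
    (hc : HasCompactSupport h) (v : EuclideanSpace ℝ (Fin m)) : ∫ y, fderiv ℝ h y v = 0 := by
  have h1 : Continuous fun y ↦ fderiv ℝ h y v :=
    (hh.continuous_fderiv one_ne_zero).clm_apply continuous_const
  have h2 := integral_mul_fderiv_eq_neg_fderiv_mul_of_integrable (μ := volume)
    (f := fun _ : EuclideanSpace ℝ (Fin m) ↦ (1 : ℝ)) (g := h) (v := v) (by simp)
    (by simpa using h1.integrable_of_hasCompactSupport (hc.fderiv_apply (𝕜 := ℝ) v))
    (by simpa using hh.continuous.integrable_of_hasCompactSupport hc)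
    (fun _ _ ↦ differentiableAt_const _) fun _ _ ↦ hh.differentiable one_ne_zero _
  simpa using h2

variable (m) in
/-- A function on the domain of a chart, multiplied by the volume density, in the coordinates of
the chart, extended by zero. -/
def chartFun (c : M) (f : M → ℝ) : EuclideanSpace ℝ (Fin m) → ℝ :=
  (chartAt (EuclideanSpace ℝ (Fin m)) c).target.indicator fun y ↦
    volDensity c y * f ((chartAt (EuclideanSpace ℝ (Fin m)) c).symm y)

variable (m) in
/-- The integral of a function over the domain of a chart. -/
def chartIntegral (c : M) (f : M → ℝ) : ℝ :=
  ∫ y in (chartAt (EuclideanSpace ℝ (Fin m)) c).target,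
    volDensity c y * f ((chartAt (EuclideanSpace ℝ (Fin m)) c).symm y)

theorem chartIntegral_eq (c : M) (f : M → ℝ) : chartIntegral m c f = ∫ y, chartFun m c f y :=
  (integral_indicator (chartAt (EuclideanSpace ℝ (Fin m)) c).open_target.measurableSet).symm

theorem chartFun_eventuallyEq {c : M} (f : M → ℝ) {y : EuclideanSpace ℝ (Fin m)}
    (hy : y ∈ (chartAt (EuclideanSpace ℝ (Fin m)) c).target) :
    chartFun m c f =ᶠ[𝓝 y] fun y ↦
      volDensity c y * f ((chartAt (EuclideanSpace ℝ (Fin m)) c).symm y) := by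
  filter_upwards [(chartAt (EuclideanSpace ℝ (Fin m)) c).open_target.mem_nhds hy] with z hz
  exact Set.indicator_of_mem hz _

section Compact

variable [CompactSpace M] {c : M} {f : M → ℝ}
  (hs : tsupport f ⊆ (chartAt (EuclideanSpace ℝ (Fin m)) c).source)
include hs

theorem isCompact_image_tsupport :
    IsCompact (chartAt (EuclideanSpace ℝ (Fin m)) c '' tsupport f) :=
  (isClosed_tsupport f).isCompact.image_of_continuousOn
    ((chartAt (EuclideanSpace ℝ (Fin m)) c).continuousOn.mono hs)

omit hs in
theorem chartFun_eq_zero {y : EuclideanSpace ℝ (Fin m)}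
    (hy : y ∉ chartAt (EuclideanSpace ℝ (Fin m)) c '' tsupport f) : chartFun m c f y = 0 := by
  by_cases hyt : y ∈ (chartAt (EuclideanSpace ℝ (Fin m)) c).target
  · have h0 : f ((chartAt (EuclideanSpace ℝ (Fin m)) c).symm y) = 0 :=
      image_eq_zero_of_notMem_tsupport fun h ↦
        hy ⟨_, h, (chartAt (EuclideanSpace ℝ (Fin m)) c).right_inv hyt⟩
    rw [chartFun, Set.indicator_of_mem hyt, h0, mul_zero]
  · exact Set.indicator_of_notMem hyt _

theorem hasCompactSupport_chartFun : HasCompactSupport (chartFun m c f) :=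
  HasCompactSupport.intro (isCompact_image_tsupport hs) fun _ ↦ chartFun_eq_zero

/-- The image of the support is compact, hence closed, and lies inside the chart target; so the
extension by zero stays regular across the boundary of the target. -/
theorem chartFun_eventuallyEq_zero {y : EuclideanSpace ℝ (Fin m)}
    (hy : y ∉ (chartAt (EuclideanSpace ℝ (Fin m)) c).target) : chartFun m c f =ᶠ[𝓝 y] 0 := by
  have : y ∉ chartAt (EuclideanSpace ℝ (Fin m)) c '' tsupport f := by
    rintro ⟨x, hx, rfl⟩
    exact hy ((chartAt (EuclideanSpace ℝ (Fin m)) c).map_source (hs hx))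
  filter_upwards [(isCompact_image_tsupport hs).isClosed.isOpen_compl.mem_nhds this] with z hz
  exact chartFun_eq_zero hz

theorem continuous_chartFun (hf : Continuous f) : Continuous (chartFun m c f) := by
  rw [continuous_iff_continuousAt]
  intro y
  by_cases hyt : y ∈ (chartAt (EuclideanSpace ℝ (Fin m)) c).target
  · refine ContinuousAt.congr ?_ (chartFun_eventuallyEq f hyt).symm
    exact ((contDiffOn_volDensity c).continuousOn.continuousAt
      ((chartAt (EuclideanSpace ℝ (Fin m)) c).open_target.mem_nhds hyt)).mul
      (hf.continuousAt.comp ((chartAt (EuclideanSpace ℝ (Fin m)) c).continuousAt_symm hyt))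
  · exact continuousAt_const.congr (chartFun_eventuallyEq_zero hs hyt).symm

theorem contDiff_chartFun (hf : ContMDiff (𝓡 m) 𝓘(ℝ, ℝ) ∞ f) : ContDiff ℝ ∞ (chartFun m c f) := by
  rw [contDiff_iff_contDiffAt]
  intro y
  by_cases hyt : y ∈ (chartAt (EuclideanSpace ℝ (Fin m)) c).target
  · refine ContDiffAt.congr_of_eventuallyEq ?_ (chartFun_eventuallyEq f hyt)
    have ht := (chartAt (EuclideanSpace ℝ (Fin m)) c).open_target.mem_nhds hyt
    exact ((contDiffOn_volDensity c).contDiffAt ht).mul ((hf.comp_contMDiffOn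
      (contMDiffOn_chart_symm (I := 𝓡 m) (x := c) (n := ∞))).contDiffOn.contDiffAt ht)
  · exact contDiffAt_const.congr_of_eventuallyEq (chartFun_eventuallyEq_zero hs hyt)

theorem integrableOn_chartFun (hf : Continuous f) : IntegrableOn (fun y ↦
    volDensity c y * f ((chartAt (EuclideanSpace ℝ (Fin m)) c).symm y))
    (chartAt (EuclideanSpace ℝ (Fin m)) c).target :=
  (integrable_indicator_iff (chartAt (EuclideanSpace ℝ (Fin m)) c).open_target.measurableSet).1
    ((continuous_chartFun hs hf).integrable_of_hasCompactSupport (hasCompactSupport_chartFun hs))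

end Compact

/-- The divergence of a vector field. -/
def divergence (Y : Π x : M, TangentSpace (𝓡 m) x) (x : M) : ℝ :=
  LinearMap.trace ℝ _ (leviCivita Y x).toLinearMap

theorem divergence_smul {Y : Π x : M, TangentSpace (𝓡 m) x} {f : M → ℝ}
    (hf : ContMDiff (𝓡 m) 𝓘(ℝ, ℝ) ∞ f) (hY : SmoothField (𝓡 m) Y) (x : M) :
    divergence (f • Y) x = f x * divergence Y x + mvfderiv (𝓡 m) f x (Y x) := by
  simp only [divergence, LinearMap.trace_eq_sum_inner _ (stdOrthonormalBasis ℝ _),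
    ContinuousLinearMap.coe_coe, leviCivita_smul hf hY, inner_add_right, real_inner_smul_right,
    Finset.sum_add_distrib, ← Finset.mul_sum]
  congr 1
  conv_rhs => rw [← (stdOrthonormalBasis ℝ (TangentSpace (𝓡 m) x)).sum_repr' (Y x)]
  simp only [map_sum, map_smul, smul_eq_mul, mul_comm]

theorem continuous_divergence {Y : Π x : M, TangentSpace (𝓡 m) x} (hY : SmoothField (𝓡 m) Y) :
    Continuous (divergence Y) := by
  rw [continuous_iff_continuousAt]
  intro x
  obtain ⟨e, he, ho⟩ := exists_orthonormal_frame (I := 𝓡 m) x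
  have h : ContinuousAt (fun y ↦ ∑ i, (inner ℝ (e i y) (nabla (e i) Y y) : ℝ)) x :=
    tendsto_finsetSum _ fun i _ ↦
      ((he i).contMDiff_inner ((he i).nabla hY)).continuous.continuousAt
  refine h.congr ?_
  filter_upwards [ho] with y hy
  rw [divergence, LinearMap.trace_eq_sum_inner _ (onb hy)]
  simp only [onb_apply]
  rfl

/-- The cutoff `ρ` makes the coordinate components of ρY smooth on all of M and supported in the
chart. The integrand becomes a sum of partial derivatives of compactly supported functions. -/
theorem chartIntegral_divergence [CompactSpace M] {c : M} {ρ : M → ℝ}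
    (hs : tsupport ρ ⊆ (chartAt (EuclideanSpace ℝ (Fin m)) c).source)
    (hρ : ContMDiff (𝓡 m) 𝓘(ℝ, ℝ) ∞ ρ) {Y : Π x : M, TangentSpace (𝓡 m) x}
    (hY : SmoothField (𝓡 m) Y) : chartIntegral m c (divergence (ρ • Y)) = 0 := by
  have hcoeff (k) : coordCoeff c k (ρ • Y) = fun x ↦ ρ x • coordCoeff c k Y x := by
    ext x; simp [coordCoeff]
  have hsupp (k) : tsupport (coordCoeff c k (ρ • Y)) ⊆
      (chartAt (EuclideanSpace ℝ (Fin m)) c).source := by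
    rw [hcoeff]; exact (tsupport_smul_subset_left ρ _).trans hs
  have hW (k) : ContMDiff (𝓡 m) 𝓘(ℝ, ℝ) ∞ (coordCoeff c k (ρ • Y)) := by
    refine contMDiff_of_tsupport fun x hx ↦ ?_
    exact (contMDiffOn_coordCoeff c k (hY.smul hρ)).contMDiffAt
      ((chartAt (EuclideanSpace ℝ (Fin m)) c).open_source.mem_nhds (hsupp k hx))
  have hC (k) := (contDiff_chartFun (hsupp k) (hW k)).of_le (m := 1) (by simp)
  have hS (k) := hasCompactSupport_chartFun (hsupp k)
  have hpt (y) : chartFun m c (divergence (ρ • Y)) y =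
      ∑ k, fderiv ℝ (chartFun m c (coordCoeff c k (ρ • Y))) y (EuclideanSpace.single k 1) := by
    by_cases hyt : y ∈ (chartAt (EuclideanSpace ℝ (Fin m)) c).target
    · rw [chartFun, Set.indicator_of_mem hyt, divergence, ← sum_fderiv_volDensity_mul hyt hW]
      simp only [(chartFun_eventuallyEq _ hyt).fderiv_eq]
    · rw [chartFun, Set.indicator_of_notMem hyt]
      simp only [(chartFun_eventuallyEq_zero (hsupp _) hyt).fderiv_eq]
      simp
  rw [chartIntegral_eq]
  simp only [hpt]
  rw [integral_finsetSum]
  · exact Finset.sum_eq_zero fun k _ ↦ integral_fderiv_eq_zero (hC k) (hS k) _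
  · intro k _
    exact (((hC k).continuous_fderiv one_ne_zero).clm_apply
      continuous_const).integrable_of_hasCompactSupport ((hS k).fderiv_apply (𝕜 := ℝ) _)

theorem mvfderiv_chart_coordField {c x : M}
    (hx : x ∈ (chartAt (EuclideanSpace ℝ (Fin m)) c).source) (i : Fin m) :
    mvfderiv (𝓡 m) (chartAt (EuclideanSpace ℝ (Fin m)) c) x (coordField c i x) =
      EuclideanSpace.single i 1 := by
  have hyt := (chartAt (EuclideanSpace ℝ (Fin m)) c).map_source hx
  rw [← fderiv_comp_chart_symm hx rfl (mdifferentiableAt_atlas (I := 𝓡 m)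
    (chart_mem_atlas (EuclideanSpace ℝ (Fin m)) c) hx)]
  have : (fun z ↦ chartAt (EuclideanSpace ℝ (Fin m)) c
      ((chartAt (EuclideanSpace ℝ (Fin m)) c).symm z)) =ᶠ[
      𝓝 (chartAt (EuclideanSpace ℝ (Fin m)) c x)] id := by
    filter_upwards [(chartAt (EuclideanSpace ℝ (Fin m)) c).open_target.mem_nhds hyt] with z hz
    exact (chartAt (EuclideanSpace ℝ (Fin m)) c).right_inv hz
  rw [this.fderiv_eq, fderiv_id]
  rfl

/-- The two Gram matrices are congruent by the Jacobian matrix of the transition map. -/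
theorem abs_det_fderiv_mul_volDensity {c d : M} {y : EuclideanSpace ℝ (Fin m)}
    (hy : y ∈ (chartAt (EuclideanSpace ℝ (Fin m)) c).target)
    (hd : (chartAt (EuclideanSpace ℝ (Fin m)) c).symm y ∈
      (chartAt (EuclideanSpace ℝ (Fin m)) d).source) :
    |(fderiv ℝ (fun y ↦ chartAt (EuclideanSpace ℝ (Fin m)) d
      ((chartAt (EuclideanSpace ℝ (Fin m)) c).symm y)) y).det| *
      volDensity d (chartAt (EuclideanSpace ℝ (Fin m)) d
        ((chartAt (EuclideanSpace ℝ (Fin m)) c).symm y)) = volDensity c y := by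
  set x := (chartAt (EuclideanSpace ℝ (Fin m)) c).symm y with hxy
  set L := fderiv ℝ (fun y ↦ chartAt (EuclideanSpace ℝ (Fin m)) d
      ((chartAt (EuclideanSpace ℝ (Fin m)) c).symm y)) y
  have hx : x ∈ (chartAt (EuclideanSpace ℝ (Fin m)) c).source :=
    (chartAt (EuclideanSpace ℝ (Fin m)) c).map_target hy
  have hxc : chartAt (EuclideanSpace ℝ (Fin m)) c x = y :=
    (chartAt (EuclideanSpace ℝ (Fin m)) c).right_inv hy
  have hdt := (chartAt (EuclideanSpace ℝ (Fin m)) d).map_source hd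
  have hdx := (chartAt (EuclideanSpace ℝ (Fin m)) d).left_inv hd
  let A := LinearMap.toMatrix (EuclideanSpace.basisFun (Fin m) ℝ).toBasis
    (EuclideanSpace.basisFun (Fin m) ℝ).toBasis L.toLinearMap
  have hA (k i) : A k i = (coordBasis hd).repr (coordField c i x) k := by
    have h1 : L (EuclideanSpace.single i 1) = mvfderiv (𝓡 m)
        (chartAt (EuclideanSpace ℝ (Fin m)) d) x (coordField c i x) :=
      fderiv_comp_chart_symm hx hxc (mdifferentiableAt_atlas (I := 𝓡 m)
        (chart_mem_atlas (EuclideanSpace ℝ (Fin m)) d) hd) i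
    rw [← (coordBasis hd).sum_repr (coordField c i x)] at h1
    simp only [map_sum, map_smul, ← coordField_eq_coordBasis hd, mvfderiv_chart_coordField hd] at h1
    simp [A, LinearMap.toMatrix_apply, h1]
  have hG : gramMatrix m c y = A.transpose * gramMatrix m d
      (chartAt (EuclideanSpace ℝ (Fin m)) d x) * A := by
    ext i j
    rw [gramMatrix_apply hy, ← hxy, ← (coordBasis hd).sum_repr (coordField c i x),
      ← (coordBasis hd).sum_repr (coordField c j x)]
    simp only [Matrix.mul_apply, Matrix.transpose_apply, hA, gramMatrix_apply hdt, sum_inner,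
      inner_sum, real_inner_smul_left, real_inner_smul_right, Finset.sum_mul]
    refine Finset.sum_congr rfl fun k _ ↦ Finset.sum_congr rfl fun l _ ↦ ?_
    rw [hdx, coordField_eq_coordBasis hd, coordField_eq_coordBasis hd]
    ring
  have hdet : L.det = A.det := by
    rw [ContinuousLinearMap.det, ← LinearMap.det_toMatrix (EuclideanSpace.basisFun (Fin m) ℝ).toBasis]
  rw [hdet, volDensity, volDensity, hG, Matrix.det_mul, Matrix.det_mul, Matrix.det_transpose,
    ← Real.sqrt_sq_eq_abs, ← Real.sqrt_mul (sq_nonneg _)]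
  congr 1
  ring

/-- The vanishing hypotheses restrict both integrals to the overlap of the charts, where the change
of variables formula applies to the transition map. -/
theorem chartIntegral_eq_chartIntegral {c d : M} {f : M → ℝ}
    (hfc : ∀ x ∉ (chartAt (EuclideanSpace ℝ (Fin m)) c).source, f x = 0)
    (hfd : ∀ x ∉ (chartAt (EuclideanSpace ℝ (Fin m)) d).source, f x = 0) :
    chartIntegral m c f = chartIntegral m d f := by
  let φ := chartAt (EuclideanSpace ℝ (Fin m)) c
  let ψ := chartAt (EuclideanSpace ℝ (Fin m)) d
  let e := φ.symm.trans ψ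
  have hes : e.source = φ.target ∩ φ.symm ⁻¹' ψ.source := rfl
  have het : e.target = ψ.target ∩ ψ.symm ⁻¹' φ.source := rfl
  have h1 : chartIntegral m c f = ∫ y in e.source, volDensity c y * f (φ.symm y) := by
    refine setIntegral_eq_of_subset_of_forall_sdiff_eq_zero φ.open_target.measurableSet
      (hes ▸ Set.inter_subset_left) fun y hy ↦ ?_
    have h0 : f (φ.symm y) = 0 := hfd _ fun h ↦ hy.2 ⟨hy.1, h⟩
    exact mul_eq_zero_of_right _ h0
  have h2 : chartIntegral m d f = ∫ y in e.target, volDensity d y * f (ψ.symm y) := by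
    refine setIntegral_eq_of_subset_of_forall_sdiff_eq_zero ψ.open_target.measurableSet
      (het ▸ Set.inter_subset_left) fun y hy ↦ ?_
    have h0 : f (ψ.symm y) = 0 := hfc _ fun h ↦ hy.2 ⟨hy.1, h⟩
    exact mul_eq_zero_of_right _ h0
  have hd (y) (hy : y ∈ e.source) : HasFDerivAt e (fderiv ℝ (fun y ↦ ψ (φ.symm y)) y) y := by
    refine DifferentiableAt.hasFDerivAt (f := fun y ↦ ψ (φ.symm y)) ?_
    have h3 := (contMDiffOn_chart (I := 𝓡 m) (x := d) (n := ∞)).contMDiffAt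
      (ψ.open_source.mem_nhds hy.2)
    have h4 := (contMDiffOn_chart_symm (I := 𝓡 m) (x := c) (n := ∞)).contMDiffAt
      (φ.open_target.mem_nhds hy.1)
    exact (ContMDiffAt.comp y h3 h4).contDiffAt.differentiableAt (by simp)
  rw [h1, h2, integral_target_eq_integral_abs_det_fderiv_smul _ hd]
  refine setIntegral_congr_fun e.open_source.measurableSet fun y hy ↦ ?_
  have h3 := abs_det_fderiv_mul_volDensity hy.1 hy.2
  change _ = _ * (volDensity d (ψ (φ.symm y)) * f (ψ.symm (ψ (φ.symm y))))
  have h4 : ψ.symm (ψ (φ.symm y)) = φ.symm y := ψ.left_inv hy.2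
  rw [h4, ← mul_assoc]
  exact congrArg (· * f (φ.symm y)) h3.symm

end ChartIntegral

/-! ### The Riemannian volume and the divergence theorem. -/

section DivergenceTheorem

variable {m : ℕ} {M : Type*} [TopologicalSpace M] [T2Space M] [CompactSpace M]
  [ChartedSpace (EuclideanSpace ℝ (Fin m)) M] [IsManifold (𝓡 m) ∞ M]

theorem tsupport_chartPartition (c : M) :
    tsupport (chartPartition m M c) ⊆ (chartAt (EuclideanSpace ℝ (Fin m)) c).source :=
  (SmoothPartitionOfUnity.exists_isSubordinate_chartAt_source (𝓡 m) M).choose_spec c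

theorem chartPartition_eq_zero {c x : M}
    (hx : x ∉ (chartAt (EuclideanSpace ℝ (Fin m)) c).source) : chartPartition m M c x = 0 :=
  image_eq_zero_of_notMem_tsupport fun h ↦ hx (tsupport_chartPartition c h)

variable (m M) in
theorem finite_chartPartition : {c | (Function.support (chartPartition m M c)).Nonempty}.Finite :=
  (chartPartition m M).locallyFinite.finite_nonempty_of_compact

variable (m M) in
/-- The finitely many indices for which the function of the partition of unity is nonzero. -/
def chartIndices : Finset M := (finite_chartPartition m M).toFinset

theorem chartPartition_of_notMem {c : M} (hc : c ∉ chartIndices m M) (x : M) :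
    chartPartition m M c x = 0 := by
  by_contra h
  exact hc ((finite_chartPartition m M).mem_toFinset.2 ⟨x, h⟩)

theorem sum_chartPartition (x : M) : ∑ c ∈ chartIndices m M, chartPartition m M c x = 1 := by
  rw [← (chartPartition m M).sum_eq_one (Set.mem_univ x)]
  refine (finsum_eq_sum_of_support_subset _ fun c hc ↦ ?_).symm
  by_contra h
  exact hc (chartPartition_of_notMem h x)

theorem contMDiff_chartPartition (c : M) :
    ContMDiff (𝓡 m) 𝓘(ℝ, ℝ) ∞ (chartPartition m M c) := (chartPartition m M c).contMDiff

variable [RiemannianBundle (fun x : M ↦ TangentSpace (𝓡 m) x)]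

variable (m) in
/-- The part of the Riemannian volume measure that belongs to a chart. -/
def chartMeasure [MeasurableSpace M] (c : M) : Measure M :=
  (((volume : Measure (EuclideanSpace ℝ (Fin m))).restrict
      (chartAt (EuclideanSpace ℝ (Fin m)) c).target).withDensity fun y ↦
    ENNReal.ofReal (chartPartition m M c ((chartAt (EuclideanSpace ℝ (Fin m)) c).symm y) *
      volDensity c y)).map (chartAt (EuclideanSpace ℝ (Fin m)) c).symm

/-- By compactness and local finiteness only finitely many functions of the partition are nonzero.
-/
theorem riemannianVolume_eq_sum [MeasurableSpace M] :
    riemannianVolume m M = ∑ c ∈ chartIndices m M, chartMeasure m c := by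
  change Measure.sum (chartMeasure m) = _
  ext s hs
  rw [Measure.sum_apply _ hs, Measure.finsetSum_apply]
  refine tsum_eq_sum fun c hc ↦ ?_
  simp only [chartMeasure, chartPartition_of_notMem hc, zero_mul, ENNReal.ofReal_zero]
  have h (μ : Measure (EuclideanSpace ℝ (Fin m))) : μ.withDensity (fun _ ↦ 0) = 0 :=
    withDensity_zero
  simp [h]

variable [IsContMDiffRiemannianBundle (𝓡 m) ∞ (EuclideanSpace ℝ (Fin m))
    (fun x : M ↦ TangentSpace (𝓡 m) x)] [MeasurableSpace M] [BorelSpace M]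

theorem isFiniteMeasure_chartMeasure (c : M) : IsFiniteMeasure (chartMeasure m c) := by
  have h := integrableOn_chartFun (tsupport_chartPartition c)
    (contMDiff_chartPartition (m := m) c).continuous
  have h2 : IsFiniteMeasure (((volume : Measure (EuclideanSpace ℝ (Fin m))).restrict
      (chartAt (EuclideanSpace ℝ (Fin m)) c).target).withDensity fun y ↦
      ENNReal.ofReal (chartPartition m M c ((chartAt (EuclideanSpace ℝ (Fin m)) c).symm y) *
      volDensity c y)) := by
    refine isFiniteMeasure_withDensity_ofReal ?_
    simpa only [mul_comm] using h.hasFiniteIntegral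
  unfold chartMeasure
  infer_instance

theorem integrable_riemannianVolume {f : M → ℝ} (hf : Continuous f) :
    Integrable f (riemannianVolume m M) := by
  have (c : M) := isFiniteMeasure_chartMeasure (m := m) c
  rw [riemannianVolume_eq_sum, integrable_finsetSum_measure]
  intro c _
  exact hf.integrable_of_hasCompactSupport (HasCompactSupport.of_compactSpace f)

theorem integral_chartMeasure (c : M) {f : M → ℝ} (hf : Continuous f) :
    ∫ x, f x ∂(chartMeasure m c) = chartIntegral m c (fun x ↦ chartPartition m M c x * f x) := by
  have ht := (chartAt (EuclideanSpace ℝ (Fin m)) c).open_target.measurableSet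
  have hsymm := (chartAt (EuclideanSpace ℝ (Fin m)) c).continuousOn_symm
  have hd : AEMeasurable (fun y ↦ ENNReal.ofReal (chartPartition m M c
      ((chartAt (EuclideanSpace ℝ (Fin m)) c).symm y) * volDensity c y))
      ((volume : Measure (EuclideanSpace ℝ (Fin m))).restrict
        (chartAt (EuclideanSpace ℝ (Fin m)) c).target) := by
    refine ENNReal.measurable_ofReal.comp_aemeasurable (ContinuousOn.aemeasurable ?_ ht)
    exact ((contMDiff_chartPartition c).continuous.comp_continuousOn hsymm).mul
      (contDiffOn_volDensity c).continuousOn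
  have hm : AEMeasurable (chartAt (EuclideanSpace ℝ (Fin m)) c).symm
      (((volume : Measure (EuclideanSpace ℝ (Fin m))).restrict
        (chartAt (EuclideanSpace ℝ (Fin m)) c).target).withDensity fun y ↦
        ENNReal.ofReal (chartPartition m M c ((chartAt (EuclideanSpace ℝ (Fin m)) c).symm y) *
        volDensity c y)) :=
    (hsymm.aemeasurable ht).mono_ac (withDensity_absolutelyContinuous _ _)
  rw [chartMeasure, integral_map hm hf.aestronglyMeasurable,
    integral_withDensity_eq_integral_toReal_smul₀ hd (by simp), chartIntegral]
  refine integral_congr_ae (Filter.Eventually.of_forall fun y ↦ ?_)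
  simp only [smul_eq_mul]
  have hv : 0 ≤ volDensity c y := Real.sqrt_nonneg _
  rw [ENNReal.toReal_ofReal (mul_nonneg ((chartPartition m M).nonneg c _) hv)]
  ring

theorem tsupport_mul_subset_source {c : M} {ρ : M → ℝ}
    (hs : tsupport ρ ⊆ (chartAt (EuclideanSpace ℝ (Fin m)) c).source) (f : M → ℝ) :
    tsupport (fun x ↦ ρ x * f x) ⊆ (chartAt (EuclideanSpace ℝ (Fin m)) c).source :=
  (tsupport_mul_subset_left (f := ρ) (g := f)).trans hs

theorem integral_riemannianVolume {f : M → ℝ} (hf : Continuous f) :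
    ∫ x, f x ∂(riemannianVolume m M) =
      ∑ c ∈ chartIndices m M, chartIntegral m c (fun x ↦ chartPartition m M c x * f x) := by
  have h := integrable_riemannianVolume (m := m) hf
  rw [riemannianVolume_eq_sum, integrable_finsetSum_measure] at h
  rw [riemannianVolume_eq_sum, integral_finsetSum_measure h]
  exact Finset.sum_congr rfl fun c _ ↦ integral_chartMeasure c hf

/-- The integral of a function which is supported in a chart can be computed in this chart. -/
theorem integral_riemannianVolume_eq_chartIntegral {c : M} {f : M → ℝ} (hf : Continuous f)
    (hs : tsupport f ⊆ (chartAt (EuclideanSpace ℝ (Fin m)) c).source) :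
    ∫ x, f x ∂(riemannianVolume m M) = chartIntegral m c f := by
  have hsd (d : M) : tsupport (fun x ↦ chartPartition m M d x * f x) ⊆
      (chartAt (EuclideanSpace ℝ (Fin m)) c).source :=
    (tsupport_mul_subset_right (f := chartPartition m M d) (g := f)).trans hs
  -- Each piece is supported in both charts, so its integral can be moved to the chart at `c`, where
  -- the partition functions add up to 1.
  have h (d : M) : chartIntegral m d (fun x ↦ chartPartition m M d x * f x) =
      chartIntegral m c (fun x ↦ chartPartition m M d x * f x) := by
    refine chartIntegral_eq_chartIntegral (fun x hx ↦ ?_) fun x hx ↦ ?_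
    · rw [chartPartition_eq_zero hx, zero_mul]
    · exact image_eq_zero_of_notMem_tsupport (f := fun x ↦ chartPartition m M d x * f x)
        fun h ↦ hx (hsd d h)
  rw [integral_riemannianVolume hf, Finset.sum_congr rfl fun d _ ↦ h d]
  refine (integral_finsetSum _ fun d _ ↦ integrableOn_chartFun (hsd d)
    ((contMDiff_chartPartition d).continuous.mul hf)).symm.trans ?_
  simp only [← Finset.mul_sum, ← Finset.sum_mul, sum_chartPartition, one_mul]
  rfl

/-- The divergence theorem on a closed Riemannian manifold. -/
theorem integral_divergence {Y : Π x : M, TangentSpace (𝓡 m) x} (hY : SmoothField (𝓡 m) Y) :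
    ∫ x, divergence Y x ∂(riemannianVolume m M) = 0 := by
  have hdiv := continuous_divergence hY
  have hdρ (c : M) : Continuous fun x ↦ mvfderiv (𝓡 m) (chartPartition m M c) x (Y x) :=
    (SmoothField.mvfderiv_apply (contMDiff_chartPartition c) hY).continuous
  have hsd (c : M) : tsupport (fun x ↦ mvfderiv (𝓡 m) (chartPartition m M c) x (Y x)) ⊆
      (chartAt (EuclideanSpace ℝ (Fin m)) c).source := by
    refine (closure_minimal (fun x hx ↦ ?_) (isClosed_tsupport _)).trans (tsupport_chartPartition c)
    by_contra h
    refine hx ?_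
    have : ∀ᶠ y in 𝓝 x, chartPartition m M c y = 0 := by
      filter_upwards [(isClosed_tsupport _).isOpen_compl.mem_nhds h] with y hy
      exact image_eq_zero_of_notMem_tsupport hy
    change mvfderiv (𝓡 m) (chartPartition m M c) x (Y x) = 0
    rw [mvfderiv_congr this, mvfderiv_const]
    rfl
  -- For each partition function ρ, ρ div Y = div(ρY) − dρ(Y), and div(ρY) has integral zero in the
  -- chart.
  have h (c : M) : chartIntegral m c (fun x ↦ chartPartition m M c x * divergence Y x) =
      -∫ x, mvfderiv (𝓡 m) (chartPartition m M c) x (Y x) ∂(riemannianVolume m M) := by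
    rw [integral_riemannianVolume_eq_chartIntegral (hdρ c) (hsd c), eq_neg_iff_add_eq_zero,
      ← chartIntegral_divergence (tsupport_chartPartition c) (contMDiff_chartPartition c) hY]
    simp only [chartIntegral]
    rw [← integral_add (integrableOn_chartFun
      (tsupport_mul_subset_source (tsupport_chartPartition c) _)
        ((contMDiff_chartPartition c).continuous.mul hdiv))
      (integrableOn_chartFun (hsd c) (hdρ c))]
    simp only [divergence_smul (contMDiff_chartPartition c) hY, mul_add]
  rw [integral_riemannianVolume hdiv]
  simp only [h]
  rw [Finset.sum_neg_distrib, ← integral_finsetSum _ fun c _ ↦ integrable_riemannianVolume (hdρ c)]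
  -- The partition functions add up to the constant 1, so their differentials add up to zero.
  have h0 (x : M) :
      ∑ c ∈ chartIndices m M, mvfderiv (𝓡 m) (chartPartition m M c) x (Y x) = 0 := by
    rw [← mvfderiv_finset_sum _ fun c ↦ contMDiff_mdiffAt (contMDiff_chartPartition c) x]
    simp only [sum_chartPartition, mvfderiv_const]
    rfl
  simp [h0]

end DivergenceTheorem

/-! ### Continuity of the scalar functions and integration of the identity. -/

section Main

variable {n : ℕ} {M : Type*} [TopologicalSpace M]
  [ChartedSpace (EuclideanSpace ℝ (Fin (2 * n))) M] [IsManifold (𝓡 (2 * n)) ∞ M]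
  [RiemannianBundle (fun x : M ↦ TangentSpace (𝓡 (2 * n)) x)]
  [IsContMDiffRiemannianBundle (𝓡 (2 * n)) ∞ (EuclideanSpace ℝ (Fin (2 * n)))
    (fun x : M ↦ TangentSpace (𝓡 (2 * n)) x)] [T2Space M]

namespace SUStructure

variable (S : SUStructure n M)

/-- `charU` is defined with an arbitrary basis in each fibre; by basis independence it may be
computed in a smooth local frame. -/
theorem continuous_inner_charU {Y : Π x : M, TangentSpace (𝓡 (2 * n)) x}
    (hY : SmoothField (𝓡 (2 * n)) Y) : Continuous fun x ↦ (inner ℝ (Y x) (S.charU x) : ℝ) := by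
  rw [continuous_iff_continuousAt]
  intro x
  obtain ⟨e, he, ho⟩ := exists_orthonormal_frame (I := 𝓡 (2 * n)) x
  have h : ContinuousAt (fun y ↦ ∑ i, (inner ℝ (Y y) (S.xiU y (e i y) (e i y)) : ℝ)) x :=
    tendsto_finsetSum _ fun i _ ↦
      (hY.contMDiff_inner (S.smoothField_xiU (he i) (he i))).continuous.continuousAt
  refine h.congr ?_
  filter_upwards [ho] with y hy
  rw [charU, torsionU_eq, charVector_eq (onb hy), inner_sum]
  simp only [onb_apply]

theorem continuous_scalarAlt : Continuous fun x ↦ scalarAlt (S.Jend x) (S.xiU x) := by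
  rw [continuous_iff_continuousAt]
  intro x
  obtain ⟨e, he, ho⟩ := exists_orthonormal_frame (I := 𝓡 (2 * n)) x
  have hJe (i) := S.smoothField_JX (he i)
  have hX (i j) := S.smoothField_xiU (hJe j) (S.smoothField_xiU (he j) (hJe i))
  have hX' (i j) := S.smoothField_xiU (he j) (S.smoothField_xiU (hJe j) (hJe i))
  have h : ContinuousAt (fun y ↦ -(1 / (Module.finrank ℝ (EuclideanSpace ℝ (Fin (2 * n))) : ℝ)) *
      ∑ j, ∑ i, (inner ℝ (e i y) (S.xiU y (S.JX (e j) y) (S.xiU y (e j y) (S.JX (e i) y))) -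
        inner ℝ (e i y) (S.xiU y (e j y) (S.xiU y (S.JX (e j) y) (S.JX (e i) y))) : ℝ)) x :=
    continuousAt_const.mul <| tendsto_finsetSum _ fun j _ ↦ tendsto_finsetSum _ fun i _ ↦
      (((he i).contMDiff_inner (hX i j)).continuous.continuousAt).sub
        ((he i).contMDiff_inner (hX' i j)).continuous.continuousAt
  refine h.congr ?_
  filter_upwards [ho] with y hy
  rw [scalarAlt_eq (onb hy)]
  simp only [LinearMap.trace_eq_sum_inner _ (onb hy), onb_apply, Ring.lie_def, sub_mul,
    LinearMap.sub_apply, Module.End.mul_apply, inner_sub_right]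
  rfl

/-- Continuity is read off from the expression in terms of Y and ξ^{U(n)}, which avoids the
pointwise extensions in `curvature`. -/
theorem continuous_sReal : Continuous S.sReal := by
  rw [show S.sReal = _ from funext S.sReal_eq]
  exact (S.continuous_scalarAlt.sub (continuous_const.mul
    (continuous_divergence S.smoothField_leeField))).add
    (continuous_const.mul (S.continuous_inner_charU S.smoothField_leeField))

theorem continuous_sAlt : Continuous S.sAlt := by
  rw [show S.sAlt = _ from funext S.sAlt_eq]
  exact S.continuous_scalarAlt.sub
    (continuous_const.mul (S.continuous_inner_charU S.smoothField_leeField))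

theorem eight_mul_integral_inner_charU [CompactSpace M] [MeasurableSpace M] [BorelSpace M] :
    8 * ∫ x, inner ℝ (S.leeField x) (S.charU x) ∂(riemannianVolume (2 * n) M) =
      ∫ x, (S.sReal x - S.sAlt x) ∂(riemannianVolume (2 * n) M) := by
  have h1 := integrable_riemannianVolume (m := 2 * n)
    ((continuous_const_mul (8 : ℝ)).comp (S.continuous_inner_charU S.smoothField_leeField))
  have h2 := integrable_riemannianVolume (m := 2 * n)
    ((continuous_const_mul (2 : ℝ)).comp (continuous_divergence S.smoothField_leeField))
  simp only [sReal_sub_sAlt]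
  refine Eq.symm ((integral_sub h1 h2).trans ?_)
  have h3 := integral_divergence S.smoothField_leeField
  simp only [Function.comp_apply, integral_const_mul, h3, mul_zero, sub_zero]

end SUStructure

end Main

end SUGeom

end

theorem mainTheorem5 {n : ℕ} {M : Type*} [TopologicalSpace M] [T2Space M] [CompactSpace M]
    [ChartedSpace (EuclideanSpace ℝ (Fin (2 * n))) M] [IsManifold (𝓡 (2 * n)) ∞ M]
    [MeasurableSpace M] [BorelSpace M]
    [Bundle.RiemannianBundle (fun x : M ↦ TangentSpace (𝓡 (2 * n)) x)]
    [IsContMDiffRiemannianBundle (𝓡 (2 * n)) ∞ (EuclideanSpace ℝ (Fin (2 * n)))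
      (fun x : M ↦ TangentSpace (𝓡 (2 * n)) x)]
    (S : SUStructure n M) (η : Π x : M, TangentSpace (𝓡 (2 * n)) x →L[ℝ] ℝ)
    (hη : ∀ (x : M) (u v : TangentSpace (𝓡 (2 * n)) x),
      S.componentW5 x u v = η x (S.J x u) • S.J x v) :
    Integrable (fun x ↦ η x (S.charU x)) (riemannianVolume (2 * n) M) ∧
    Integrable S.sReal (riemannianVolume (2 * n) M) ∧
    Integrable S.sAlt (riemannianVolume (2 * n) M) ∧
    8 * ∫ x, η x (S.charU x) ∂(riemannianVolume (2 * n) M) =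
      ∫ x, (S.sReal x - S.sAlt x) ∂(riemannianVolume (2 * n) M) ∧
    ((∀ x, S.torsionU x ∈ classW1 (S.Jend x) ⊔ classW2 (S.Jend x) ⊔ classW3 (S.Jend x)) →
      ∫ x, S.sReal x ∂(riemannianVolume (2 * n) M) =
        ∫ x, S.sAlt x ∂(riemannianVolume (2 * n) M)) := by
  have hI1 := integrable_riemannianVolume (m := 2 * n) S.continuous_sReal
  have hI2 := integrable_riemannianVolume (m := 2 * n) S.continuous_sAlt
  have h := S.eight_mul_integral_inner_charU
  have hI3 := integrable_riemannianVolume (m := 2 * n)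
    (S.continuous_inner_charU S.smoothField_leeField)
  simp only [S.inner_leeField_eq η hη] at h hI3
  refine ⟨hI3, hI1, hI2, h, fun hW ↦ ?_⟩
  have h0 (x) : S.charU x = 0 := charVector_eq_zero (S.J_J x) (S.inner_Jend x) (hW x)
  simp only [h0, map_zero, integral_zero, mul_zero] at h
  rw [integral_sub hI1 hI2] at h
  linarith
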